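/- **Setting.** For $u:\mathbb R^2\to\mathbb C$ and $\varepsilon>0$ put $e_\varepsilon(u)=\frac12|\nabla u|^2+\frac1{4\varepsilon^2}(|u|^2-1)^2$ (weak gradient), $j(u)=(iu,\nabla u)$ with $(v,w)=\mathrm{Re}(v\bar w)$, and $J(u)=\frac12\nabla\times j(u)$ in the sense of distributions. For a distribution $\mu$ let $$\|\mu\|_{X_{\ln}^*}=\sup\Big\{\langle\mu,\phi\rangle:\ \phi\in C^1_c(\mathbb R^2),\ \operatorname*{ess\,sup}_{x}\,(1+\ln^+|x|)\,|D\phi(x)|\le1\Big\}.$$ For an integer $D$ let $U^D:\mathbb R^2\to\mathbb C$ be a fixed smooth function with $U^D=e^{iD\theta}$ outside a compact set and $\frac12\int_{B_R}|\nabla U^D|^2\,dx=\pi D^2\ln R$ for all $R\ge4$, where $B_R$ is the ball of radius $R$ about $0$. Let $[U^D]+H^1$ be the set of all $u=U^D(\cdot-y)+v$ with $y\in\mathbb R^2$ and $v\in H^1(\mathbb R^2;\mathbb C)$, and for such $u$ let $$\mathbb E_\varepsilon(u)=\lim_{R\to\infty}\int_{B_R}\Big[e_\varepsilon(u)-\tfrac12|\nabla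 U^D|^2\Big]\,dx .$$ For $\alpha=(\alpha_1,\dots,\alpha_n)\in(\mathbb R^2)^n$ put $R_\alpha=\max(4,\,4\max_j|\alpha_j|)$. **Proposition.** There exist universal constants $c_1>0$ and $C>0$ such that the following holds. Let $\varepsilon>0$, $s_\varepsilon\in\mathbb R$, $\alpha\in(\mathbb R^2)^n$ and $d\in\mathbb Z^n$ with $D:=\sum_i d_i>0$, and let $u\in[U^D]+H^1$ satisfy $$\Big\|J(u)-\pi\sum_i d_i\delta_{\alpha_i}\Big\|_{X_{\ln}^*}\le s_\varepsilon,\qquad s_\varepsilon D^2\le c_1,\qquad \varepsilon D^2<c_1 .$$ Then $e_\varepsilon(u)$ is locally integrable, the limit defining $\mathbb E_\varepsilon(u)$ exists and is finite, and for all $R_1\ge R_\alpha$ and $R_2\ge2R_1$, $$\int_{B_{R_2}\setminus B_{R_1}}e_\varepsilon(u)\,dx-\pi D^2\ln\frac{R_2}{R_1}\ \ge\ -CD^4\frac{\varepsilon}{R_1}.$$ Consequently, for every $R\ge R_\alpha$, $$\int_{B_R}e_\varepsilon(u)\,dx\ \le\ \mathbb E_\varepsilon(u)+\pi D^2\ln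 R+CD^4\frac{\varepsilon}{R}.$$ -/

import Mathlib

open MeasureTheory Set Filter Topology
open scoped ContDiff

noncomputable section

/-- The Euclidean plane `ℝ²`. -/
abbrev Plane : Type := EuclideanSpace ℝ (Fin 2)

/-- The standard basis vectors of the plane. -/
def planeBasis (i : Fin 2) : Plane := EuclideanSpace.single i (1 : ℝ)

/-- `g` is a weak (distributional) `i`-th partial derivative of `u : ℝ² → ℂ`. -/
def IsWeakPartial (i : Fin 2) (u g : Plane → ℂ) : Prop :=
  LocallyIntegrable u ∧ LocallyIntegrable g ∧
    ∀ φ : Plane → ℝ, ContDiff ℝ ∞ φ → HasCompactSupport φ →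
      ∫ x, (fderiv ℝ φ x (planeBasis i)) • u x = - ∫ x, φ x • g x

open Classical in
/-- The weak `i`-th partial derivative of `u`. It is unique up to null sets when it exists;
the value is `0` when it does not exist. -/
def weakPartial (i : Fin 2) (u : Plane → ℂ) : Plane → ℂ :=
  if h : ∃ g, IsWeakPartial i u g then h.choose else 0

/-- The Sobolev space `H¹(ℝ²; ℂ)`: square integrable functions whose weak first partial
derivatives exist and are square integrable. -/
def MemH1 (v : Plane → ℂ) : Prop :=
  MemLp v 2 ∧ ∀ i : Fin 2, ∃ g, IsWeakPartial i v g ∧ MemLp g 2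

/-- The point of the plane seen as the complex number `x₁ + i x₂`. -/
def planeToComplex (x : Plane) : ℂ := ⟨x 0, x 1⟩

/-- `e^{iDθ}`, where `θ` is the polar angle of `x`. -/
def angularPhase (D : ℤ) (x : Plane) : ℂ := (planeToComplex x / (‖x‖ : ℂ)) ^ D

/-- The (Frobenius) squared norm `|∇U|²` of the gradient of a smooth function. -/
def gradSq (U : Plane → ℂ) (x : Plane) : ℝ :=
  ∑ i : Fin 2, ‖fderiv ℝ U x (planeBasis i)‖ ^ 2

/-- `U` is an admissible choice of the reference map `U^D`: it is smooth, equal to `e^{iDθ}`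
outside a compact set, and normalized by `½ ∫_{B_R} |∇U|² = π D² ln R` for all `R ≥ 4`. -/
structure IsReferenceMap (D : ℤ) (U : Plane → ℂ) : Prop where
  smooth : ContDiff ℝ ∞ U
  eq_phase : ∃ K : Set Plane, IsCompact K ∧ ∀ x, x ∉ K → U x = angularPhase D x
  normalized : ∀ R : ℝ, 4 ≤ R →
    (1 / 2 : ℝ) * ∫ x in Metric.ball (0 : Plane) R, gradSq U x = Real.pi * (D : ℝ) ^ 2 * Real.log R

/-- `u ∈ [U] + H¹(ℝ²; ℂ)`, where `[U]` is the set of all translates of `U`. -/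
def MemTranslatesAddH1 (U u : Plane → ℂ) : Prop :=
  ∃ y : Plane, ∃ v : Plane → ℂ, MemH1 v ∧ ∀ x, u x = U (x - y) + v x

/-- The Ginzburg-Landau energy density
`e_ε(u) = ½ |∇u|² + (1 / (4 ε²)) (|u|² - 1)²`, with the weak gradient of `u`. -/
def energyDensity (ε : ℝ) (u : Plane → ℂ) (x : Plane) : ℝ :=
  (1 / 2) * ∑ i : Fin 2, ‖weakPartial i u x‖ ^ 2 + 1 / (4 * ε ^ 2) * (‖u x‖ ^ 2 - 1) ^ 2

/-- The energy in `B_R` minus that of the reference map, `∫_{B_R} (e_ε(u) - ½ |∇U|²)`. -/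
def excessEnergy (ε : ℝ) (U u : Plane → ℂ) (R : ℝ) : ℝ :=
  ∫ x in Metric.ball (0 : Plane) R, (energyDensity ε u x - (1 / 2) * gradSq U x)

/-- The energy renormalized at infinity,
`𝔼_ε(u) = lim_{R → ∞} ∫_{B_R} (e_ε(u) - ½ |∇U|²)`. -/
def renormalizedEnergy (ε : ℝ) (U u : Plane → ℂ) : ℝ :=
  limUnder atTop (excessEnergy ε U u)

/-- The components of the current `j(u) = (iu, ∇u)`, where `(v, w) = Re (v w̄)`. -/
def current (u : Plane → ℂ) (i : Fin 2) (x : Plane) : ℝ :=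
  ((Complex.I * u x) * (starRingEnd ℂ) (weakPartial i u x)).re

/-- The pairing of the distribution `J(u) = ½ ∇ × j(u) = ½ (∂₁ j₂(u) - ∂₂ j₁(u))` with a compactly
supported `C¹` function `φ`. -/
def jacobianPairing (u : Plane → ℂ) (φ : Plane → ℝ) : ℝ :=
  (1 / 2) * ∫ x, (fderiv ℝ φ x (planeBasis 1) * current u 0 x
    - fderiv ℝ φ x (planeBasis 0) * current u 1 x)

/-- The norm `‖φ‖_{X_ln} = ess sup (1 + ln⁺ |x|) |Dφ(x)|`. -/
def XlnNorm (φ : Plane → ℝ) : ENNReal :=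
  essSup (fun x => ENNReal.ofReal ((1 + Real.posLog ‖x‖) * ‖fderiv ℝ φ x‖)) volume

/-- The norm `‖μ‖_{X_ln^*}` of a distribution, given by its pairing `φ ↦ ⟨μ, φ⟩` with functions
`φ ∈ C¹_c(ℝ²)`: the supremum (possibly `+∞`) of `⟨μ, φ⟩` over `φ ∈ C¹_c(ℝ²)` with
`‖φ‖_{X_ln} ≤ 1`. -/
def XlnDualNorm (μ : (Plane → ℝ) → ℝ) : EReal :=
  ⨆ φ ∈ {φ : Plane → ℝ | ContDiff ℝ 1 φ ∧ HasCompactSupport φ ∧ XlnNorm φ ≤ 1}, ((μ φ : ℝ) : EReal)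

/-- The pairing of `J(u) - π ∑ dᵢ δ_{αᵢ}` with a test function. -/
def vorticityDefect {n : ℕ} (u : Plane → ℂ) (d : Fin n → ℤ) (α : Fin n → Plane)
    (φ : Plane → ℝ) : ℝ :=
  jacobianPairing u φ - Real.pi * ∑ i, (d i : ℝ) * φ (α i)

/-- `R_α = max (4, 4 maxⱼ |αⱼ|)`. -/
def vortexRadius {n : ℕ} (α : Fin n → Plane) : ℝ := max 4 (4 * ⨆ j, ‖α j‖)

end

/-! In logarithmic polar coordinates x = e^t (cos θ, sin θ) an annulus becomes a cylinder, the
Dirichlet energy is conformally invariant and the potential acquires the weight (e^t/ε)². A closed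
curve of winding number D and modulus one has angular energy at least πD². Letting the modulus drop
below one lowers this bound, but the potential charges for it, and the net loss on the circle t is
at most 2πD⁴ε²e^{-2t} (`circle_energy_lower_bound`). Integrated over ln R₁ < t < ln R₂ this gives
πD² ln(R₂/R₁) with an error of at most πD⁴ε²/R₁², which is at most πD⁴ε/R₁.

The vorticity hypothesis must supply the winding number. Testing J(u) with radial functions,
constant near all vortices, bounds the L¹ norm in t of (circulation − 2πD) by a small multiple of
1/D². This is not a pointwise bound, and a crude estimate would leave an error of order sD². A
dichotomy in `IsCylinderMap.energy_lower_bound` removes it. Either every circle has circulation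
within π of 2πD, and the circle bound applies everywhere; or some circle violates this while a very
close one does not. In the latter case the circulation varies by at least π/2 on a short interval.
Since its derivative is controlled by the energy, that costs at least π/4, more than all the losses
together.

These computations need smooth maps. For u = U(· − y) + v only v is mollified. The embedding of H¹
into L⁴ puts the potential under control, so that energies and currents converge in L¹ on bounded
sets, and the lower bound passes to the limit (`annulus_lower_bound`).

The existence of the renormalized energy rests on expanding the square. All terms are integrable
except ∇U·∇v, because ∇U decays only like 1/|x|. As U has no radial derivative at infinity,
integration by parts on a large ball has no boundary term (`integral_ball_inner_fderiv`), and ΔU·v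
is integrable because ΔU = O(|x|⁻²). The upper bound on a ball follows by subtracting the annulus
bound from the energy of B_{R'}, using the normalization of U, and letting R' tend to infinity. -/

/-! ### Energy of closed curves with prescribed circulation. -/

/-- The logarithmic derivative of a nonvanishing closed curve integrates to a multiple of `2πi`. -/
theorem exists_int_integral_logDeriv {f f' : ℝ → ℂ} {a b : ℝ} (hab : a ≤ b)
    (hf : ∀ θ, HasDerivAt f (f' θ) θ) (hf' : Continuous f') (hper : f b = f a)
    (hne : ∀ θ ∈ Icc a b, f θ ≠ 0) :
    ∃ k : ℤ, ∫ θ in a..b, f' θ / f θ = k * (2 * Real.pi * Complex.I) := by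
  have hfc : Continuous f := continuous_iff_continuousAt.2 fun θ => (hf θ).continuousAt
  have hcont : ContinuousOn (fun θ => f' θ / f θ) (Icc a b) :=
    hf'.continuousOn.div hfc.continuousOn hne
  set F : ℝ → ℂ := fun θ => ∫ t in a..θ, f' t / f t with hF
  have hint : IntervalIntegrable (fun θ => f' θ / f θ) volume a b :=
    (hcont.mono (by rw [uIcc_of_le hab])).intervalIntegrable
  have hFc : ContinuousOn F (Icc a b) := by
    have := intervalIntegral.continuousOn_primitive_interval (μ := volume)
      (f := fun θ => f' θ / f θ) (a := a) (b := b)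
      (by rw [uIcc_of_le hab]; exact hcont.integrableOn_Icc)
    rwa [uIcc_of_le hab] at this
  -- The product f·e^{-F} has zero derivative; comparing its values at the two ends forces e^{-F(b)}
  -- = 1. Since f is known not to vanish only on the closed interval, F is differentiated from the
  -- right.
  have hconst : ∀ x ∈ Icc a b, f x * Complex.exp (-F x) = f a * Complex.exp (-F a) := by
    apply constant_of_has_deriv_right_zero
    · exact hfc.continuousOn.mul (Complex.continuous_exp.comp_continuousOn hFc.neg)
    · intro x hx
      have hx' : x ∈ Icc a b := Ico_subset_Icc_self hx
      have h1 : HasDerivWithinAt F (f' x / f x) (Ici x) x := by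
        have hmem : Icc a b ∈ 𝓝[>] x := 
          mem_of_superset (Ioc_mem_nhdsGT hx.2)
            (fun y hy => ⟨hx.1.trans hy.1.le, hy.2⟩)
        refine intervalIntegral.integral_hasDerivWithinAt_right
          (hint.mono_set ?_) (s := Ici x) (t := Ioi x) ?_ ?_
        · rw [uIcc_of_le hab, uIcc_of_le hx.1]; exact Icc_subset_Icc_right hx'.2
        · exact ⟨Icc a b, hmem,
            (hcont.aestronglyMeasurable measurableSet_Icc)⟩
        · exact (hcont x hx').mono_of_mem_nhdsWithin hmem
      have h2 := (hf x).hasDerivWithinAt (s := Ici x) |>.mul (h1.neg.cexp)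
      refine HasDerivWithinAt.congr_deriv (f := fun x => f x * Complex.exp (-F x)) h2 ?_
      have := hne x hx'
      simp only [Pi.neg_apply]
      field_simp
      ring
  have h1 := hconst b (right_mem_Icc.2 hab)
  have ha : F a = 0 := by simp [hF]
  rw [hper, ha, neg_zero, Complex.exp_zero] at h1
  have h2 : Complex.exp (-F b) = 1 :=
    mul_left_cancel₀ (hne a (left_mem_Icc.2 hab)) h1
  rw [Complex.exp_eq_one_iff] at h2
  obtain ⟨n, hn⟩ := h2
  refine ⟨-n, ?_⟩
  have : F b = -(n * (2 * Real.pi * Complex.I)) := by rw [← hn]; ring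
  show F b = _
  rw [this]; push_cast; ring

/-- The Ginzburg-Landau density on a circle, in the angular variable. -/
noncomputable def circleDensity (μ : ℝ) (z z' : ℂ) : ℝ :=
  1 / 2 * ‖z'‖ ^ 2 + μ ^ 2 / 4 * (‖z‖ ^ 2 - 1) ^ 2

theorem circleDensity_nonneg (μ : ℝ) (z z' : ℂ) : 0 ≤ circleDensity μ z z' := by
  unfold circleDensity; positivity

/-- The arithmetic-geometric inequality between the two terms of the density. The factor 1/μ is what
makes both the modulus and the circulation rigid when μ is large. -/
theorem abs_mul_norm_le_circleDensity {μ : ℝ} (hμ : 0 < μ) (z z' : ℂ) :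
    |‖z‖ ^ 2 - 1| * ‖z'‖ ≤ 2 / μ * circleDensity μ z z' := by
  unfold circleDensity
  rw [div_mul_eq_mul_div, le_div_iff₀ hμ, ← sq_abs (‖z‖ ^ 2 - 1)]
  nlinarith [sq_nonneg (‖z'‖ - μ * |‖z‖ ^ 2 - 1|), sq_nonneg ‖z'‖]

theorem continuous_circleDensity {μ : ℝ} {X : Type*} [TopologicalSpace X] {f f' : X → ℂ}
    (hf : Continuous f) (hf' : Continuous f') :
    Continuous fun θ => circleDensity μ (f θ) (f' θ) := by
  unfold circleDensity; fun_prop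

open Real in
/-- A closed curve of small energy stays close to the unit circle. -/
theorem abs_normSq_sub_one_le_half {f f' : ℝ → ℂ}
    (hf : ∀ θ, HasDerivAt f (f' θ) θ) (hf' : Continuous f') {D : ℝ} (hD : 1 ≤ D) {μ : ℝ}
    (hDμ : D ^ 2 ≤ μ / 1000)
    (hA : ∫ θ in (-π)..π, circleDensity μ (f θ) (f' θ) ≤ π * D ^ 2) :
    ∀ θ ∈ Icc (-π) π, |‖f θ‖ ^ 2 - 1| ≤ 1 / 2 := by
  have hμ : 0 < μ := by nlinarith
  have hpi := pi_pos
  have hpp : -π ≤ π := by linarith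
  have hfc : Continuous f := continuous_iff_continuousAt.2 fun θ => (hf θ).continuousAt
  have hec := continuous_circleDensity (μ := μ) hfc hf'
  set A := ∫ θ in (-π)..π, circleDensity μ (f θ) (f' θ) with hAdef
  set q : ℝ → ℝ := fun θ => ‖f θ‖ ^ 2 - 1 with hq
  have hqc : Continuous q := by fun_prop
  set q' : ℝ → ℝ := fun θ => 2 * inner ℝ (f θ) (f' θ) with hq'
  have hqd : ∀ θ, HasDerivAt q (q' θ) θ := fun θ => ((hf θ).norm_sq).sub_const 1
  have hq'c : Continuous q' := by fun_prop
  obtain ⟨θ₁, hθ₁, hmax⟩ := isCompact_Icc.exists_isMaxOn (nonempty_Icc.2 hpp)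
    (hqc.abs.continuousOn (s := Icc (-π) π))
  set N := |q θ₁| with hN
  have hN0 : 0 ≤ N := abs_nonneg _
  have hmax' : ∀ θ ∈ Icc (-π) π, |q θ| ≤ N := fun θ hθ => hmax hθ
  -- The derivative of q² is bounded by 4|q||f||f'|, with |f| ≤ 1 + N; hence q² oscillates by at
  -- most a multiple of A/μ around its maximum N².
  have hdiff : ∀ θ ∈ Icc (-π) π, N ^ 2 ≤ q θ ^ 2 + 8 * (1 + N) / μ * A := by
    intro θ hθ
    have h1 : ∫ t in θ..θ₁, 2 * q t * q' t = q θ₁ ^ 2 - q θ ^ 2 := by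
      apply intervalIntegral.integral_eq_sub_of_hasDerivAt
      · intro x _
        exact ((hqd x).pow 2).congr_deriv (by norm_num)
      · exact (by fun_prop : Continuous fun t => 2 * q t * q' t).intervalIntegrable _ _
    have h2 : |∫ t in θ..θ₁, 2 * q t * q' t| ≤ 8 * (1 + N) / μ * A := by
      have hsub : uIoc θ θ₁ ⊆ Ioc (-π) π := by
        intro x hx
        rw [uIoc, mem_Ioc] at hx
        exact ⟨(le_min hθ.1 hθ₁.1).trans_lt hx.1, hx.2.trans (max_le hθ.2 hθ₁.2)⟩
      have hb : ∀ t ∈ Icc (-π) π, ‖2 * q t * q' t‖ ≤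
          8 * (1 + N) / μ * circleDensity μ (f t) (f' t) := by
        intro t ht
        have e1 : |inner ℝ (f t) (f' t)| ≤ ‖f t‖ * ‖f' t‖ := abs_real_inner_le_norm _ _
        have e2 := abs_mul_norm_le_circleDensity hμ (f t) (f' t)
        have e3 : ‖f t‖ ≤ 1 + N := by
          have := (abs_le.1 (hmax' t ht)).2
          simp only [hq] at this
          nlinarith [norm_nonneg (f t)]
        have e4 : ‖2 * q t * q' t‖ = 4 * (|q t| * |inner ℝ (f t) (f' t)|) := by
          simp only [hq', norm_mul, Real.norm_eq_abs, abs_two]; ring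
        rw [e4]
        calc 4 * (|q t| * |inner ℝ (f t) (f' t)|) ≤ 4 * (|q t| * (‖f t‖ * ‖f' t‖)) := by gcongr
          _ = 4 * (‖f t‖ * (|q t| * ‖f' t‖)) := by ring
          _ ≤ 4 * ((1 + N) * (2 / μ * circleDensity μ (f t) (f' t))) := by gcongr
          _ = _ := by ring
      calc |∫ t in θ..θ₁, 2 * q t * q' t| ≤ ∫ t in uIoc θ θ₁, ‖2 * q t * q' t‖ := by
            rw [← Real.norm_eq_abs]; exact intervalIntegral.norm_integral_le_integral_norm_uIoc
        _ ≤ ∫ t in Ioc (-π) π, ‖2 * q t * q' t‖ := by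
            apply setIntegral_mono_set
            · exact ((by fun_prop : Continuous fun t => ‖2 * q t * q' t‖).integrableOn_Ioc)
            · exact ae_of_all _ fun x => norm_nonneg _
            · exact hsub.eventuallyLE
        _ ≤ ∫ t in Ioc (-π) π, 8 * (1 + N) / μ * circleDensity μ (f t) (f' t) := by
            apply setIntegral_mono_on
            · exact ((by fun_prop : Continuous fun t => ‖2 * q t * q' t‖).integrableOn_Ioc)
            · exact ((continuous_const.mul hec).integrableOn_Ioc)
            · exact measurableSet_Ioc
            · exact fun x hx => hb x (Ioc_subset_Icc_self hx)
        _ = 8 * (1 + N) / μ * A := by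
            rw [integral_const_mul, hAdef, intervalIntegral.integral_of_le hpp]
    have h3 := (abs_le.1 h2).2
    have h4 : N ^ 2 = q θ₁ ^ 2 := sq_abs _
    linarith
  have hsq : μ ^ 2 / 4 * ∫ θ in (-π)..π, q θ ^ 2 ≤ A := by
    rw [← intervalIntegral.integral_const_mul]
    apply intervalIntegral.integral_mono_on hpp
    · exact (by fun_prop : Continuous fun t => μ ^ 2 / 4 * q t ^ 2).intervalIntegrable _ _
    · exact hec.intervalIntegrable _ _
    · intro x _
      unfold circleDensity
      nlinarith [sq_nonneg ‖f' x‖]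
  -- Averaging over θ replaces q(θ)² by its integral, which the potential term bounds by 4A/μ².
  have hint : ∫ θ in (-π)..π, N ^ 2 ≤ ∫ θ in (-π)..π, (q θ ^ 2 + 8 * (1 + N) / μ * A) := by
    apply intervalIntegral.integral_mono_on hpp
    · simp
    · exact (by fun_prop : Continuous fun t => q t ^ 2 + 8 * (1 + N) / μ * A).intervalIntegrable _ _
    · exact hdiff
  rw [intervalIntegral.integral_add ((by fun_prop : Continuous fun t => q t ^ 2).intervalIntegrable _ _)
    (by simp)] at hint
  simp only [intervalIntegral.integral_const, smul_eq_mul] at hint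
  have hAμ : A / μ ≤ π / 1000 := by
    rw [div_le_iff₀ hμ]; nlinarith
  have hQ : ∫ θ in (-π)..π, q θ ^ 2 ≤ π / 1000 := by
    have h5 : μ ^ 2 / 4 * ∫ θ in (-π)..π, q θ ^ 2 ≤ μ ^ 2 / 4 * (π / 1000) := by
      refine hsq.trans ?_
      have : A ≤ π / 1000 * μ := by rwa [div_le_iff₀ hμ] at hAμ
      have h1000 : 1000 ≤ μ := by nlinarith
      have : μ * 1 ≤ μ ^ 2 / 4 := by nlinarith
      nlinarith
    exact le_of_mul_le_mul_left h5 (by positivity)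
  have h6 : 8 * (1 + N) / μ * A = 8 * (1 + N) * (A / μ) := by ring
  rw [h6] at hint
  have h7 : 8 * (1 + N) * (A / μ) ≤ 8 * (1 + N) * (π / 1000) := by gcongr
  have h8 : N ^ 2 * (2 * π) ≤ (1 / 1000 + 16 * (1 + N) * (π / 1000)) * π := by nlinarith
  have h9 : N ^ 2 * 2 ≤ 1 / 1000 + 16 * (1 + N) * (π / 1000) := by
    refine le_of_mul_le_mul_right ?_ hpi; linarith
  have h10 : N ≤ 1 / 2 := by
    by_contra h
    push Not at h
    nlinarith [pi_lt_four]
  exact fun θ hθ => (hmax' θ hθ).trans h10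

open Real in
/-- Lower bound for the energy on a circle along which the circulation is close to `2πD`. -/
theorem circle_energy_lower_bound {f f' : ℝ → ℂ}
    (hf : ∀ θ, HasDerivAt f (f' θ) θ) (hf' : Continuous f') (hper : f π = f (-π))
    {D : ℤ} (hD : 1 ≤ D) {μ : ℝ} (hDμ : (D : ℝ) ^ 2 ≤ μ / 1000)
    (hM : |(∫ θ in (-π)..π, ((starRingEnd ℂ) (f θ) * f' θ).im) - 2 * π * D| < π) :
    π * (D : ℝ) ^ 2 - 2 * π * (D : ℝ) ^ 4 / μ ^ 2 ≤
      ∫ θ in (-π)..π, circleDensity μ (f θ) (f' θ) := by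
  have hD' : (1 : ℝ) ≤ D := by exact_mod_cast hD
  have hμ : 0 < μ := by nlinarith
  have hpi := pi_pos
  have hpp : -π ≤ π := by linarith
  -- If the energy already exceeds πD² nothing is left to prove; otherwise it is small compared with
  -- μ, so the curve avoids 0 and has a winding number k.
  by_cases hA : π * (D : ℝ) ^ 2 < ∫ θ in (-π)..π, circleDensity μ (f θ) (f' θ)
  · have : 0 ≤ 2 * π * (D : ℝ) ^ 4 / μ ^ 2 := by positivity
    linarith
  push Not at hA
  have hhalf := abs_normSq_sub_one_le_half hf hf' hD' hDμ hA
  have hfc : Continuous f := continuous_iff_continuousAt.2 fun θ => (hf θ).continuousAt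
  have hec := continuous_circleDensity (μ := μ) hfc hf'
  have hρ : ∀ θ ∈ Icc (-π) π, 1 / 2 ≤ ‖f θ‖ ^ 2 := fun θ hθ => by
    have := (abs_le.1 (hhalf θ hθ)).1; linarith
  have hne : ∀ θ ∈ Icc (-π) π, f θ ≠ 0 := fun θ hθ h0 => by
    have := hρ θ hθ; rw [h0] at this; norm_num at this
  obtain ⟨k, hk⟩ := exists_int_integral_logDeriv hpp hf hf' hper hne
  set om : ℝ → ℝ := fun θ => (f' θ / f θ).im with hom
  have hcont : ContinuousOn (fun θ => f' θ / f θ) (uIcc (-π) π) := by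
    rw [uIcc_of_le hpp]; exact hf'.continuousOn.div hfc.continuousOn hne
  have homc : ContinuousOn om (uIcc (-π) π) := Complex.continuous_im.comp_continuousOn hcont
  have homint : ∫ θ in (-π)..π, om θ = 2 * π * k := by
    have h1 : ∫ θ in (-π)..π, om θ = (∫ θ in (-π)..π, f' θ / f θ).im := by
      have := (Complex.imCLM.intervalIntegral_comp_comm (hcont.intervalIntegrable (μ := volume)))
      simpa using this
    rw [h1, hk]
    simp
    ring
  -- the circulation density is `|f|² om`
  have hjom : ∀ θ ∈ Icc (-π) π, ((starRingEnd ℂ) (f θ) * f' θ).im = ‖f θ‖ ^ 2 * om θ := by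
    intro θ hθ
    have h0 := hne θ hθ
    have : (starRingEnd ℂ) (f θ) * f' θ = ((‖f θ‖ ^ 2 : ℝ) : ℂ) * (f' θ / f θ) := by
      rw [Complex.ofReal_pow, ← Complex.conj_mul']
      field_simp
    rw [this, Complex.im_ofReal_mul]
  have homle : ∀ θ ∈ Icc (-π) π, ‖f θ‖ * |om θ| ≤ ‖f' θ‖ := by
    intro θ hθ
    have h0 := hne θ hθ
    calc ‖f θ‖ * |om θ| ≤ ‖f θ‖ * ‖f' θ / f θ‖ := by
          gcongr; exact Complex.abs_im_le_norm _
      _ = ‖f' θ‖ := by rw [norm_div]; field_simp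
  set A := ∫ θ in (-π)..π, circleDensity μ (f θ) (f' θ) with hAdef
  have hjc : Continuous fun θ => ((starRingEnd ℂ) (f θ) * f' θ).im := by fun_prop
  -- The circulation differs from 2πk by at most 4A/μ ≤ π/2 and from 2πD by less than π, so |k − D|
  -- < 1.
  have hkD : k = D := by
    have h1 : |(∫ θ in (-π)..π, ((starRingEnd ℂ) (f θ) * f' θ).im) - 2 * π * k| ≤ 4 / μ * A := by
      rw [← homint, ← intervalIntegral.integral_sub (hjc.intervalIntegrable _ _)
        homc.intervalIntegrable, ← Real.norm_eq_abs, hAdef, ← intervalIntegral.integral_const_mul]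
      apply intervalIntegral.norm_integral_le_of_norm_le hpp
      · refine ae_of_all _ fun θ hθ => ?_
        have hθ' := Ioc_subset_Icc_self hθ
        rw [hjom θ hθ', Real.norm_eq_abs,
          show ‖f θ‖ ^ 2 * om θ - om θ = (‖f θ‖ ^ 2 - 1) * om θ by ring, abs_mul]
        have e1 := abs_mul_norm_le_circleDensity hμ (f θ) (f' θ)
        have e2 : |om θ| ≤ 2 * ‖f' θ‖ := by
          have := homle θ hθ'
          have h2 := hρ θ hθ'
          have h3 : 1 / 2 ≤ ‖f θ‖ := by nlinarith [norm_nonneg (f θ)]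
          nlinarith [abs_nonneg (om θ)]
        calc |‖f θ‖ ^ 2 - 1| * |om θ| ≤ |‖f θ‖ ^ 2 - 1| * (2 * ‖f' θ‖) := by gcongr
          _ = 2 * (|‖f θ‖ ^ 2 - 1| * ‖f' θ‖) := by ring
          _ ≤ 2 * (2 / μ * circleDensity μ (f θ) (f' θ)) := by gcongr
          _ = _ := by ring
      · exact (continuous_const.mul hec).intervalIntegrable _ _
    have h2 : 4 / μ * A ≤ π / 2 := by
      rw [div_mul_eq_mul_div, div_le_iff₀ hμ]; nlinarith
    have h3 : |2 * π * (k : ℝ) - 2 * π * D| < 2 * π := by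
      have := abs_sub_le (2 * π * (k : ℝ))
        (∫ θ in (-π)..π, ((starRingEnd ℂ) (f θ) * f' θ).im) (2 * π * D)
      rw [abs_sub_comm (2 * π * (k : ℝ)) (∫ θ in (-π)..π, _)] at this
      linarith
    have h4 : |((k - D : ℤ) : ℝ)| < 1 := by
      rw [← mul_sub, abs_mul, abs_of_pos (by positivity : 0 < 2 * π)] at h3
      push_cast
      nlinarith
    have h5 : |k - D| < 1 := by exact_mod_cast h4
    have := Int.abs_lt_one_iff.1 h5
    omega
  rw [hkD] at homint
  -- A pointwise bound affine in `om`, whose integral is the known number 2πD. It comes from P·om² ≥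
  -- 2D·om − D²/P, followed by replacing 1/P with 1 and absorbing the error D²|P − 1| into the
  -- potential by completing a square.
  have hlow : ∀ θ ∈ Icc (-π) π,
      D * om θ - (D : ℝ) ^ 2 / 2 - (D : ℝ) ^ 4 / μ ^ 2 ≤ circleDensity μ (f θ) (f' θ) := by
    intro θ hθ
    set P := ‖f θ‖ ^ 2 with hP
    have hP2 := hρ θ hθ
    have e1 : P * om θ ^ 2 ≤ ‖f' θ‖ ^ 2 := by
      rw [hP, ← sq_abs (om θ), ← mul_pow]
      have := homle θ hθ
      gcongr
    have e2 : 2 * D * om θ - (D : ℝ) ^ 2 / P ≤ P * om θ ^ 2 := by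
      have : 0 ≤ P * (om θ - D / P) ^ 2 := by positivity
      have e : P * (om θ - D / P) ^ 2 = P * om θ ^ 2 - 2 * D * om θ + (D : ℝ) ^ 2 / P := by
        have : P ≠ 0 := by intro h; rw [← hP, h] at hP2; norm_num at hP2
        field_simp; ring
      linarith
    have e3 : 1 / P ≤ 1 + 2 * |P - 1| := by
      rw [div_le_iff₀ (by linarith)]
      rcases le_total P 1 with h | h
      · rw [abs_of_nonpos (by linarith)]; nlinarith
      · rw [abs_of_nonneg (by linarith)]; nlinarith
    have e4 : (D : ℝ) ^ 2 / P ≤ (D : ℝ) ^ 2 * (1 + 2 * |P - 1|) := by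
      rw [div_eq_mul_one_div]; gcongr
    have e5 : -((D : ℝ) ^ 4 / μ ^ 2) ≤ μ ^ 2 / 4 * (P - 1) ^ 2 - (D : ℝ) ^ 2 * |P - 1| := by
      rw [← sq_abs (P - 1)]
      have : 0 ≤ (μ / 2 * |P - 1| - (D : ℝ) ^ 2 / μ) ^ 2 := sq_nonneg _
      have e : (μ / 2 * |P - 1| - (D : ℝ) ^ 2 / μ) ^ 2 =
        μ ^ 2 / 4 * |P - 1| ^ 2 - (D : ℝ) ^ 2 * |P - 1| + (D : ℝ) ^ 4 / μ ^ 2 := by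
        field_simp; ring
      linarith
    unfold circleDensity
    rw [← hP]
    linarith
  have homi : IntervalIntegrable (fun θ => D * om θ) volume (-π) π :=
    homc.intervalIntegrable.const_mul _
  have homi' : IntervalIntegrable (fun θ => D * om θ - (D : ℝ) ^ 2 / 2) volume (-π) π :=
    homi.sub intervalIntegrable_const
  have hfin := intervalIntegral.integral_mono_on hpp
    (f := fun θ => D * om θ - (D : ℝ) ^ 2 / 2 - (D : ℝ) ^ 4 / μ ^ 2)
    (homi'.sub intervalIntegrable_const)
    (hec.intervalIntegrable _ _) hlow
  rw [intervalIntegral.integral_sub homi' intervalIntegrable_const,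
    intervalIntegral.integral_sub homi intervalIntegrable_const,
    intervalIntegral.integral_const_mul, homint] at hfin
  simp only [intervalIntegral.integral_const, smul_eq_mul] at hfin
  refine le_trans (le_of_eq ?_) hfin
  ring

/-! ### Circulation and energy on a cylinder. -/

/-- A twice differentiable map `W(t, θ)` on the cylinder, together with its partial derivatives
`∂ₜW`, `∂_θW` and `∂ₜ∂_θW`. -/
structure IsCylinderMap (W Wt Wθ Wm : ℝ → ℝ → ℂ) : Prop where
  deriv_t : ∀ t θ, HasDerivAt (fun t => W t θ) (Wt t θ) t
  deriv_θ : ∀ t θ, HasDerivAt (fun θ => W t θ) (Wθ t θ) θ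
  deriv_θt : ∀ t θ, HasDerivAt (fun t => Wθ t θ) (Wm t θ) t
  deriv_tθ : ∀ t θ, HasDerivAt (fun θ => Wt t θ) (Wm t θ) θ
  cont : Continuous (Function.uncurry W)
  cont_t : Continuous (Function.uncurry Wt)
  cont_θ : Continuous (Function.uncurry Wθ)
  cont_m : Continuous (Function.uncurry Wm)
  periodic : ∀ t, W t Real.pi = W t (-Real.pi)
  periodic_t : ∀ t, Wt t Real.pi = Wt t (-Real.pi)

/-- The circulation `∫ Im (W̄ ∂_θ W) dθ` of `W` along a circle. -/
noncomputable def circulation (W Wθ : ℝ → ℝ → ℂ) (t : ℝ) : ℝ :=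
  ∫ θ in (-Real.pi)..Real.pi, ((starRingEnd ℂ) (W t θ) * Wθ t θ).im

/-- The Ginzburg-Landau energy of a circle in logarithmic polar coordinates. -/
noncomputable def cylinderEnergy (ε : ℝ) (W Wt Wθ : ℝ → ℝ → ℂ) (t : ℝ) : ℝ :=
  ∫ θ in (-Real.pi)..Real.pi,
    (1 / 2 * ‖Wt t θ‖ ^ 2 + circleDensity (Real.exp t / ε) (W t θ) (Wθ t θ))

namespace IsCylinderMap

open Real

variable {W Wt Wθ Wm : ℝ → ℝ → ℂ} (h : IsCylinderMap W Wt Wθ Wm)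

include h

theorem continuous_circulation : Continuous (circulation W Wθ) := by
  apply intervalIntegral.continuous_parametric_intervalIntegral_of_continuous'
  have h1 := h.cont
  have h2 := h.cont_θ
  simp only [Function.uncurry_def] at h1 h2 ⊢
  fun_prop

theorem continuous_cylinderDensity (ε : ℝ) : Continuous (Function.uncurry fun t θ =>
    1 / 2 * ‖Wt t θ‖ ^ 2 + circleDensity (exp t / ε) (W t θ) (Wθ t θ)) := by
  have h1 := h.cont
  have h2 := h.cont_θ
  have h3 := h.cont_t
  simp only [Function.uncurry_def, circleDensity] at h1 h2 h3 ⊢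
  fun_prop

theorem continuous_cylinderEnergy (ε : ℝ) : Continuous (cylinderEnergy ε W Wt Wθ) :=
  intervalIntegral.continuous_parametric_intervalIntegral_of_continuous'
    (h.continuous_cylinderDensity ε) _ _

omit h in
theorem cylinderEnergy_nonneg (ε t : ℝ) : 0 ≤ cylinderEnergy ε W Wt Wθ t := by
  have hpp : -π ≤ π := by linarith [pi_pos]
  refine intervalIntegral.integral_nonneg hpp fun θ _ => ?_
  have := circleDensity_nonneg (exp t / ε) (W t θ) (Wθ t θ)
  positivity

theorem circle_le_cylinderEnergy (ε t : ℝ) :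
    ∫ θ in (-π)..π, circleDensity (exp t / ε) (W t θ) (Wθ t θ) ≤ cylinderEnergy ε W Wt Wθ t := by
  have hpp : -π ≤ π := by linarith [pi_pos]
  have hW : Continuous (W t) := h.cont.comp (Continuous.prodMk_right t)
  have hWθ : Continuous (Wθ t) := h.cont_θ.comp (Continuous.prodMk_right t)
  refine intervalIntegral.integral_mono_on hpp
    ((continuous_circleDensity hW hWθ).intervalIntegrable _ _)
    (((h.continuous_cylinderDensity ε).comp (Continuous.prodMk_right t)).intervalIntegrable _ _)
    fun θ _ => ?_
  nlinarith [sq_nonneg ‖Wt t θ‖]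

/-- Differentiating under the integral produces Im(W̄ ∂ₜ∂_θW); integrating that term by parts in θ,
where periodicity kills the boundary values, leaves twice the Jacobian of W. -/
theorem circulation_sub (t₁ t₂ : ℝ) : circulation W Wθ t₂ - circulation W Wθ t₁ =
    ∫ t in t₁..t₂, ∫ θ in (-π)..π, (((starRingEnd ℂ) (Wt t θ) * Wθ t θ).im
      - ((starRingEnd ℂ) (Wθ t θ) * Wt t θ).im) := by
  have c0 := h.cont
  have c1 := h.cont_t
  have c2 := h.cont_θ
  have c3 := h.cont_m
  simp only [Function.uncurry_def] at c0 c1 c2 c3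
  have hconj : ∀ {f : ℝ → ℂ} {f' : ℂ} {x : ℝ}, HasDerivAt f f' x →
      HasDerivAt (fun x => (starRingEnd ℂ) (f x)) ((starRingEnd ℂ) f') x := fun hf =>
    (Complex.conjCLE : ℂ →L[ℝ] ℂ).hasFDerivAt.comp_hasDerivAt _ hf
  have him : ∀ {f : ℝ → ℂ} {f' : ℂ} {x : ℝ}, HasDerivAt f f' x →
      HasDerivAt (fun x => (f x).im) f'.im x := fun hf =>
    Complex.imCLM.hasFDerivAt.comp_hasDerivAt _ hf
  have slice : ∀ {f : ℝ × ℝ → ℝ} (_ : Continuous f) (t : ℝ), Continuous fun θ => f (t, θ) :=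
    fun hf t => hf.comp (Continuous.prodMk_right t)
  have slice' : ∀ {f : ℝ × ℝ → ℝ} (_ : Continuous f) (θ : ℝ), Continuous fun t => f (t, θ) :=
    fun hf t => hf.comp (Continuous.prodMk_left t)
  have hj : Continuous fun p : ℝ × ℝ => ((starRingEnd ℂ) (W p.1 p.2) * Wθ p.1 p.2).im := by fun_prop
  have ha : Continuous fun p : ℝ × ℝ => ((starRingEnd ℂ) (Wt p.1 p.2) * Wθ p.1 p.2).im := by
    fun_prop
  have hb : Continuous fun p : ℝ × ℝ => ((starRingEnd ℂ) (W p.1 p.2) * Wm p.1 p.2).im := by fun_prop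
  have hc : Continuous fun p : ℝ × ℝ => ((starRingEnd ℂ) (Wθ p.1 p.2) * Wt p.1 p.2).im := by
    fun_prop
  have h1 : ∀ θ, ∫ t in t₁..t₂, (((starRingEnd ℂ) (Wt t θ) * Wθ t θ).im
      + ((starRingEnd ℂ) (W t θ) * Wm t θ).im) =
      ((starRingEnd ℂ) (W t₂ θ) * Wθ t₂ θ).im - ((starRingEnd ℂ) (W t₁ θ) * Wθ t₁ θ).im := by
    intro θ
    refine intervalIntegral.integral_eq_sub_of_hasDerivAt
      (f := fun t => ((starRingEnd ℂ) (W t θ) * Wθ t θ).im) (fun t _ => ?_)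
      ((slice' (ha.add hb) θ).intervalIntegrable _ _)
    rw [← Complex.add_im]
    exact him ((hconj (h.deriv_t t θ)).mul (h.deriv_θt t θ))
  have h2 : ∀ t, ∫ θ in (-π)..π, ((starRingEnd ℂ) (W t θ) * Wm t θ).im =
      - ∫ θ in (-π)..π, ((starRingEnd ℂ) (Wθ t θ) * Wt t θ).im := by
    intro t
    have : ∫ θ in (-π)..π, (((starRingEnd ℂ) (Wθ t θ) * Wt t θ).im
      + ((starRingEnd ℂ) (W t θ) * Wm t θ).im) =
      ((starRingEnd ℂ) (W t π) * Wt t π).im - ((starRingEnd ℂ) (W t (-π)) * Wt t (-π)).im := by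
      refine intervalIntegral.integral_eq_sub_of_hasDerivAt
        (f := fun θ => ((starRingEnd ℂ) (W t θ) * Wt t θ).im) (fun θ _ => ?_)
        ((slice (hc.add hb) t).intervalIntegrable _ _)
      rw [← Complex.add_im]
      exact him ((hconj (h.deriv_θ t θ)).mul (h.deriv_tθ t θ))
    rw [h.periodic, h.periodic_t, sub_self, intervalIntegral.integral_add
      ((slice hc t).intervalIntegrable _ _) ((slice hb t).intervalIntegrable _ _)] at this
    linarith
  calc circulation W Wθ t₂ - circulation W Wθ t₁
      = ∫ θ in (-π)..π, ∫ t in t₁..t₂, (((starRingEnd ℂ) (Wt t θ) * Wθ t θ).im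
        + ((starRingEnd ℂ) (W t θ) * Wm t θ).im) := by
        simp_rw [h1]
        rw [circulation, circulation, ← intervalIntegral.integral_sub
          ((slice hj t₂).intervalIntegrable _ _) ((slice hj t₁).intervalIntegrable _ _)]
    _ = ∫ t in t₁..t₂, ∫ θ in (-π)..π, (((starRingEnd ℂ) (Wt t θ) * Wθ t θ).im
        + ((starRingEnd ℂ) (W t θ) * Wm t θ).im) := by
        apply intervalIntegral_intervalIntegral_swap
        refine (((ha.add hb).comp continuous_swap).continuousOn (s := uIcc (-π) π ×ˢ uIcc t₁ t₂)
          |>.integrableOn_compact (isCompact_uIcc.prod isCompact_uIcc)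
          |>.mono_set (prod_mono uIoc_subset_uIcc uIoc_subset_uIcc))
    _ = _ := by
        congr 1; ext t
        rw [intervalIntegral.integral_add ((slice ha t).intervalIntegrable _ _)
          ((slice hb t).intervalIntegrable _ _), h2, intervalIntegral.integral_sub
          ((slice ha t).intervalIntegrable _ _) ((slice hc t).intervalIntegrable _ _)]
        ring

/-- The Jacobian is bounded pointwise by |∂ₜW||∂_θW|, hence by the energy density. Rapid changes of
the circulation are therefore expensive. -/
theorem abs_circulation_sub_le (ε : ℝ) {t₁ t₂ : ℝ} (ht : t₁ ≤ t₂) :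
    |circulation W Wθ t₂ - circulation W Wθ t₁| ≤ 2 * ∫ t in t₁..t₂, cylinderEnergy ε W Wt Wθ t := by
  have hpp : -π ≤ π := by linarith [pi_pos]
  rw [h.circulation_sub, ← Real.norm_eq_abs, ← intervalIntegral.integral_const_mul]
  refine intervalIntegral.norm_integral_le_of_norm_le ht (ae_of_all _ fun t _ => ?_)
    ((continuous_const.mul (h.continuous_cylinderEnergy ε)).intervalIntegrable _ _)
  rw [cylinderEnergy, ← intervalIntegral.integral_const_mul]
  refine intervalIntegral.norm_integral_le_of_norm_le hpp (ae_of_all _ fun θ _ => ?_)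
    (((h.continuous_cylinderDensity ε).comp (Continuous.prodMk_right t)).const_smul (2 : ℝ)
      |>.intervalIntegrable _ _)
  have e1 : |((starRingEnd ℂ) (Wt t θ) * Wθ t θ).im| ≤ ‖Wt t θ‖ * ‖Wθ t θ‖ := by
    refine (Complex.abs_im_le_norm _).trans (by simp)
  have e2 : |((starRingEnd ℂ) (Wθ t θ) * Wt t θ).im| ≤ ‖Wt t θ‖ * ‖Wθ t θ‖ := by
    refine (Complex.abs_im_le_norm _).trans (by simp [mul_comm])
  have e3 : 1 / 2 * ‖Wθ t θ‖ ^ 2 ≤ circleDensity (exp t / ε) (W t θ) (Wθ t θ) := by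
    unfold circleDensity
    have : 0 ≤ (exp t / ε) ^ 2 / 4 * (‖W t θ‖ ^ 2 - 1) ^ 2 := by positivity
    linarith
  calc _ ≤ _ := norm_sub_le _ _
    _ ≤ ‖Wt t θ‖ * ‖Wθ t θ‖ + ‖Wt t θ‖ * ‖Wθ t θ‖ := add_le_add e1 e2
    _ ≤ _ := by nlinarith [sq_nonneg (‖Wt t θ‖ - ‖Wθ t θ‖)]

/-- Lower bound for the energy on a cylinder `[a, b] × S¹` along which the circulation is close to
`2πD` on average. -/
theorem energy_lower_bound {ε : ℝ} (hε : 0 < ε) {D : ℤ} (hD : 1 ≤ D) {a b : ℝ} (ha : 0 ≤ a)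
    (hab : a + log 2 ≤ b) (hεD : ε * (D : ℝ) ^ 2 ≤ 1 / 1000)
    (hM : ∫ t in a..b, |circulation W Wθ t - 2 * π * D| ≤ 1 / (100 * (D : ℝ) ^ 2)) :
    π * (D : ℝ) ^ 2 * (b - a) - π * (D : ℝ) ^ 4 * ε ^ 2 * exp (-2 * a) ≤
      ∫ t in a..b, cylinderEnergy ε W Wt Wθ t := by
  have hD' : (1 : ℝ) ≤ D := by exact_mod_cast hD
  have hD2 : (1 : ℝ) ≤ (D : ℝ) ^ 2 := by nlinarith
  have hl2 := Real.log_two_gt_d9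
  have hab' : a ≤ b := by linarith
  have hpi := pi_pos
  set A := cylinderEnergy ε W Wt Wθ with hA
  set g : ℝ → ℝ := fun t => circulation W Wθ t - 2 * π * D with hg
  have hAc : Continuous A := h.continuous_cylinderEnergy ε
  have hgc : Continuous g := h.continuous_circulation.sub continuous_const
  have hA0 : ∀ t, 0 ≤ A t := fun t => cylinderEnergy_nonneg ε t
  set err : ℝ → ℝ := fun t => 2 * π * (D : ℝ) ^ 4 * ε ^ 2 * exp (-2 * t) with herr
  have herrc : Continuous err := by fun_prop
  have herr0 : ∀ t, 0 ≤ err t := fun t => by positivity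
  have hgood : ∀ t, 0 ≤ t → |g t| < π → π * (D : ℝ) ^ 2 - err t ≤ A t := by
    intro t ht hgt
    refine le_trans ?_ (h.circle_le_cylinderEnergy ε t)
    have hWθ : Continuous (Wθ t) := h.cont_θ.comp (Continuous.prodMk_right t)
    have hexp : 1 ≤ exp t := one_le_exp ht
    have hc : (D : ℝ) ^ 2 ≤ exp t / ε / 1000 := by
      rw [div_div, le_div_iff₀ (by positivity)]; nlinarith
    refine le_trans (le_of_eq ?_) (circle_energy_lower_bound (h.deriv_θ t) hWθ (h.periodic t) hD hc hgt)
    have : exp (-2 * t) = (exp t ^ 2)⁻¹ := by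
      rw [← exp_nat_mul, ← exp_neg]; congr 1; push_cast; ring
    simp only [herr, this]
    field_simp
  -- On a bad circle D²|g| is at least πD², so the left side is nonpositive and the sign of the
  -- energy suffices.
  have hall : ∀ t, 0 ≤ t → π * (D : ℝ) ^ 2 - err t - (D : ℝ) ^ 2 * |g t| ≤ A t := by
    intro t ht
    rcases lt_or_ge |g t| π with hlt | hge
    · have := hgood t ht hlt
      have : 0 ≤ (D : ℝ) ^ 2 * |g t| := by positivity
      linarith
    · have := hA0 t
      have := herr0 t
      nlinarith
  have herri : ∫ t in a..b, err t ≤ π * (D : ℝ) ^ 4 * ε ^ 2 * exp (-2 * a) := by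
    have : ∫ t in a..b, err t = - (π * (D : ℝ) ^ 4 * ε ^ 2 * exp (-2 * b))
        - (- (π * (D : ℝ) ^ 4 * ε ^ 2 * exp (-2 * a))) := by
      refine intervalIntegral.integral_eq_sub_of_hasDerivAt
        (f := fun t => - (π * (D : ℝ) ^ 4 * ε ^ 2 * exp (-2 * t))) (fun t _ => ?_)
        (herrc.intervalIntegrable _ _)
      have h1 : HasDerivAt (fun t : ℝ => -2 * t) (-2) t := by
        simpa using (hasDerivAt_id t).const_mul (-2 : ℝ)
      refine ((h1.exp.const_mul (π * (D : ℝ) ^ 4 * ε ^ 2)).neg).congr_deriv ?_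
      simp only [herr]; ring
    have h2 : 0 ≤ π * (D : ℝ) ^ 4 * ε ^ 2 * exp (-2 * b) := by positivity
    linarith
  have ii : ∀ {f : ℝ → ℝ} (_ : Continuous f) (x y : ℝ), IntervalIntegrable f volume x y :=
    fun hf x y => hf.intervalIntegrable x y
  by_cases hB : ∀ t ∈ Icc a b, |g t| < π
  · have h1 : ∫ t in a..b, (π * (D : ℝ) ^ 2 - err t) ≤ ∫ t in a..b, A t :=
      intervalIntegral.integral_mono_on hab' (ii (by fun_prop) _ _) (ii hAc _ _)
        fun t ht => hgood t (ha.trans ht.1) (hB t ht)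
    rw [intervalIntegral.integral_sub (ii continuous_const _ _) (ii herrc _ _),
      intervalIntegral.integral_const, smul_eq_mul] at h1
    linarith
  push Not at hB
  obtain ⟨t₀, ht₀, hgt₀⟩ := hB
  -- The length is twice the bound on the L¹ norm of g: short enough that discarding such an
  -- interval loses only π/50, long enough that g cannot be large throughout it.
  set L : ℝ := 1 / (50 * (D : ℝ) ^ 2) with hL
  have hL0 : 0 < L := by positivity
  have hL1 : L ≤ 1 / 50 := by
    rw [hL]; apply one_div_le_one_div_of_le <;> linarith
  have hLD : (D : ℝ) ^ 2 * L = 1 / 50 := by rw [hL]; field_simp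
  have hσ : ∀ x y, a ≤ x → x ≤ y → y ≤ b → ∫ t in x..y, |g t| ≤ L / 2 := by
    intro x y hax hxy hyb
    have : ∫ t in x..y, |g t| ≤ ∫ t in a..b, |g t| :=
      intervalIntegral.integral_mono_interval hax hxy hyb
        (ae_of_all _ fun t => abs_nonneg _) (ii hgc.abs _ _)
    refine this.trans (hM.trans (le_of_eq ?_))
    rw [hL]; field_simp; norm_num
  -- an interval of length `L` next to `t₀`
  obtain ⟨x, hax, hxb, hxt⟩ : ∃ x, a ≤ x ∧ x + L ≤ b ∧ t₀ ∈ Icc x (x + L) := by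
    by_cases hle : t₀ + L ≤ b
    · exact ⟨t₀, ht₀.1, hle, le_rfl, by linarith⟩
    · exact ⟨t₀ - L, by linarith, by linarith [ht₀.2], by linarith, by linarith⟩
  -- Otherwise the integral of |g| over this interval would be at least Lπ/2, exceeding L/2.
  obtain ⟨t₁, ht₁, hgt₁⟩ : ∃ t₁ ∈ Icc x (x + L), |g t₁| < π / 2 := by
    by_contra hcon
    push Not at hcon
    have h1 : ∫ t in x..(x + L), π / 2 ≤ ∫ t in x..(x + L), |g t| :=
      intervalIntegral.integral_mono_on (by linarith) (ii continuous_const _ _) (ii hgc.abs _ _) hcon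
    have h2 := hσ x (x + L) hax (by linarith) hxb
    rw [intervalIntegral.integral_const, smul_eq_mul] at h1
    nlinarith [pi_gt_three]
  have hI : π / 4 ≤ ∫ t in x..(x + L), A t := by
    have key : ∀ y z, x ≤ y → y ≤ z → z ≤ x + L → π / 2 ≤ |g z - g y| →
        π / 4 ≤ ∫ t in x..(x + L), A t := by
      intro y z hxy hyz hzx hd
      have h1 := h.abs_circulation_sub_le ε hyz
      have h2 : ∫ t in y..z, A t ≤ ∫ t in x..(x + L), A t :=
        intervalIntegral.integral_mono_interval hxy hyz hzx
          (ae_of_all _ fun t => hA0 t) (ii hAc _ _)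
      have h3 : g z - g y = circulation W Wθ z - circulation W Wθ y := by simp [hg]
      rw [h3] at hd
      linarith
    have hdist : π / 2 ≤ |g t₀ - g t₁| := by
      have := abs_sub_abs_le_abs_sub (g t₀) (g t₁); linarith
    rcases le_total t₀ t₁ with hle | hle
    · exact key t₀ t₁ hxt.1 hle ht₁.2 (by rwa [abs_sub_comm])
    · exact key t₁ t₀ ht₁.1 hle hxt.2 hdist
  -- Off the short interval the crude bound is used; the L¹ bound on g limits its loss to D²L/2 =
  -- 1/100 on each side.
  have hoff : ∀ y z, a ≤ y → y ≤ z → z ≤ b → 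
      π * (D : ℝ) ^ 2 * (z - y) - (∫ t in y..z, err t) - (D : ℝ) ^ 2 * (L / 2) ≤ ∫ t in y..z, A t := by
    intro y z hay hyz hzb
    have h1 : ∫ t in y..z, (π * (D : ℝ) ^ 2 - err t - (D : ℝ) ^ 2 * |g t|) ≤ ∫ t in y..z, A t :=
      intervalIntegral.integral_mono_on hyz (ii (by fun_prop) _ _) (ii hAc _ _)
        fun t ht => hall t (ha.trans (hay.trans ht.1))
    rw [intervalIntegral.integral_sub (ii (by fun_prop) _ _) (ii (by fun_prop) _ _),
      intervalIntegral.integral_sub (ii continuous_const _ _) (ii herrc _ _),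
      intervalIntegral.integral_const, smul_eq_mul,
      intervalIntegral.integral_const_mul ((D : ℝ) ^ 2) fun t => |g t|] at h1
    have h2 := hσ y z hay hyz hzb
    have h3 : (D : ℝ) ^ 2 * ∫ t in y..z, |g t| ≤ (D : ℝ) ^ 2 * (L / 2) := by gcongr
    linarith
  have h1 := hoff a x le_rfl hax (by linarith)
  have h2 := hoff (x + L) b (by linarith) hxb le_rfl
  have h3 : (∫ t in a..x, A t) + (∫ t in x..(x + L), A t) + (∫ t in (x + L)..b, A t)
      = ∫ t in a..b, A t := by
    rw [intervalIntegral.integral_add_adjacent_intervals (ii hAc _ _) (ii hAc _ _),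
      intervalIntegral.integral_add_adjacent_intervals (ii hAc _ _) (ii hAc _ _)]
  have h4 : (∫ t in a..x, err t) + (∫ t in x..(x + L), err t) + (∫ t in (x + L)..b, err t)
      = ∫ t in a..b, err t := by
    rw [intervalIntegral.integral_add_adjacent_intervals (ii herrc _ _) (ii herrc _ _),
      intervalIntegral.integral_add_adjacent_intervals (ii herrc _ _) (ii herrc _ _)]
  have h5 : 0 ≤ ∫ t in x..(x + L), err t :=
    intervalIntegral.integral_nonneg (by linarith) fun t _ => herr0 t
  -- Balance: the gain π/4 on the short interval exceeds the missing πD²L = π/50 plus the two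
  -- lateral losses of 1/100.
  nlinarith [pi_gt_three]

end IsCylinderMap

/-! ### Logarithmic polar coordinates. -/

open Real in
/-- The point of the plane with logarithmic polar coordinates `(t, θ)`. -/
noncomputable def logPolar (t θ : ℝ) : Plane := !₂[exp t * cos θ, exp t * sin θ]

open Real in
/-- The rotation of `logPolar t θ` by a right angle. -/
noncomputable def logPolarPerp (t θ : ℝ) : Plane := !₂[-(exp t * sin θ), exp t * cos θ]

section LogPolar

open Real

theorem plane_norm_sq (x : Plane) : ‖x‖ ^ 2 = x 0 ^ 2 + x 1 ^ 2 := by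
  rw [EuclideanSpace.norm_sq_eq]; simp

theorem norm_toLp_polar {r : ℝ} (hr : 0 ≤ r) (θ : ℝ) :
    ‖(!₂[r * cos θ, r * sin θ] : Plane)‖ = r := by
  rw [← sq_eq_sq₀ (norm_nonneg _) hr, plane_norm_sq]
  simp only [Matrix.cons_val_zero, Matrix.cons_val_one]
  linear_combination r ^ 2 * cos_sq_add_sin_sq θ

theorem norm_logPolar (t θ : ℝ) : ‖logPolar t θ‖ = exp t := norm_toLp_polar (exp_pos t).le θ

theorem integral_plane_eq (f : Plane → ℝ) :
    ∫ x, f x = ∫ p : ℝ × ℝ, f !₂[p.1, p.2] := by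
  have h1 := (EuclideanSpace.volume_preserving_symm_measurableEquiv_toLp (Fin 2)).symm
  have h2 := (volume_preserving_finTwoArrow ℝ).symm
  rw [← h1.integral_comp (MeasurableEquiv.measurableEmbedding _),
    ← h2.integral_comp (MeasurableEquiv.measurableEmbedding _)]
  rfl

/-- Polar coordinates followed by r = e^t; the area element r dr becomes e^{2t} dt. -/
theorem integral_annulus_eq {f : Plane → ℝ} (hf : Continuous f) {a b : ℝ} (hab : a ≤ b) :
    ∫ x in Metric.ball (0 : Plane) (exp b) \ Metric.ball 0 (exp a), f x =
      ∫ t in a..b, ∫ θ in (-π)..π, exp t ^ 2 * f (logPolar t θ) := by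
  have hpp : -π ≤ π := by linarith [pi_pos]
  have hexp : exp a ≤ exp b := exp_le_exp.2 hab
  set S : Set Plane := Metric.ball (0 : Plane) (exp b) \ Metric.ball 0 (exp a) with hS
  have hSm : MeasurableSet S := Metric.isOpen_ball.measurableSet.diff Metric.isOpen_ball.measurableSet
  set F : ℝ × ℝ → ℝ := fun p => p.1 * f !₂[p.1 * cos p.2, p.1 * sin p.2] with hF
  have hFc : Continuous F := by
    refine continuous_fst.mul (hf.comp ?_)
    exact (PiLp.continuous_toLp 2 _).comp (continuous_pi fun i => by
      fin_cases i <;> simp <;> fun_prop)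
  have hmem : ∀ p : ℝ × ℝ, 0 < p.1 →
      (!₂[p.1 * cos p.2, p.1 * sin p.2] ∈ S ↔ p.1 ∈ Ico (exp a) (exp b)) := by
    intro p hp
    rw [hS, Set.mem_sdiff, mem_ball_zero_iff, mem_ball_zero_iff, norm_toLp_polar hp.le, not_lt, mem_Ico,
      and_comm]
  calc ∫ x in S, f x = ∫ x, S.indicator f x := (integral_indicator hSm).symm
    _ = ∫ p in polarCoord.target, p.1 • S.indicator f !₂[p.1 * cos p.2, p.1 * sin p.2] := by
        rw [integral_plane_eq, ← integral_comp_polarCoord_symm]; rfl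
    _ = ∫ p in polarCoord.target, (Ico (exp a) (exp b) ×ˢ univ).indicator F p := by
        refine setIntegral_congr_fun polarCoord.open_target.measurableSet fun p hp => ?_
        have hp1 : 0 < p.1 := hp.1
        by_cases hin : p.1 ∈ Ico (exp a) (exp b)
        · simp only [indicator_of_mem ((hmem p hp1).2 hin),
            indicator_of_mem (show p ∈ Ico (exp a) (exp b) ×ˢ univ from ⟨hin, trivial⟩), smul_eq_mul,
            hF]
        · simp only [indicator_of_notMem (fun hc => hin ((hmem p hp1).1 hc)),
            indicator_of_notMem (fun hc : p ∈ Ico (exp a) (exp b) ×ˢ univ => hin hc.1), smul_zero]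
    _ = ∫ p in Ico (exp a) (exp b) ×ˢ Ioo (-π) π, F p := by
        rw [setIntegral_indicator (measurableSet_Ico.prod MeasurableSet.univ)]
        congr 2
        ext p
        simp only [polarCoord_target, mem_inter_iff, mem_prod, mem_Ioi, mem_univ, and_true]
        exact ⟨fun h => ⟨h.2, h.1.2⟩, fun h => ⟨⟨(exp_pos a).trans_le h.1.1, h.2⟩, h.1⟩⟩
    _ = ∫ r in Ico (exp a) (exp b), ∫ θ in Ioo (-π) π, F (r, θ) := by
        rw [Measure.volume_eq_prod, setIntegral_prod]
        rw [← Measure.volume_eq_prod]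
        exact (hFc.continuousOn.integrableOn_compact
          (isCompact_Icc.prod isCompact_Icc)).mono_set (prod_mono Ico_subset_Icc_self Ioo_subset_Icc_self)
    _ = ∫ r in (exp a)..(exp b), ∫ θ in (-π)..π, F (r, θ) := by
        rw [intervalIntegral.integral_of_le hexp, integral_Ico_eq_integral_Ioc]
        simp_rw [intervalIntegral.integral_of_le hpp, integral_Ioc_eq_integral_Ioo]
    _ = ∫ t in a..b, exp t • ((fun r => ∫ θ in (-π)..π, F (r, θ)) ∘ exp) t := by
        rw [intervalIntegral.integral_deriv_smul_comp (fun x _ => hasDerivAt_exp x)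
          continuous_exp.continuousOn]
        exact intervalIntegral.continuous_parametric_intervalIntegral_of_continuous'
          (f := fun r θ => F (r, θ)) hFc _ _
    _ = _ := by
        congr 1; ext t
        simp only [Function.comp, smul_eq_mul]
        rw [← intervalIntegral.integral_const_mul]
        congr 1; ext θ
        simp only [hF, logPolar]; ring

theorem hasDerivAt_toLp {f g : ℝ → ℝ} {f' g' x : ℝ} (hf : HasDerivAt f f' x)
    (hg : HasDerivAt g g' x) : HasDerivAt (fun x => (!₂[f x, g x] : Plane)) !₂[f', g'] x := by
  have h : HasDerivAt (fun x => ![f x, g x]) ![f', g'] x := by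
    refine hasDerivAt_pi.2 fun i => ?_
    fin_cases i
    · simpa using hf
    · simpa using hg
  exact (PiLp.continuousLinearEquiv 2 ℝ (fun _ : Fin 2 => ℝ)).symm.hasFDerivAt.comp_hasDerivAt x h

theorem hasDerivAt_logPolar_t (t θ : ℝ) :
    HasDerivAt (fun t => logPolar t θ) (logPolar t θ) t :=
  hasDerivAt_toLp ((hasDerivAt_exp t).mul_const _) ((hasDerivAt_exp t).mul_const _)

theorem hasDerivAt_logPolarPerp_t (t θ : ℝ) :
    HasDerivAt (fun t => logPolarPerp t θ) (logPolarPerp t θ) t :=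
  hasDerivAt_toLp ((hasDerivAt_exp t).mul_const _).neg ((hasDerivAt_exp t).mul_const _)

theorem hasDerivAt_logPolar_θ (t θ : ℝ) :
    HasDerivAt (fun θ => logPolar t θ) (logPolarPerp t θ) θ :=
  hasDerivAt_toLp (((hasDerivAt_cos θ).const_mul _).congr_deriv (by ring))
    ((hasDerivAt_sin θ).const_mul _)

theorem continuous_logPolar : Continuous (Function.uncurry logPolar) :=
  (PiLp.continuous_toLp 2 _).comp (continuous_pi fun i => by
    fin_cases i <;> simp <;> fun_prop)

theorem continuous_logPolarPerp : Continuous (Function.uncurry logPolarPerp) :=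
  (PiLp.continuous_toLp 2 _).comp (continuous_pi fun i => by
    fin_cases i <;> simp <;> fun_prop)

/-- The vector x = `logPolar t θ` is its own t-derivative and has θ-derivative x^⊥. The two orders
of mixed differentiation agree by symmetry of the second derivative. -/
theorem isCylinderMap_of_contDiff {w : Plane → ℂ} (hw : ContDiff ℝ ∞ w) :
    IsCylinderMap (fun t θ => w (logPolar t θ))
      (fun t θ => fderiv ℝ w (logPolar t θ) (logPolar t θ))
      (fun t θ => fderiv ℝ w (logPolar t θ) (logPolarPerp t θ))
      (fun t θ => fderiv ℝ (fderiv ℝ w) (logPolar t θ) (logPolar t θ) (logPolarPerp t θ)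
        + fderiv ℝ w (logPolar t θ) (logPolarPerp t θ)) := by
  have hd : ∀ x, HasFDerivAt w (fderiv ℝ w x) x := fun x =>
    (hw.differentiable (by simp) x).hasFDerivAt
  have hw1 : ContDiff ℝ ∞ (fderiv ℝ w) := hw.fderiv_right (by simp)
  have hd2 : ∀ x, HasFDerivAt (fderiv ℝ w) (fderiv ℝ (fderiv ℝ w) x) x := fun x =>
    (hw1.differentiable (by simp) x).hasFDerivAt
  have c1 : Continuous (fderiv ℝ w) := hw1.continuous
  have c2 : Continuous (fderiv ℝ (fderiv ℝ w)) := (hw1.fderiv_right (m := ∞) (by simp)).continuous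
  have p1 := continuous_logPolar
  have p2 := continuous_logPolarPerp
  have c0 := hw.continuous
  constructor
  · exact fun t θ => (hd _).comp_hasDerivAt t (hasDerivAt_logPolar_t t θ)
  · exact fun t θ => (hd _).comp_hasDerivAt θ (hasDerivAt_logPolar_θ t θ)
  · exact fun t θ => ((hd2 _).comp_hasDerivAt t (hasDerivAt_logPolar_t t θ)).clm_apply
      (hasDerivAt_logPolarPerp_t t θ)
  · intro t θ
    refine (((hd2 _).comp_hasDerivAt θ (hasDerivAt_logPolar_θ t θ)).clm_apply
      (hasDerivAt_logPolar_θ t θ)).congr_deriv ?_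
    have hsymm : IsSymmSndFDerivAt ℝ w (logPolar t θ) :=
      hw.contDiffAt.isSymmSndFDerivAt
      (by simpa using (by exact_mod_cast le_top : ((2 : ℕ∞) : WithTop ℕ∞) ≤ ((⊤ : ℕ∞) : WithTop ℕ∞)))
    rw [hsymm.eq]
    rfl
  · exact c0.comp p1
  · exact (c1.comp p1).clm_apply p1
  · exact (c1.comp p1).clm_apply p2
  · exact (((c2.comp p1).clm_apply p1).clm_apply p2).add ((c1.comp p1).clm_apply p2)
  · intro t; simp [logPolar]
  · intro t; simp [logPolar]

theorem plane_eq_sum (x : Plane) : x = x 0 • planeBasis 0 + x 1 • planeBasis 1 := by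
  ext i; fin_cases i <;> simp [planeBasis]

/-- The Cauchy-Riemann type identity `|x|² |L|² = |L x|² + |L x^⊥|²`. -/
theorem normSq_logPolar_add (L : Plane →L[ℝ] ℂ) (t θ : ℝ) :
    exp t ^ 2 * ∑ i : Fin 2, ‖L (planeBasis i)‖ ^ 2 =
      ‖L (logPolar t θ)‖ ^ 2 + ‖L (logPolarPerp t θ)‖ ^ 2 := by
  rw [plane_eq_sum (logPolar t θ), plane_eq_sum (logPolarPerp t θ)]
  simp only [map_add, map_smul, Fin.sum_univ_two, logPolar, logPolarPerp, PiLp.toLp_apply,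
    Matrix.cons_val_zero, Matrix.cons_val_one, ← Complex.normSq_eq_norm_sq, Complex.normSq_apply,
    Complex.add_re, Complex.add_im, Complex.real_smul, Complex.re_ofReal_mul, Complex.im_ofReal_mul]
  have := sin_sq_add_cos_sq θ
  set c := cos θ
  set s := sin θ
  set a := L (planeBasis 0)
  set b := L (planeBasis 1)
  linear_combination (-(exp t ^ 2 * (a.re ^ 2 + a.im ^ 2 + b.re ^ 2 + b.im ^ 2))) * this

end LogPolar

/-! ### Smooth maps on annuli and radial weights. -/

/-- The Ginzburg-Landau density of a differentiable map. -/
noncomputable def classicalDensity (ε : ℝ) (w : Plane → ℂ) (x : Plane) : ℝ :=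
  1 / 2 * gradSq w x + 1 / (4 * ε ^ 2) * (‖w x‖ ^ 2 - 1) ^ 2

/-- The angular component `x₀ j₁ - x₁ j₀` of the current of a function with value `z` and partial
derivatives `p₀`, `p₁` at `x`. -/
noncomputable def swirl (x : Plane) (z p₀ p₁ : ℂ) : ℝ :=
  x 0 * ((Complex.I * z) * (starRingEnd ℂ) p₁).re - x 1 * ((Complex.I * z) * (starRingEnd ℂ) p₀).re

/-- Radial weights whose logarithmic profile `η` vanishes outside `(a, b)`. -/
noncomputable def radialWeight (η : ℝ → ℝ) (x : Plane) : ℝ := η (Real.log ‖x‖) / ‖x‖ ^ 2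

section

open Real

theorem continuous_classicalDensity (ε : ℝ) {w : Plane → ℂ} (hw : ContDiff ℝ ∞ w) :
    Continuous (classicalDensity ε w) := by
  have c1 : Continuous (fderiv ℝ w) := (hw.fderiv_right (m := ∞) (by simp)).continuous
  have c0 := hw.continuous
  unfold classicalDensity gradSq
  fun_prop

/-- The area factor e^{2t} turns |∇w|² into |∂ₜw|² + |∂_θw|² and 1/ε² into (e^t/ε)². -/
theorem integral_classicalDensity_annulus {ε : ℝ} {w : Plane → ℂ} (hw : ContDiff ℝ ∞ w)
    {a b : ℝ} (hab : a ≤ b) :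
    ∫ x in Metric.ball (0 : Plane) (exp b) \ Metric.ball 0 (exp a), classicalDensity ε w x =
      ∫ t in a..b, cylinderEnergy ε (fun t θ => w (logPolar t θ))
        (fun t θ => fderiv ℝ w (logPolar t θ) (logPolar t θ))
        (fun t θ => fderiv ℝ w (logPolar t θ) (logPolarPerp t θ)) t := by
  rw [integral_annulus_eq (continuous_classicalDensity ε hw) hab]
  congr 1; ext t
  unfold cylinderEnergy
  congr 1; ext θ
  have := normSq_logPolar_add (fderiv ℝ w (logPolar t θ)) t θ
  unfold classicalDensity gradSq circleDensity
  rw [mul_add, mul_left_comm, this]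
  ring

/-- Differentiation along x^⊥ is ∂_θ, so the angular component of the current is the integrand of
the circulation. -/
theorem swirl_logPolar (L : Plane →L[ℝ] ℂ) (z : ℂ) (t θ : ℝ) :
    swirl (logPolar t θ) z (L (planeBasis 0)) (L (planeBasis 1)) =
      ((starRingEnd ℂ) z * L (logPolarPerp t θ)).im := by
  rw [plane_eq_sum (logPolarPerp t θ)]
  simp only [swirl, map_add, map_smul, logPolar, logPolarPerp, PiLp.toLp_apply,
    Matrix.cons_val_zero, Matrix.cons_val_one, Complex.mul_re, Complex.mul_im, Complex.conj_re,
    Complex.conj_im, Complex.I_re, Complex.I_im, Complex.add_re, Complex.add_im, Complex.real_smul,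
    Complex.ofReal_re, Complex.ofReal_im]
  ring

theorem radialWeight_eq_zero {η : ℝ → ℝ} {a b : ℝ} (ha : 0 < a)
    (hη0 : ∀ t, t ∉ Ioo a b → η t = 0) {x : Plane}
    (hx : x ∉ Metric.ball (0 : Plane) (exp b) \ Metric.ball 0 (exp a)) : radialWeight η x = 0 := by
  have : log ‖x‖ ∉ Ioo a b := by
    intro hmem
    have hx0 : 0 < ‖x‖ := by
      rcases eq_or_lt_of_le (norm_nonneg x) with h | h
      -- With the convention `log 0 = 0`, the assumption 0 < a keeps the origin outside the support.
      · rw [← h, log_zero] at hmem; exact absurd hmem.1 (by linarith)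
      · exact h
    apply hx
    rw [Set.mem_sdiff, mem_ball_zero_iff, mem_ball_zero_iff, not_lt]
    exact ⟨(log_lt_iff_lt_exp hx0).1 hmem.2, ((lt_log_iff_exp_lt hx0).1 hmem.1).le⟩
  rw [radialWeight, hη0 _ this, zero_div]

theorem continuous_radialWeight {η : ℝ → ℝ} {a b : ℝ} (ha : 0 < a) (hη : Continuous η)
    (hη0 : ∀ t, t ∉ Ioo a b → η t = 0) : Continuous (radialWeight η) := by
  rw [continuous_iff_continuousAt]
  intro x
  by_cases hx : x = 0
  · have : radialWeight η =ᶠ[𝓝 x] fun _ => 0 := by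
      filter_upwards [Metric.isOpen_ball.mem_nhds
        (hx ▸ Metric.mem_ball_self (exp_pos a) : x ∈ Metric.ball (0 : Plane) (exp a))] with y hy
      exact radialWeight_eq_zero ha hη0 fun h => h.2 hy
    exact continuousAt_const.congr this.symm
  · have hx' : ‖x‖ ≠ 0 := norm_ne_zero_iff.2 hx
    unfold radialWeight
    exact (hη.continuousAt.comp (continuous_norm.continuousAt.log hx')).div
      (by fun_prop) (pow_ne_zero 2 hx')

theorem continuous_swirl {w : Plane → ℂ} (hw : ContDiff ℝ ∞ w) : Continuous fun x =>
    swirl x (w x) (fderiv ℝ w x (planeBasis 0)) (fderiv ℝ w x (planeBasis 1)) := by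
  have c1 : Continuous (fderiv ℝ w) := (hw.fderiv_right (m := ∞) (by simp)).continuous
  have c0 := hw.continuous
  unfold swirl
  fun_prop

/-- The factor |x|⁻² in the weight cancels the area factor e^{2t}, so a weighted planar integral of
the current tests the circulation against the profile η. -/
theorem integral_radialWeight_mul_swirl {w : Plane → ℂ} (hw : ContDiff ℝ ∞ w) {η : ℝ → ℝ}
    {a b : ℝ} (ha : 0 < a) (hab : a ≤ b) (hη : Continuous η)
    (hη0 : ∀ t, t ∉ Ioo a b → η t = 0) :
    ∫ x, radialWeight η x * swirl x (w x) (fderiv ℝ w x (planeBasis 0))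
      (fderiv ℝ w x (planeBasis 1)) =
    ∫ t in a..b, η t * circulation (fun t θ => w (logPolar t θ))
        (fun t θ => fderiv ℝ w (logPolar t θ) (logPolarPerp t θ)) t := by
  rw [← setIntegral_eq_integral_of_forall_compl_eq_zero
    (s := Metric.ball (0 : Plane) (exp b) \ Metric.ball 0 (exp a))
    (fun x hx => by rw [radialWeight_eq_zero ha hη0 hx, zero_mul]),
    integral_annulus_eq ((continuous_radialWeight ha hη hη0).fun_mul (continuous_swirl hw)) hab]
  congr 1; ext t
  rw [circulation, ← intervalIntegral.integral_const_mul]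
  congr 1; ext θ
  rw [swirl_logPolar, radialWeight, norm_logPolar, log_exp]
  have := exp_pos t
  field_simp

/-- A bound for the pairing of a continuous function with all profiles bounds its `L¹` norm. -/
theorem integral_abs_le_of_forall_profile {g : ℝ → ℝ} (hg : Continuous g) {a b σ : ℝ} (hab : a ≤ b)
    (H : ∀ η : ℝ → ℝ, Continuous η → (∀ t, |η t| ≤ 1) →
      (∀ t, t ∉ Ioo (a - 1) (b + 1) → η t = 0) → ∫ t in (a - 1)..(b + 1), η t * g t ≤ σ) :
    ∫ t in a..b, |g t| ≤ σ := by
  refine le_of_forall_pos_le_add fun δ hδ => ?_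
  -- The regularization below costs at most κ per unit length, hence δ over (a − 1, b + 1).
  set κ : ℝ := δ / (b - a + 2) with hκ
  have hlen : 0 < b - a + 2 := by linarith
  have hκ0 : 0 < κ := div_pos hδ hlen
  set χ : ℝ → ℝ := fun t => max 0 (1 - 2 * max 0 (max (a - t) (t - b))) with hχ
  have hχc : Continuous χ := by fun_prop
  have hχ0 : ∀ t, 0 ≤ χ t := fun t => le_max_left _ _
  have hχ1 : ∀ t, χ t ≤ 1 := fun t => max_le zero_le_one (by
    have := le_max_left 0 (max (a - t) (t - b)); linarith)
  have hχeq : ∀ t ∈ Icc a b, χ t = 1 := by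
    intro t ht
    have : max 0 (max (a - t) (t - b)) = 0 :=
      max_eq_left (max_le (by linarith [ht.1]) (by linarith [ht.2]))
    simp [hχ, this]
  have hχout : ∀ t, t ∉ Ioo (a - 1) (b + 1) → χ t = 0 := by
    intro t ht
    refine max_eq_left ?_
    have : 1 ≤ max 0 (max (a - t) (t - b)) := by
      rw [mem_Ioo, not_and_or, not_lt, not_lt] at ht
      rcases ht with h | h
      · exact le_max_of_le_right (le_max_of_le_left (by linarith))
      · exact le_max_of_le_right (le_max_of_le_right (by linarith))
    linarith
  have hden : ∀ t, 0 < |g t| + κ := fun t => by positivity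
  -- A continuous substitute for the sign of g, cut off by χ, which equals 1 on [a, b] and reaches 0
  -- within distance 1/2.
  set η : ℝ → ℝ := fun t => χ t * (g t / (|g t| + κ)) with hη
  have hηc : Continuous η := hχc.mul (hg.div (by fun_prop) fun t => (hden t).ne')
  have h1 := H η hηc (fun t => ?_) (fun t ht => by simp [hη, hχout t ht])
  · have ii : ∀ {f : ℝ → ℝ} (_ : Continuous f) (x y : ℝ), IntervalIntegrable f volume x y :=
      fun hf x y => hf.intervalIntegrable x y
    have h2 : ∫ t in (a - 1)..(b + 1), (χ t * |g t| - κ) ≤ ∫ t in (a - 1)..(b + 1), η t * g t := by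
      refine intervalIntegral.integral_mono_on (by linarith) (ii (by fun_prop) _ _)
        (ii (hηc.mul hg) _ _) fun t _ => ?_
      have e : |g t| - κ ≤ g t / (|g t| + κ) * g t := by
        rw [div_mul_eq_mul_div, le_div_iff₀ (hden t)]
        nlinarith [abs_mul_abs_self (g t)]
      have := mul_le_mul_of_nonneg_left e (hχ0 t)
      have := mul_le_mul_of_nonneg_right (hχ1 t) hκ0.le
      simp only [hη]
      nlinarith
    rw [intervalIntegral.integral_sub (ii (by fun_prop) _ _) (ii continuous_const _ _),
      intervalIntegral.integral_const, smul_eq_mul] at h2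
    have h3 : ∫ t in a..b, |g t| ≤ ∫ t in (a - 1)..(b + 1), χ t * |g t| := by
      calc ∫ t in a..b, |g t| = ∫ t in a..b, χ t * |g t| := by
            refine intervalIntegral.integral_congr fun t ht => ?_
            rw [uIcc_of_le hab] at ht
            simp [hχeq t ht]
        _ ≤ _ := intervalIntegral.integral_mono_interval (by linarith) hab (by linarith)
            (ae_of_all _ fun t => mul_nonneg (hχ0 t) (abs_nonneg _)) (ii (by fun_prop) _ _)
    have h4 : (b + 1 - (a - 1)) * κ = δ := by rw [hκ]; field_simp; ring
    linarith
  · rw [hη]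
    simp only [abs_mul, abs_div, abs_of_nonneg (hχ0 t), abs_of_pos (hden t)]
    refine mul_le_one₀ (hχ1 t) (by positivity) ?_
    rw [div_le_one (hden t)]; linarith

/-- Lower bound for the energy of a smooth map on an annulus, when its vorticity pairs with radial
test functions almost as `2πD δ₀` does. -/
theorem smooth_annulus_lower_bound {w : Plane → ℂ} (hw : ContDiff ℝ ∞ w) {ε : ℝ} (hε : 0 < ε)
    {D : ℤ} (hD : 1 ≤ D) {a b : ℝ} (ha : 1 < a) (hab : a + log 2 ≤ b)
    (hεD : ε * (D : ℝ) ^ 2 ≤ 1 / 1000)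
    (H : ∀ η : ℝ → ℝ, Continuous η → (∀ t, |η t| ≤ 1) →
      (∀ t, t ∉ Ioo (a - 1) (b + 1) → η t = 0) →
      (∫ x, radialWeight η x * swirl x (w x) (fderiv ℝ w x (planeBasis 0))
        (fderiv ℝ w x (planeBasis 1))) - 2 * π * D * ∫ t in (a - 1)..(b + 1), η t
        ≤ 1 / (100 * (D : ℝ) ^ 2)) :
    π * (D : ℝ) ^ 2 * (b - a) - π * (D : ℝ) ^ 4 * ε ^ 2 * exp (-2 * a) ≤
      ∫ x in Metric.ball (0 : Plane) (exp b) \ Metric.ball 0 (exp a), classicalDensity ε w x := by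
  have hab' : a ≤ b := by have := log_two_gt_d9; linarith
  have hcyl := isCylinderMap_of_contDiff hw
  rw [integral_classicalDensity_annulus hw hab']
  refine hcyl.energy_lower_bound hε hD (by linarith) hab hεD ?_
  refine integral_abs_le_of_forall_profile (hcyl.continuous_circulation.fun_sub continuous_const) hab'
    fun η hη hη1 hη0 => ?_
  have h1 := H η hη hη1 hη0
  rw [integral_radialWeight_mul_swirl hw (by linarith) (by linarith) hη hη0,
    ← intervalIntegral.integral_const_mul, ← intervalIntegral.integral_sub
      ((hη.fun_mul hcyl.continuous_circulation).intervalIntegrable _ _)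
      ((continuous_const.fun_mul hη).intervalIntegrable _ _)] at h1
  refine le_trans (le_of_eq ?_) h1
  congr 1; ext t; ring

end

/-! ### Mollification in Lᵖ. -/

section Mollification

/-- A sequence of bump functions on the plane concentrating at the origin. -/
noncomputable def planeBump (k : ℕ) : ContDiffBump (0 : Plane) where
  rIn := 1 / (2 * ((k : ℝ) + 1))
  rOut := 1 / ((k : ℝ) + 1)
  rIn_pos := by positivity
  rIn_lt_rOut := by
    apply one_div_lt_one_div_of_lt <;> linarith [(Nat.cast_nonneg k : (0 : ℝ) ≤ k)]

theorem tendsto_planeBump_rOut : Tendsto (fun k => (planeBump k).rOut) atTop (𝓝 0) :=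
  tendsto_one_div_add_atTop_nhds_zero_nat

theorem planeBump_rOut_le_one (k : ℕ) : (planeBump k).rOut ≤ 1 := by
  show 1 / ((k : ℝ) + 1) ≤ 1
  rw [div_le_one (by positivity)]; linarith [(Nat.cast_nonneg k : (0 : ℝ) ≤ k)]

/-- Mollification of a function on the plane. -/
noncomputable def mollify (k : ℕ) (f : Plane → ℂ) : Plane → ℂ :=
  convolution ((planeBump k).normed volume) f (ContinuousLinearMap.lsmul ℝ ℝ) volume

theorem mollify_apply (k : ℕ) (f : Plane → ℂ) (x : Plane) :
    mollify k f x = ∫ t, (planeBump k).normed volume t • f (x - t) := rfl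

theorem contDiff_mollify (k : ℕ) {f : Plane → ℂ} (hf : LocallyIntegrable f) :
    ContDiff ℝ ∞ (mollify k f) :=
  (planeBump k).hasCompactSupport_normed.contDiff_convolution_left _
    (planeBump k).contDiff_normed hf

theorem mollify_congr (k : ℕ) {f g : Plane → ℂ} (h : f =ᵐ[volume] g) : mollify k f = mollify k g :=
  convolution_congr _ (ae_eq_refl _) h

theorem mollify_add (k : ℕ) {f g : Plane → ℂ} (hf : LocallyIntegrable f)
    (hg : LocallyIntegrable g) : mollify k (f + g) = mollify k f + mollify k g := by
  ext x
  have hc := (planeBump k).hasCompactSupport_normed (μ := volume)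
  have hcont := (planeBump k).continuous_normed (μ := volume)
  exact ConvolutionExistsAt.distrib_add
    (hc.convolutionExists_left (ContinuousLinearMap.lsmul ℝ ℝ) hcont hf x)
    (hc.convolutionExists_left (ContinuousLinearMap.lsmul ℝ ℝ) hcont hg x)

/-- The probability measure with density the normalized bump function. -/
noncomputable def bumpMeasure (k : ℕ) : Measure Plane :=
  volume.withDensity fun t => ENNReal.ofReal ((planeBump k).normed volume t)

instance (k : ℕ) : IsProbabilityMeasure (bumpMeasure k) := by
  constructor
  rw [bumpMeasure, withDensity_apply _ MeasurableSet.univ, setLIntegral_univ,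
    ← ofReal_integral_eq_lintegral_ofReal (planeBump k).integrable_normed
      (ae_of_all _ (planeBump k).nonneg_normed), (planeBump k).integral_normed, ENNReal.ofReal_one]

theorem enorm_mollify_le (k : ℕ) {f : Plane → ℂ} (hf : StronglyMeasurable f) (x : Plane) :
    ‖mollify k f x‖ₑ ≤ ∫⁻ t, ‖f (x - t)‖ₑ ∂bumpMeasure k := by
  rw [mollify_apply, bumpMeasure, lintegral_withDensity_eq_lintegral_mul _
    (planeBump k).continuous_normed.measurable.ennreal_ofReal
    (show Measurable fun t => ‖f (x - t)‖ₑ from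
      (hf.measurable.comp (measurable_const.sub measurable_id)).enorm)]
  refine (enorm_integral_le_lintegral_enorm _).trans (lintegral_mono fun t => ?_)
  rw [enorm_smul, Pi.mul_apply, Real.enorm_of_nonneg ((planeBump k).nonneg_normed t)]

/-- Young's inequality: Jensen for the probability measure `bumpMeasure k` at each point, then
Tonelli and translation invariance. -/
theorem eLpNorm_mollify_le (k : ℕ) {f : Plane → ℂ} (hf : AEStronglyMeasurable f) {p : ENNReal}
    (hp1 : 1 ≤ p) (hp : p ≠ ⊤) : eLpNorm (mollify k f) p ≤ eLpNorm f p := by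
  wlog hsm : StronglyMeasurable f generalizing f
  · rw [mollify_congr k hf.ae_eq_mk, eLpNorm_congr_ae hf.ae_eq_mk]
    exact this hf.stronglyMeasurable_mk.aestronglyMeasurable hf.stronglyMeasurable_mk
  have hp0 : p ≠ 0 := (zero_lt_one.trans_le hp1).ne'
  have hpr : 0 < p.toReal := ENNReal.toReal_pos hp0 hp
  rw [eLpNorm_eq_lintegral_rpow_enorm_toReal hp0 hp, eLpNorm_eq_lintegral_rpow_enorm_toReal hp0 hp]
  gcongr ?_ ^ _
  have hmeas : ∀ x, AEStronglyMeasurable (fun t => f (x - t)) (bumpMeasure k) := fun x =>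
    (hsm.comp_measurable (measurable_const.sub measurable_id)).aestronglyMeasurable
  calc ∫⁻ x, ‖mollify k f x‖ₑ ^ p.toReal
      ≤ ∫⁻ x, ∫⁻ t, ‖f (x - t)‖ₑ ^ p.toReal ∂bumpMeasure k := by
        refine lintegral_mono fun x => ?_
        have h1 : ‖mollify k f x‖ₑ ≤ eLpNorm (fun t => f (x - t)) p (bumpMeasure k) := by
          refine (enorm_mollify_le k hsm x).trans ?_
          rw [← eLpNorm_one_eq_lintegral_enorm]
          exact eLpNorm_le_eLpNorm_of_exponent_le hp1 (hmeas x)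
        rw [eLpNorm_eq_lintegral_rpow_enorm_toReal hp0 hp] at h1
        calc _ ≤ _ := ENNReal.rpow_le_rpow h1 hpr.le
          _ = _ := by rw [← ENNReal.rpow_mul, one_div_mul_cancel hpr.ne', ENNReal.rpow_one]
    _ = ∫⁻ t, ∫⁻ x, ‖f (x - t)‖ₑ ^ p.toReal ∂volume ∂bumpMeasure k := by
        apply lintegral_lintegral_swap
        exact ((hsm.measurable.comp measurable_sub).enorm.pow_const _).aemeasurable
    _ = ∫⁻ t, ∫⁻ x, ‖f x‖ₑ ^ p.toReal ∂volume ∂bumpMeasure k := by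
        congr 1; ext t
        exact lintegral_sub_right_eq_self (fun x => ‖f x‖ₑ ^ p.toReal) t
    _ = ∫⁻ x, ‖f x‖ₑ ^ p.toReal := by simp

/-- Convergence is uniform by uniform continuity, and all supports lie in one compact neighbourhood
of the support of g, since the kernels have radius at most 1. -/
theorem tendsto_eLpNorm_mollify_sub_of_continuous {g : Plane → ℂ} (hg : Continuous g)
    (hgc : HasCompactSupport g) {p : ENNReal} (hp : p ≠ ⊤) :
    Tendsto (fun k => eLpNorm (mollify k g - g) p) atTop (𝓝 0) := by
  set K := Metric.cthickening 1 (tsupport g) with hK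
  have hKc : IsCompact K := hgc.isCompact.cthickening
  have hKμ : volume K ≠ ⊤ := hKc.measure_lt_top.ne
  have hsupp : ∀ k, Function.support (mollify k g) ⊆ K := by
    intro k x hx
    obtain ⟨s, hs, t, ht, rfl⟩ := support_convolution_subset _ hx
    rw [(planeBump k).support_normed_eq, mem_ball_zero_iff] at hs
    refine Metric.mem_cthickening_of_dist_le _ t _ _ (subset_tsupport g ht) ?_
    rw [dist_eq_norm]
    have := planeBump_rOut_le_one k
    simpa using (hs.le.trans this)
  have huc := hgc.uniformContinuous_of_continuous hg
  have hbound : ∀ c : ℝ, 0 < c → ∀ᶠ k in atTop,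
      eLpNorm (mollify k g - g) p ≤ ENNReal.ofReal c * volume K ^ (1 / p.toReal) := by
    intro c hc
    obtain ⟨δ, hδ, hδg⟩ := Metric.uniformContinuous_iff.1 huc c hc
    filter_upwards [tendsto_planeBump_rOut.eventually (gt_mem_nhds hδ)] with k hk
    refine eLpNorm_sub_le_of_dist_bdd volume hp hKc.measurableSet hc.le (fun x => ?_) (hsupp k)
      ((subset_tsupport g).trans (Metric.self_subset_cthickening _))
    exact ContDiffBump.dist_normed_convolution_le hg.aestronglyMeasurable
      fun y hy => (hδg ((Metric.mem_ball.1 hy).trans hk)).le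
  rw [ENNReal.tendsto_nhds_zero]
  intro ε hε
  have hM : volume K ^ (1 / p.toReal) ≠ ⊤ := ENNReal.rpow_ne_top_of_nonneg (by positivity) hKμ
  have hlim : Tendsto (fun c : ℝ => ENNReal.ofReal c * volume K ^ (1 / p.toReal)) (𝓝[>] 0) (𝓝 0) := by
    have h1 : Tendsto (fun c : ℝ => ENNReal.ofReal c) (𝓝[>] 0) (𝓝 0) := by
      have := (ENNReal.continuous_ofReal.tendsto 0).mono_left (nhdsWithin_le_nhds (s := Ioi 0))
      rwa [ENNReal.ofReal_zero] at this
    simpa using ENNReal.Tendsto.mul_const h1 (Or.inr hM)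
  obtain ⟨c, hcε, hc⟩ := ((hlim.eventually (ge_mem_nhds hε)).and self_mem_nhdsWithin).exists
  filter_upwards [hbound c hc] with k hk using hk.trans hcε

/-- Mollifications of an `Lᵖ` function converge to it in `Lᵖ`. -/
theorem tendsto_eLpNorm_mollify_sub {f : Plane → ℂ} {p : ENNReal} (hf : MemLp f p)
    (hp1 : 1 ≤ p) (hp : p ≠ ⊤) :
    Tendsto (fun k => eLpNorm (mollify k f - f) p) atTop (𝓝 0) := by
  rw [ENNReal.tendsto_nhds_zero]
  intro ε hε
  have hε3 : ε / 3 ≠ 0 := (ENNReal.div_pos hε.ne' (by norm_num)).ne'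
  obtain ⟨g, hgc, hfg, hg, hgp⟩ := hf.exists_hasCompactSupport_eLpNorm_sub_le hp hε3
  filter_upwards [(ENNReal.tendsto_nhds_zero.1 (tendsto_eLpNorm_mollify_sub_of_continuous hg hgc hp))
    (ε / 3) (pos_iff_ne_zero.2 hε3)] with k hk
  have hfl := hf.locallyIntegrable hp1
  have hgl := hgp.locallyIntegrable hp1
  have hmf : ∀ {h : Plane → ℂ}, LocallyIntegrable h → AEStronglyMeasurable (mollify k h) :=
    fun h => (contDiff_mollify k h).continuous.aestronglyMeasurable
  have hsubl : LocallyIntegrable (f - g) := hfl.sub hgl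
  have hsub : AEStronglyMeasurable (f - g) := hf.aestronglyMeasurable.sub hgp.aestronglyMeasurable
  have hmg : AEStronglyMeasurable (mollify k g - g) := (hmf hgl).sub hgp.aestronglyMeasurable
  have hsum : mollify k f = mollify k (f - g) + mollify k g := by
    rw [← mollify_add k hsubl hgl, sub_add_cancel]
  have hdecomp : mollify k f - f = mollify k (f - g) + ((mollify k g - g) - (f - g)) := by
    rw [hsum]; abel
  have e1 : eLpNorm (mollify k f - f) p ≤
      eLpNorm (mollify k (f - g)) p + eLpNorm ((mollify k g - g) - (f - g)) p := by
    rw [hdecomp]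
    exact eLpNorm_add_le (hmf hsubl) (hmg.sub hsub) hp1
  have e2 : eLpNorm (mollify k (f - g)) p ≤ ε / 3 := (eLpNorm_mollify_le k hsub hp1 hp).trans hfg
  have e3 : eLpNorm ((mollify k g - g) - (f - g)) p ≤ ε / 3 + ε / 3 :=
    (eLpNorm_sub_le hmg hsub hp1).trans (add_le_add hk hfg)
  have e4 : ε / 3 + (ε / 3 + ε / 3) = ε := by rw [← add_assoc, ENNReal.add_thirds]
  exact e4 ▸ e1.trans (add_le_add e2 e3)

end Mollification

/-! ### Weak derivatives and their mollification. -/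

section WeakPartial

theorem IsWeakPartial.ae_unique {i : Fin 2} {u g g' : Plane → ℂ} (h : IsWeakPartial i u g)
    (h' : IsWeakPartial i u g') : g =ᵐ[volume] g' :=
  ae_eq_of_integral_contDiff_smul_eq h.2.1 h'.2.1 fun φ hφ hφc => by
    have h1 := h.2.2 φ hφ hφc
    have h2 := h'.2.2 φ hφ hφc
    rw [h1] at h2
    exact neg_injective h2

/-- Makes the choice hidden in `weakPartial` harmless: any explicit weak derivative may replace it
almost everywhere. -/
theorem IsWeakPartial.weakPartial_ae_eq {i : Fin 2} {u g : Plane → ℂ} (h : IsWeakPartial i u g) :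
    weakPartial i u =ᵐ[volume] g := by
  have hex : ∃ g, IsWeakPartial i u g := ⟨g, h⟩
  rw [weakPartial, dif_pos hex]
  exact hex.choose_spec.ae_unique h

theorem IsWeakPartial.add {i : Fin 2} {u v g h : Plane → ℂ} (hu : IsWeakPartial i u g)
    (hv : IsWeakPartial i v h) : IsWeakPartial i (u + v) (g + h) := by
  refine ⟨hu.1.add hv.1, hu.2.1.add hv.2.1, fun φ hφ hφc => ?_⟩
  have hc1 : Continuous fun x => fderiv ℝ φ x (planeBasis i) :=
    (hφ.continuous_fderiv (by simp)).clm_apply continuous_const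
  have hs1 : HasCompactSupport fun x => fderiv ℝ φ x (planeBasis i) := hφc.fderiv_apply ℝ _
  have hc := hφ.continuous
  simp only [Pi.add_apply, smul_add]
  rw [integral_add (hu.1.integrable_smul_left_of_hasCompactSupport hc1 hs1)
    (hv.1.integrable_smul_left_of_hasCompactSupport hc1 hs1),
    integral_add (hu.2.1.integrable_smul_left_of_hasCompactSupport hc hφc)
    (hv.2.1.integrable_smul_left_of_hasCompactSupport hc hφc), hu.2.2 φ hφ hφc, hv.2.2 φ hφ hφc]
  ring

theorem isWeakPartial_of_contDiff (i : Fin 2) {u : Plane → ℂ} (hu : ContDiff ℝ 1 u) :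
    IsWeakPartial i u fun x => fderiv ℝ u x (planeBasis i) := by
  have hc1 : Continuous fun x => fderiv ℝ u x (planeBasis i) :=
    (hu.continuous_fderiv (by simp)).clm_apply continuous_const
  refine ⟨hu.continuous.locallyIntegrable, hc1.locallyIntegrable, fun φ hφ hφc => ?_⟩
  have hc2 : Continuous fun x => fderiv ℝ φ x (planeBasis i) :=
    (hφ.continuous_fderiv (by simp)).clm_apply continuous_const
  have hs2 : HasCompactSupport fun x => fderiv ℝ φ x (planeBasis i) := hφc.fderiv_apply ℝ _
  have := integral_bilinear_hasFDerivAt_right_eq_neg_left_of_integrable (μ := volume)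
    (f := φ) (f' := fderiv ℝ φ) (g := u) (g' := fderiv ℝ u) (v := planeBasis i)
    (B := ContinuousLinearMap.lsmul ℝ ℝ) ?_ ?_ ?_ ?_ ?_
  · simp only [ContinuousLinearMap.lsmul_apply] at this
    rw [this, neg_neg]
  · exact hu.continuous.locallyIntegrable.integrable_smul_left_of_hasCompactSupport hc2 hs2
  · exact hc1.locallyIntegrable.integrable_smul_left_of_hasCompactSupport hφ.continuous hφc
  · exact hu.continuous.locallyIntegrable.integrable_smul_left_of_hasCompactSupport hφ.continuous hφc
  · exact fun x _ => (hφ.differentiable (by simp) x).hasFDerivAt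
  · exact fun x _ => (hu.differentiable (by simp) x).hasFDerivAt

/-- Partial derivatives of the mollification are mollifications of the weak partial derivatives. -/
theorem IsWeakPartial.fderiv_mollify {i : Fin 2} {u g : Plane → ℂ} (h : IsWeakPartial i u g)
    (k : ℕ) (x : Plane) : fderiv ℝ (mollify k u) x (planeBasis i) = mollify k g x := by
  set f := (planeBump k).normed volume with hf
  have hfc : HasCompactSupport f := (planeBump k).hasCompactSupport_normed
  have hfs : ContDiff ℝ ∞ f := (planeBump k).contDiff_normed
  have hf1 : ContDiff ℝ 1 f := hfs.of_le (by simp)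
  have hd := hfc.hasFDerivAt_convolution_left (ContinuousLinearMap.lsmul ℝ ℝ) hf1 h.1 x
  have hex := (hfc.fderiv ℝ).convolutionExists_left
    ((ContinuousLinearMap.lsmul ℝ ℝ : ℝ →L[ℝ] ℂ →L[ℝ] ℂ).precompL Plane)
    (hfs.continuous_fderiv (by simp)) h.1 x
  rw [show mollify k u = convolution f u (ContinuousLinearMap.lsmul ℝ ℝ) volume from rfl, hd.fderiv,
    convolution_def, ContinuousLinearMap.integral_apply hex]
  simp only [ContinuousLinearMap.precompL_apply, ContinuousLinearMap.lsmul_apply]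
  -- The reflected kernel serves as test function; the sign produced by the reflection cancels the
  -- one in the definition of the weak derivative.
  set φ : Plane → ℝ := fun t => f (x - t) with hφ
  have hφs : ContDiff ℝ ∞ φ := hfs.comp (contDiff_const.sub contDiff_id)
  have hφc : HasCompactSupport φ := hfc.comp_homeomorph (Homeomorph.subLeft x)
  have hφd : ∀ t, fderiv ℝ φ t (planeBasis i) = - fderiv ℝ f (x - t) (planeBasis i) := by
    intro t
    have h1 : HasFDerivAt φ ((fderiv ℝ f (x - t)).comp (-(ContinuousLinearMap.id ℝ Plane))) t :=
      ((hfs.differentiable (by simp)) (x - t)).hasFDerivAt.comp t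
        (((hasFDerivAt_id t).const_sub x))
    rw [h1.fderiv]; simp
  have key := h.2.2 φ hφs hφc
  simp_rw [hφd, neg_smul] at key
  rw [integral_neg, neg_inj] at key
  rw [mollify_apply, ← integral_sub_left_eq_self _ volume x]
  simp only [sub_sub_cancel]
  rw [key, ← integral_sub_left_eq_self _ volume x]
  simp only [hφ, sub_sub_cancel]
  rfl

end WeakPartial

/-! ### Ladyzhenskaya's inequality and the embedding into L⁴. -/

section SobolevEmbedding

instance holderTriple_four_four_two : ENNReal.HolderTriple 4 4 2 := by
  constructor
  have h : (4 : ENNReal) = 2 * 2 := by norm_num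
  rw [← two_mul, h, ENNReal.mul_inv (by simp) (by simp), ← mul_assoc,
    ENNReal.mul_inv_cancel (by simp) (by simp), one_mul]

theorem norm_planeBasis (i : Fin 2) : ‖planeBasis i‖ = 1 := by
  simp [planeBasis]

theorem opNorm_le_sum_planeBasis (L : Plane →L[ℝ] ℂ) :
    ‖L‖ ≤ ‖L (planeBasis 0)‖ + ‖L (planeBasis 1)‖ := by
  refine L.opNorm_le_bound (by positivity) fun x => ?_
  have h0 : |x 0| ≤ ‖x‖ := by simpa using PiLp.norm_apply_le x 0
  have h1 : |x 1| ≤ ‖x‖ := by simpa using PiLp.norm_apply_le x 1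
  conv_lhs => rw [plane_eq_sum x]
  rw [map_add, map_smul, map_smul]
  refine (norm_add_le _ _).trans ?_
  rw [norm_smul, norm_smul, Real.norm_eq_abs, Real.norm_eq_abs, add_mul, mul_comm |x 0|, mul_comm |x 1|]
  gcongr

/-- Ladyzhenskaya's inequality for compactly supported functions in the plane. -/
theorem exists_eLpNorm_sq_le : ∃ C : NNReal, ∀ w : Plane → ℂ, ContDiff ℝ 1 w →
    HasCompactSupport w →
    eLpNorm (fun x => w x ^ 2) 2 ≤ C * (eLpNorm w 2 * eLpNorm (fderiv ℝ w) 2) := by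
  refine ⟨eLpNormLESNormFDerivOneConst (volume : Measure Plane) 2 * 2, fun w hw hwc => ?_⟩
  -- The Gagliardo-Nirenberg-Sobolev inequality for exponent 1 bounds the L² norm of w² by the L¹
  -- norm of 2w∇w, to which Hölder applies.
  have hsq : ContDiff ℝ 1 fun x => w x ^ 2 := hw.pow 2
  have hsqc : HasCompactSupport fun x => w x ^ 2 :=
    hwc.comp_left (g := fun z : ℂ => z ^ 2) (by simp)
  have hdim : NNReal.HolderConjugate (Module.finrank ℝ Plane) 2 := by
    rw [finrank_euclideanSpace_fin, NNReal.holderConjugate_iff]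
    constructor
    · norm_num
    · push_cast; rw [← two_mul]; exact mul_inv_cancel₀ two_ne_zero
  refine (eLpNorm_le_eLpNorm_fderiv_one (volume : Measure Plane) hsq hsqc hdim).trans ?_
  have hd : ∀ x, fderiv ℝ (fun x => w x ^ 2) x = (2 * w x) • fderiv ℝ w x := by
    intro x
    have h1 : HasFDerivAt w (fderiv ℝ w x) x := (hw.differentiable (by simp) x).hasFDerivAt
    rw [(h1.pow 2).fderiv]
    ext y; simp
  have hcd : Continuous (fderiv ℝ w) := hw.continuous_fderiv (by simp)
  have h1 : eLpNorm (fderiv ℝ fun x => w x ^ 2) 1 ≤ 2 * (eLpNorm w 2 * eLpNorm (fderiv ℝ w) 2) := by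
    have e : ∀ x, ‖fderiv ℝ (fun x => w x ^ 2) x‖ ≤
        (2 : ℝ) * ‖((fun x => ‖w x‖) • fun x => ‖fderiv ℝ w x‖) x‖ := by
      intro x
      rw [hd, norm_smul, norm_mul, Complex.norm_ofNat, mul_assoc]
      simp
    have h2 : eLpNorm (fderiv ℝ fun x => w x ^ 2) 1 ≤
        ENNReal.ofReal 2 * eLpNorm ((fun x => ‖w x‖) • fun x => ‖fderiv ℝ w x‖) 1 :=
      eLpNorm_le_mul_eLpNorm_of_ae_le_mul (Eventually.of_forall e) 1
    have h3 : eLpNorm ((fun x => ‖w x‖) • fun x => ‖fderiv ℝ w x‖) 1 ≤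
        eLpNorm (fun x => ‖w x‖) 2 * eLpNorm (fun x => ‖fderiv ℝ w x‖) 2 :=
      eLpNorm_smul_le_mul_eLpNorm hcd.norm.aestronglyMeasurable
        hw.continuous.norm.aestronglyMeasurable
    rw [eLpNorm_norm, eLpNorm_norm] at h3
    rw [ENNReal.ofReal_ofNat] at h2
    exact h2.trans (mul_le_mul_right h3 2)
  refine (mul_le_mul_right h1 _).trans (le_of_eq ?_)
  push_cast; ring

/-- Smooth cutoff functions exhausting the plane. -/
noncomputable def planeCutoff (k : ℕ) : ContDiffBump (0 : Plane) where
  rIn := (k : ℝ) + 1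
  rOut := 2 * ((k : ℝ) + 1)
  rIn_pos := by positivity
  rIn_lt_rOut := by linarith [(Nat.cast_nonneg k : (0 : ℝ) ≤ k)]

/-- All cutoffs are dilations of the first one by factors at least 1, which can only shrink the
gradient. -/
theorem exists_norm_fderiv_planeCutoff_le :
    ∃ C : ℝ, 0 ≤ C ∧ ∀ k x, ‖fderiv ℝ (planeCutoff k) x‖ ≤ C := by
  have hs : ContDiff ℝ 1 (planeCutoff 0) := (planeCutoff 0).contDiff
  obtain ⟨C, hC⟩ := ((planeCutoff 0).hasCompactSupport.fderiv ℝ).exists_bound_of_continuous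
    (hs.continuous_fderiv (by simp))
  have hC0 : 0 ≤ C := (norm_nonneg _).trans (hC 0)
  refine ⟨C, hC0, fun k x => ?_⟩
  set c : ℝ := ((k : ℝ) + 1)⁻¹ with hc
  have hc0 : 0 < c := by positivity
  have hc1 : c ≤ 1 := inv_le_one_of_one_le₀ (by linarith [(Nat.cast_nonneg k : (0 : ℝ) ≤ k)])
  have hscale : (planeCutoff k : Plane → ℝ) = fun x => planeCutoff 0 (c • x) := by
    ext x
    have hk : (k : ℝ) + 1 ≠ 0 := by positivity
    simp only [ContDiffBump.apply, planeCutoff, sub_zero, Nat.cast_zero, zero_add, mul_one]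
    congr 1
    · field_simp
    · simp [hc]
  rw [hscale, fderiv_comp_smul, norm_smul, Real.norm_of_nonneg hc0.le]
  calc c * ‖fderiv ℝ (planeCutoff 0) (c • x)‖ ≤ 1 * C := by
        gcongr; exact hC _
    _ = C := one_mul C

theorem ae_tendsto_mollify {f : Plane → ℂ} (hf : LocallyIntegrable f) :
    ∀ᵐ x, Tendsto (fun k => mollify k f x) atTop (𝓝 (f x)) :=
  ContDiffBump.ae_convolution_tendsto_right_of_locallyIntegrable (K := 2) tendsto_planeBump_rOut
    (Eventually.of_forall fun k => by
      show 1 / ((k : ℝ) + 1) ≤ 2 * (1 / (2 * ((k : ℝ) + 1)))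
      apply le_of_eq; field_simp) hf

/-- The Sobolev embedding `H¹(ℝ²) ⊆ L⁴(ℝ²)`. -/
theorem MemH1.memLp_four {v : Plane → ℂ} (hv : MemH1 v) : MemLp v 4 := by
  obtain ⟨hv2, hg⟩ := hv
  choose g hgw hg2 using hg
  obtain ⟨C, hC⟩ := exists_eLpNorm_sq_le
  obtain ⟨K, hK0, hK⟩ := exists_norm_fderiv_planeCutoff_le
  have hvl : LocallyIntegrable v := hv2.locallyIntegrable (by norm_num)
  -- Truncated mollifications are smooth and compactly supported, are bounded in H¹ uniformly in k,
  -- and converge to v almost everywhere.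
  set w : ℕ → Plane → ℂ := fun k x => (planeCutoff k x) • mollify k v x with hw
  have hms : ∀ k, ContDiff ℝ 1 (mollify k v) := fun k => (contDiff_mollify k hvl).of_le (by simp)
  have hws : ∀ k, ContDiff ℝ 1 (w k) := fun k => (planeCutoff k).contDiff.smul (hms k)
  have hwc : ∀ k, HasCompactSupport (w k) := fun k => (planeCutoff k).hasCompactSupport.smul_right
  have hle1 : ∀ k x, ‖planeCutoff k x‖ ≤ 1 := fun k x => by
    rw [Real.norm_of_nonneg (planeCutoff k).nonneg]; exact (planeCutoff k).le_one
  have hw2 : ∀ k, eLpNorm (w k) 2 ≤ eLpNorm v 2 := by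
    intro k
    refine le_trans (eLpNorm_mono fun x => ?_)
      (eLpNorm_mollify_le k hv2.aestronglyMeasurable (by norm_num) (by norm_num))
    rw [hw, norm_smul]
    exact mul_le_of_le_one_left (norm_nonneg _) (hle1 k x)
  have hdm : ∀ k i, eLpNorm (fun x => fderiv ℝ (mollify k v) x (planeBasis i)) 2
      ≤ eLpNorm (g i) 2 := by
    intro k i
    simp_rw [fun x => (hgw i).fderiv_mollify k x]
    exact eLpNorm_mollify_le k (hg2 i).aestronglyMeasurable (by norm_num) (by norm_num)
  set M : ENNReal := eLpNorm (g 0) 2 + eLpNorm (g 1) 2 + ENNReal.ofReal K * eLpNorm v 2 with hM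
  have hMtop : M ≠ ⊤ := by
    simp only [hM, ne_eq, ENNReal.add_eq_top, not_or]
    exact ⟨⟨(hg2 0).eLpNorm_ne_top, (hg2 1).eLpNorm_ne_top⟩,
      ENNReal.mul_ne_top ENNReal.ofReal_ne_top hv2.eLpNorm_ne_top⟩
  have hdw : ∀ k, eLpNorm (fderiv ℝ (w k)) 2 ≤ M := by
    intro k
    have hc : ∀ i, Continuous fun x => fderiv ℝ (mollify k v) x (planeBasis i) := fun i =>
      ((hms k).continuous_fderiv (by simp)).clm_apply continuous_const
    have hb : ∀ x, ‖fderiv ℝ (w k) x‖ ≤ ‖fderiv ℝ (mollify k v) x (planeBasis 0)‖ +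
        ‖fderiv ℝ (mollify k v) x (planeBasis 1)‖ + ‖K • mollify k v x‖ := by
      intro x
      have h1 : HasFDerivAt (planeCutoff k) (fderiv ℝ (planeCutoff k) x) x :=
        (((planeCutoff k).contDiff (n := 1)).differentiable (by simp) x).hasFDerivAt
      have h2 : HasFDerivAt (mollify k v) (fderiv ℝ (mollify k v) x) x :=
        ((hms k).differentiable (by simp) x).hasFDerivAt
      have h3 := (h1.smul h2).fderiv
      have h4 : fderiv ℝ (w k) x = planeCutoff k x • fderiv ℝ (mollify k v) x
        + (fderiv ℝ (planeCutoff k) x).smulRight (mollify k v x) := h3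
      rw [h4]
      refine (norm_add_le _ _).trans (add_le_add ?_ ?_)
      · rw [norm_smul]
        exact (mul_le_of_le_one_left (norm_nonneg _) (hle1 k x)).trans (opNorm_le_sum_planeBasis _)
      · rw [ContinuousLinearMap.norm_smulRight_apply, norm_smul, Real.norm_of_nonneg hK0]
        gcongr
        exact hK k x
    have hmc := (hms k).continuous
    have m0 := (hc 0).norm.aestronglyMeasurable (μ := volume)
    have m1 := (hc 1).norm.aestronglyMeasurable (μ := volume)
    have m2 := (hmc.const_smul K).norm.aestronglyMeasurable (μ := volume)
    have e1 := eLpNorm_mono_real (p := 2) (μ := volume) hb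
    have e2 := eLpNorm_add_le (p := 2) (m0.add m1) m2 (by norm_num)
    have e3 := eLpNorm_add_le (p := 2) m0 m1 (by norm_num)
    rw [eLpNorm_norm] at e2
    rw [eLpNorm_norm, eLpNorm_norm] at e3
    have e4 : eLpNorm (fun x => K • mollify k v x) 2 ≤ ENNReal.ofReal K * eLpNorm v 2 := by
      have : (fun x => K • mollify k v x) = K • mollify k v := rfl
      rw [this, eLpNorm_const_smul, Real.enorm_of_nonneg hK0]
      gcongr
      exact eLpNorm_mollify_le k hv2.aestronglyMeasurable (by norm_num) (by norm_num)
    exact e1.trans (e2.trans (add_le_add (e3.trans (add_le_add (hdm k 0) (hdm k 1))) e4))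
  have hlim : ∀ᵐ x, Tendsto (fun k => w k x ^ 2) atTop (𝓝 (v x ^ 2)) := by
    filter_upwards [ae_tendsto_mollify hvl] with x hx
    refine Tendsto.pow ?_ 2
    have h1 : ∀ᶠ k : ℕ in atTop, w k x = mollify k v x := by
      obtain ⟨N, hN⟩ := exists_nat_ge ‖x‖
      filter_upwards [eventually_ge_atTop N] with k hk
      have : planeCutoff k x = 1 := by
        apply (planeCutoff k).one_of_mem_closedBall
        rw [mem_closedBall_zero_iff]
        show ‖x‖ ≤ (k : ℝ) + 1
        have : (N : ℝ) ≤ k := by exact_mod_cast hk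
        linarith
      simp [hw, this]
    exact hx.congr' (h1.mono fun k hk => hk.symm)
  have hsq : eLpNorm (fun x => v x ^ 2) 2 ≤ C * (eLpNorm v 2 * M) := by
    -- Fatou's lemma transfers the uniform bound on the squares to v².
    refine (Lp.eLpNorm_lim_le_liminf_eLpNorm
      (fun k => ((hws k).continuous.pow 2).aestronglyMeasurable) _ hlim).trans ?_
    refine liminf_le_of_frequently_le' (Frequently.of_forall fun k => ?_)
    refine (hC (w k) (hws k) (hwc k)).trans ?_
    gcongr
    · exact hw2 k
    · exact hdw k
  refine ⟨hv2.aestronglyMeasurable, ?_⟩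
  have h4 : eLpNorm (fun x => v x ^ 2) 2 = eLpNorm v 4 ^ (2 : ℝ) := by
    have h5 := eLpNorm_norm_rpow (p := 2) (q := 2) (μ := (volume : Measure Plane)) v (by norm_num)
    have h6 : (2 : ENNReal) * ENNReal.ofReal 2 = 4 := by norm_num
    rw [h6] at h5
    rw [← h5, ← eLpNorm_norm]
    congr 1; ext x; simp
  have hlt : eLpNorm v 4 ^ (2 : ℝ) < ⊤ := by
    rw [← h4]
    exact hsq.trans_lt (ENNReal.mul_lt_top ENNReal.coe_lt_top
      (ENNReal.mul_lt_top hv2.eLpNorm_lt_top hMtop.lt_top))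
  by_contra hcon
  rw [not_lt, top_le_iff] at hcon
  rw [hcon] at hlt
  simp at hlt

end SobolevEmbedding

/-! ### Convergence of products in Lᵖ and smooth approximation. -/

/-- Convergence in `Lᵖ` of a sequence of complex functions. -/
structure LpTendsto (μ : Measure Plane) (p : ENNReal) (F : ℕ → Plane → ℂ) (f : Plane → ℂ) :
    Prop where
  memLp : ∀ k, MemLp (F k) p μ
  memLp_lim : MemLp f p μ
  tendsto : Tendsto (fun k => eLpNorm (F k - f) p μ) atTop (𝓝 0)

namespace LpTendsto

variable {μ : Measure Plane} {p q r : ENNReal} {F G : ℕ → Plane → ℂ} {f g : Plane → ℂ}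

theorem const (hf : MemLp f p μ) : LpTendsto μ p (fun _ => f) f :=
  ⟨fun _ => hf, hf, by simp⟩

theorem add (hF : LpTendsto μ p F f) (hG : LpTendsto μ p G g) (hp : 1 ≤ p) :
    LpTendsto μ p (fun k x => F k x + G k x) fun x => f x + g x := by
  refine ⟨fun k => (hF.memLp k).add (hG.memLp k), hF.memLp_lim.add hG.memLp_lim, ?_⟩
  have hlim := hF.tendsto.add hG.tendsto
  rw [add_zero] at hlim
  refine tendsto_of_tendsto_of_tendsto_of_le_of_le tendsto_const_nhds hlim
    (fun k => zero_le) fun k => ?_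
  have : (fun x => F k x + G k x) - (fun x => f x + g x) = (F k - f) + (G k - g) := by
    ext x; simp; ring
  rw [this]
  exact eLpNorm_add_le ((hF.memLp k).sub hF.memLp_lim).aestronglyMeasurable
    ((hG.memLp k).sub hG.memLp_lim).aestronglyMeasurable hp

theorem mul [ENNReal.HolderTriple p q r] (hF : LpTendsto μ p F f) (hG : LpTendsto μ q G g)
    (hr : 1 ≤ r) : LpTendsto μ r (fun k x => F k x * G k x) fun x => f x * g x := by
  refine ⟨fun k => (hG.memLp k).mul (hF.memLp k), hG.memLp_lim.mul hF.memLp_lim, ?_⟩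
  have hf := hF.memLp_lim.eLpNorm_ne_top
  have hg := hG.memLp_lim.eLpNorm_ne_top
  have h1 : Tendsto (fun k => eLpNorm (F k - f) p μ * (eLpNorm (G k - g) q μ + eLpNorm g q μ)
      + eLpNorm f p μ * eLpNorm (G k - g) q μ) atTop (𝓝 0) := by
    have h2 : Tendsto (fun k => eLpNorm (G k - g) q μ + eLpNorm g q μ) atTop
        (𝓝 (eLpNorm g q μ)) := by
      simpa using hG.tendsto.add_const (eLpNorm g q μ)
    have h3 := ENNReal.Tendsto.mul hF.tendsto (Or.inr hg) h2 (Or.inr ENNReal.zero_ne_top)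
    have h4 := ENNReal.Tendsto.const_mul (a := eLpNorm f p μ) hG.tendsto (Or.inr hf)
    simpa using h3.add h4
  refine tendsto_of_tendsto_of_tendsto_of_le_of_le tendsto_const_nhds h1
    (fun k => zero_le) fun k => ?_
  have mF := ((hF.memLp k).sub hF.memLp_lim).aestronglyMeasurable
  have mG := ((hG.memLp k).sub hG.memLp_lim).aestronglyMeasurable
  have mg := hG.memLp_lim.aestronglyMeasurable
  have mf := hF.memLp_lim.aestronglyMeasurable
  have e : (fun x => F k x * G k x) - (fun x => f x * g x)
      = (F k - f) • ((G k - g) + g) + f • (G k - g) := by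
    ext x; simp; ring
  have e1 : eLpNorm ((F k - f) • ((G k - g) + g) + f • (G k - g)) r μ ≤
      eLpNorm ((F k - f) • ((G k - g) + g)) r μ + eLpNorm (f • (G k - g)) r μ :=
    eLpNorm_add_le (mF.smul (mG.add mg)) (mf.smul mG) hr
  have e2 : eLpNorm ((F k - f) • ((G k - g) + g)) r μ ≤
      eLpNorm (F k - f) p μ * eLpNorm ((G k - g) + g) q μ :=
    eLpNorm_smul_le_mul_eLpNorm (mG.add mg) mF
  have e3 : eLpNorm (f • (G k - g)) r μ ≤ eLpNorm f p μ * eLpNorm (G k - g) q μ :=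
    eLpNorm_smul_le_mul_eLpNorm mG mf
  have e4 : eLpNorm ((G k - g) + g) q μ ≤ eLpNorm (G k - g) q μ + eLpNorm g q μ := by
    by_cases hq : 1 ≤ q
    · exact eLpNorm_add_le mG mg hq
    · exfalso
      have h := ENNReal.HolderTriple.inv_add_inv_eq_inv p q r
      apply hq
      have h5 : q⁻¹ ≤ r⁻¹ := by rw [← h]; exact le_add_self
      exact hr.trans (ENNReal.inv_le_inv.1 h5)
  rw [e]
  exact e1.trans (add_le_add (e2.trans (mul_le_mul_right e4 _)) e3)

theorem conj (hF : LpTendsto μ p F f) :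
    LpTendsto μ p (fun k x => (starRingEnd ℂ) (F k x)) fun x => (starRingEnd ℂ) (f x) := by
  have hm : ∀ {h : Plane → ℂ}, MemLp h p μ → MemLp (fun x => (starRingEnd ℂ) (h x)) p μ :=
    fun hh => hh.of_le (Complex.continuous_conj.comp_aestronglyMeasurable hh.aestronglyMeasurable)
      (ae_of_all _ fun x => by simp)
  refine ⟨fun k => hm (hF.memLp k), hm hF.memLp_lim, hF.tendsto.congr fun k => ?_⟩
  refine eLpNorm_congr_norm_ae (ae_of_all _ fun x => ?_)
  simp only [Pi.sub_apply]
  rw [← map_sub, RCLike.norm_conj]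

theorem const_mul (hF : LpTendsto μ p F f) (c : ℂ) :
    LpTendsto μ p (fun k x => c * F k x) fun x => c * f x := by
  refine ⟨fun k => (hF.memLp k).const_mul c, hF.memLp_lim.const_mul c, ?_⟩
  have h1 := ENNReal.Tendsto.const_mul (a := ‖c‖ₑ) hF.tendsto (Or.inr enorm_ne_top)
  rw [mul_zero] at h1
  refine h1.congr fun k => ?_
  rw [← eLpNorm_const_smul]
  congr 1; ext x; simp [mul_sub]

theorem mono_measure {ν : Measure Plane} (hF : LpTendsto μ p F f) (h : ν ≤ μ) :
    LpTendsto ν p F f :=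
  ⟨fun k => (hF.memLp k).mono_measure h, hF.memLp_lim.mono_measure h,
    tendsto_of_tendsto_of_tendsto_of_le_of_le tendsto_const_nhds hF.tendsto
      (fun _ => zero_le) fun _ => eLpNorm_mono_measure _ h⟩

theorem congr_lim {g : Plane → ℂ} (hF : LpTendsto μ p F f) (h : f =ᵐ[μ] g) :
    LpTendsto μ p F g :=
  ⟨hF.memLp, hF.memLp_lim.ae_eq h, hF.tendsto.congr fun _ =>
    eLpNorm_congr_ae (by filter_upwards [h] with x hx; simp [hx])⟩

theorem tendsto_integral (hF : LpTendsto μ 1 F f) :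
    Tendsto (fun k => ∫ x, F k x ∂μ) atTop (𝓝 (∫ x, f x ∂μ)) :=
  tendsto_integral_of_L1' _ hF.memLp_lim.aestronglyMeasurable
    (Eventually.of_forall fun k => memLp_one_iff_integrable.1 (hF.memLp k)) hF.tendsto

theorem tendsto_integral_norm_sub (hF : LpTendsto μ 1 F f) :
    Tendsto (fun k => ∫ x, ‖F k x - f x‖ ∂μ) atTop (𝓝 0) := by
  have h1 : ∀ k, ∫ x, ‖F k x - f x‖ ∂μ = (eLpNorm (F k - f) 1 μ).toReal := fun k => by
    rw [eLpNorm_one_eq_lintegral_enorm]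
    exact integral_norm_eq_lintegral_enorm ((hF.memLp k).sub hF.memLp_lim).aestronglyMeasurable
  simp_rw [h1]
  exact (ENNReal.tendsto_toReal ENNReal.zero_ne_top).comp hF.tendsto

end LpTendsto

/-- The complexified Ginzburg-Landau density with partial derivatives `p₀`, `p₁`. -/
noncomputable def complexDensity (ε : ℝ) (z p₀ p₁ : ℂ) : ℂ :=
  (1 / 2) * (p₀ * (starRingEnd ℂ) p₀ + p₁ * (starRingEnd ℂ) p₁) + (1 / (4 * ε ^ 2) : ℝ) *
    ((z * (starRingEnd ℂ) z + -1) * (starRingEnd ℂ) (z * (starRingEnd ℂ) z + -1))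

theorem complexDensity_re (ε : ℝ) (z p₀ p₁ : ℂ) : (complexDensity ε z p₀ p₁).re =
    1 / 2 * (‖p₀‖ ^ 2 + ‖p₁‖ ^ 2) + 1 / (4 * ε ^ 2) * (‖z‖ ^ 2 - 1) ^ 2 := by
  have h : z * (starRingEnd ℂ) z + -1 = ((‖z‖ ^ 2 - 1 : ℝ) : ℂ) := by
    rw [Complex.mul_conj']; push_cast; ring
  unfold complexDensity
  rw [h, Complex.mul_conj', Complex.mul_conj', Complex.conj_ofReal]
  have : (1 / 2 : ℂ) * ((‖p₀‖ : ℂ) ^ 2 + (‖p₁‖ : ℂ) ^ 2) + (1 / (4 * ε ^ 2) : ℝ) *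
      (((‖z‖ ^ 2 - 1 : ℝ) : ℂ) * ((‖z‖ ^ 2 - 1 : ℝ) : ℂ)) =
      ((1 / 2 * (‖p₀‖ ^ 2 + ‖p₁‖ ^ 2) + 1 / (4 * ε ^ 2) * (‖z‖ ^ 2 - 1) ^ 2 : ℝ) : ℂ) := by
    push_cast; ring
  rw [this, Complex.ofReal_re]

/-- The density is a polynomial in its arguments and their conjugates. Two uses of Hölder, L⁴·L⁴
into L² and L²·L² into L¹, give convergence; finiteness of μ is needed for the constant −1. -/
theorem LpTendsto.complexDensity {μ : Measure Plane} [IsFiniteMeasure μ] {W P₀ P₁ : ℕ → Plane → ℂ}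
    {w p₀ p₁ : Plane → ℂ} (hW : LpTendsto μ 4 W w) (h₀ : LpTendsto μ 2 P₀ p₀)
    (h₁ : LpTendsto μ 2 P₁ p₁) (ε : ℝ) :
    LpTendsto μ 1 (fun k x => complexDensity ε (W k x) (P₀ k x) (P₁ k x))
      fun x => _root_.complexDensity ε (w x) (p₀ x) (p₁ x) := by
  have hq : LpTendsto μ 2 (fun k x => W k x * (starRingEnd ℂ) (W k x) + -1)
      fun x => w x * (starRingEnd ℂ) (w x) + -1 :=
    (hW.mul (r := 2) hW.conj (by norm_num)).add (LpTendsto.const (memLp_const (-1))) (by norm_num)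
  exact (((h₀.mul (r := 1) h₀.conj le_rfl).add (h₁.mul (r := 1) h₁.conj le_rfl) le_rfl).const_mul _).add
    ((hq.mul (r := 1) hq.conj le_rfl).const_mul _) le_rfl

/-- The current of a differentiable function. -/
noncomputable def classicalCurrent (w : Plane → ℂ) (i : Fin 2) (x : Plane) : ℝ :=
  ((Complex.I * w x) * (starRingEnd ℂ) (fderiv ℝ w x (planeBasis i))).re

theorem memLp_of_continuous_of_subset_ball {f : Plane → ℂ} (hf : Continuous f) {S : Set Plane}
    (hSm : MeasurableSet S) {R : ℝ} (hS : S ⊆ Metric.ball 0 R) (p : ENNReal) :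
    MemLp f p (volume.restrict S) := by
  have : IsFiniteMeasure (volume.restrict S) :=
    ⟨by rw [Measure.restrict_apply_univ]; exact (measure_mono hS).trans_lt measure_ball_lt_top⟩
  obtain ⟨C, hC⟩ := (isCompact_closedBall (0 : Plane) R).exists_bound_of_continuousOn hf.continuousOn
  refine MemLp.of_bound hf.aestronglyMeasurable C ?_
  filter_upwards [ae_restrict_mem hSm] with x hx using hC x (Metric.ball_subset_closedBall (hS hx))

/-- Maps in `[U] + H¹` are limits of smooth maps, locally in `H¹ ∩ L⁴`. -/
theorem exists_smooth_approximation {U u : Plane → ℂ} (hU : ContDiff ℝ ∞ U)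
    (hu : MemTranslatesAddH1 U u) : ∃ w : ℕ → Plane → ℂ, (∀ k, ContDiff ℝ ∞ (w k)) ∧
      ∀ (S : Set Plane) (R : ℝ), MeasurableSet S → S ⊆ Metric.ball 0 R →
        LpTendsto (volume.restrict S) 4 w u ∧ LpTendsto (volume.restrict S) 2 w u ∧
        ∀ i, LpTendsto (volume.restrict S) 2 (fun k x => fderiv ℝ (w k) x (planeBasis i))
          (weakPartial i u) := by
  obtain ⟨y, v, hv, huv⟩ := hu
  have hv4 := hv.memLp_four
  obtain ⟨hv2, hg⟩ := hv
  choose g hgw hg2 using hg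
  have hvl : LocallyIntegrable v := hv2.locallyIntegrable (by norm_num)
  set V : Plane → ℂ := fun x => U (x - y) with hV
  have hVs : ContDiff ℝ ∞ V := hU.comp (contDiff_id.sub contDiff_const)
  have hu' : u = V + v := funext huv
  have hd : ∀ k x i, fderiv ℝ (fun x => V x + mollify k v x) x (planeBasis i) =
      fderiv ℝ V x (planeBasis i) + mollify k (g i) x := by
    intro k x i
    have h1 : HasFDerivAt V (fderiv ℝ V x) x := (hVs.differentiable (by simp) x).hasFDerivAt
    have h2 : HasFDerivAt (mollify k v) (fderiv ℝ (mollify k v) x) x :=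
      ((contDiff_mollify k hvl).differentiable (by simp) x).hasFDerivAt
    have h3 := (h1.add h2).fderiv
    rw [show (fun x => V x + mollify k v x) = V + mollify k v from rfl, h3,
      add_apply, (hgw i).fderiv_mollify]
  have hweak : ∀ i, weakPartial i u =ᵐ[volume] fun x => fderiv ℝ V x (planeBasis i) + g i x :=
    fun i => hu' ▸ ((isWeakPartial_of_contDiff i (hVs.of_le (by simp))).add (hgw i)).weakPartial_ae_eq
  have hmoll : ∀ {f : Plane → ℂ} {p : ENNReal}, MemLp f p → 1 ≤ p → p ≠ ⊤ →
      LpTendsto volume p (fun k => mollify k f) f := fun {f p} hf hp1 hp =>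
    ⟨fun k => ⟨(contDiff_mollify k (hf.locallyIntegrable hp1)).continuous.aestronglyMeasurable,
      (eLpNorm_mollify_le k hf.aestronglyMeasurable hp1 hp).trans_lt hf.eLpNorm_lt_top⟩, hf,
      tendsto_eLpNorm_mollify_sub hf hp1 hp⟩
  -- Only the Sobolev part is mollified; the smooth part is kept exactly and needs only local
  -- bounds.
  refine ⟨fun k x => V x + mollify k v x, fun k => hVs.add (contDiff_mollify k hvl),
    fun S R hSm hS => ⟨?_, ?_, fun i => ?_⟩⟩
  · rw [hu']
    exact (LpTendsto.const (memLp_of_continuous_of_subset_ball hVs.continuous hSm hS 4)).add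
      ((hmoll hv4 (by norm_num) (by norm_num)).mono_measure Measure.restrict_le_self) (by norm_num)
  · rw [hu']
    exact (LpTendsto.const (memLp_of_continuous_of_subset_ball hVs.continuous hSm hS 2)).add
      ((hmoll hv2 (by norm_num) (by norm_num)).mono_measure Measure.restrict_le_self) (by norm_num)
  · have hc : Continuous fun x => fderiv ℝ V x (planeBasis i) :=
      (hVs.continuous_fderiv (by simp)).clm_apply continuous_const
    simp_rw [hd]
    exact ((LpTendsto.const (memLp_of_continuous_of_subset_ball hc hSm hS 2)).add
      ((hmoll (hg2 i) (by norm_num) (by norm_num)).mono_measure Measure.restrict_le_self)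
      (by norm_num)).congr_lim (ae_restrict_of_ae (hweak i).symm)

theorem energyDensity_eq_re (ε : ℝ) (u : Plane → ℂ) (x : Plane) : energyDensity ε u x =
    (complexDensity ε (u x) (weakPartial 0 u x) (weakPartial 1 u x)).re := by
  rw [complexDensity_re, energyDensity, Fin.sum_univ_two]

theorem classicalDensity_eq_re (ε : ℝ) (w : Plane → ℂ) (x : Plane) : classicalDensity ε w x =
    (complexDensity ε (w x) (fderiv ℝ w x (planeBasis 0)) (fderiv ℝ w x (planeBasis 1))).re := by
  rw [complexDensity_re, classicalDensity, gradSq, Fin.sum_univ_two]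

/-- Smooth approximation with convergence of energies and currents on bounded sets. -/
theorem exists_smooth_approximation_energy {U u : Plane → ℂ} (hU : ContDiff ℝ ∞ U)
    (hu : MemTranslatesAddH1 U u) : ∃ w : ℕ → Plane → ℂ, (∀ k, ContDiff ℝ ∞ (w k)) ∧
      ∀ (S : Set Plane) (R : ℝ), MeasurableSet S → S ⊆ Metric.ball 0 R →
        (∀ ε, IntegrableOn (energyDensity ε u) S ∧
          Tendsto (fun k => ∫ x in S, classicalDensity ε (w k) x) atTop
            (𝓝 (∫ x in S, energyDensity ε u x))) ∧
        ∀ i, IntegrableOn (current u i) S ∧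
          (∀ k, IntegrableOn (classicalCurrent (w k) i) S) ∧
          Tendsto (fun k => ∫ x in S, |classicalCurrent (w k) i x - current u i x|) atTop (𝓝 0) := by
  obtain ⟨w, hw, hlim⟩ := exists_smooth_approximation hU hu
  refine ⟨w, hw, fun S R hSm hS => ?_⟩
  have : IsFiniteMeasure (volume.restrict S) :=
    ⟨by rw [Measure.restrict_apply_univ]; exact (measure_mono hS).trans_lt measure_ball_lt_top⟩
  obtain ⟨h4, h2, hp⟩ := hlim S R hSm hS
  constructor
  · intro ε
    have hE := h4.complexDensity (hp 0) (hp 1) ε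
    have hi := memLp_one_iff_integrable.1 hE.memLp_lim
    have hik := fun k => memLp_one_iff_integrable.1 (hE.memLp k)
    refine ⟨hi.re.congr (ae_of_all _ fun x => (energyDensity_eq_re ε u x).symm), ?_⟩
    have h1 := (Complex.continuous_re.tendsto _).comp hE.tendsto_integral
    simp_rw [energyDensity_eq_re, classicalDensity_eq_re]
    rw [show ∫ x in S, (complexDensity ε (u x) (weakPartial 0 u x) (weakPartial 1 u x)).re =
      (∫ x in S, complexDensity ε (u x) (weakPartial 0 u x) (weakPartial 1 u x)).re from
        integral_re hi]
    refine h1.congr fun k => ?_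
    exact (integral_re (hik k)).symm
  · intro i
    have hC := (h2.const_mul Complex.I).mul (r := 1) (hp i).conj le_rfl
    have hi := memLp_one_iff_integrable.1 hC.memLp_lim
    have hik := fun k => memLp_one_iff_integrable.1 (hC.memLp k)
    have hic : IntegrableOn (current u i) S := hi.re
    have hikc : ∀ k, IntegrableOn (classicalCurrent (w k) i) S := fun k => (hik k).re
    refine ⟨hic, hikc, ?_⟩
    refine tendsto_of_tendsto_of_tendsto_of_le_of_le tendsto_const_nhds
      hC.tendsto_integral_norm_sub (fun k => integral_nonneg fun x => abs_nonneg _) fun k => ?_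
    refine integral_mono ((hikc k).sub hic).abs ((hik k).sub hi).norm fun x => ?_
    simp only [classicalCurrent, current]
    rw [← Complex.sub_re]
    exact Complex.abs_re_le_norm _

/-! ### Radial test functions and the dual norm. -/

/-- The radial test function `x ↦ ∫_{ln |x|}^b η`. -/
noncomputable def radialTest (η : ℝ → ℝ) (b : ℝ) (x : Plane) : ℝ := ∫ t in (Real.log ‖x‖)..b, η t

section RadialTest

open Real

variable {η : ℝ → ℝ} {a b : ℝ}

/-- On this plateau the value does not depend on the position, so the point masses contribute only
through their total degree. -/
theorem radialTest_of_norm_lt (ha : 0 < a) (hη : Continuous η) (hη0 : ∀ t, t ∉ Ioo a b → η t = 0)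
    {x : Plane} (hx : ‖x‖ < exp a) : radialTest η b x = ∫ t in a..b, η t := by
  have hlog : log ‖x‖ ≤ a := by
    rcases eq_or_lt_of_le (norm_nonneg x) with h | h
    · rw [← h, log_zero]; exact ha.le
    · exact ((log_lt_iff_lt_exp h).2 hx).le
  rw [radialTest, ← intervalIntegral.integral_add_adjacent_intervals
    (hη.intervalIntegrable (log ‖x‖) a) (hη.intervalIntegrable a b)]
  have : ∫ t in (log ‖x‖)..a, η t = ∫ t in (log ‖x‖)..a, (0 : ℝ) := by
    refine intervalIntegral.integral_congr fun t ht => hη0 t fun h => ?_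
    rw [uIcc_of_le hlog] at ht
    exact absurd h.1 (not_lt.2 ht.2)
  rw [this]; simp

theorem radialTest_of_le_norm (hη0 : ∀ t, t ∉ Ioo a b → η t = 0) {x : Plane}
    (hx : exp b ≤ ‖x‖) : radialTest η b x = 0 := by
  have hlog : b ≤ log ‖x‖ := (le_log_iff_exp_le ((exp_pos b).trans_le hx)).2 hx
  have : ∫ t in (log ‖x‖)..b, η t = ∫ t in (log ‖x‖)..b, (0 : ℝ) := by
    refine intervalIntegral.integral_congr fun t ht => hη0 t fun h => ?_
    rw [uIcc_of_ge hlog] at ht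
    exact absurd h.2 (not_lt.2 ht.1)
  rw [radialTest, this]; simp

/-- Away from 0 this is the chain rule with ∇ ln|x| = x/|x|²; near 0 the function is constant. -/
theorem hasFDerivAt_radialTest (ha : 0 < a) (hη : Continuous η)
    (hη0 : ∀ t, t ∉ Ioo a b → η t = 0) (x : Plane) :
    HasFDerivAt (radialTest η b) (-(radialWeight η x) • innerSL ℝ x) x := by
  by_cases hx : x = 0
  · have h1 : radialTest η b =ᶠ[𝓝 x] fun _ => ∫ t in a..b, η t := by
      filter_upwards [Metric.isOpen_ball.mem_nhds
        (hx ▸ Metric.mem_ball_self (exp_pos a) : x ∈ Metric.ball (0 : Plane) (exp a))] with y hy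
      exact radialTest_of_norm_lt ha hη hη0 (mem_ball_zero_iff.1 hy)
    have h2 : -(radialWeight η x) • innerSL ℝ x = (0 : Plane →L[ℝ] ℝ) := by
      rw [hx]; simp
    rw [h2]
    exact (hasFDerivAt_const _ x).congr_of_eventuallyEq h1
  · have hx2 : ‖x‖ ^ 2 ≠ 0 := pow_ne_zero 2 (norm_ne_zero_iff.2 hx)
    have h1 : HasFDerivAt (fun y : Plane => ‖y‖ ^ 2) (2 • innerSL ℝ x) x :=
      (hasStrictFDerivAt_norm_sq x).hasFDerivAt
    have h2 := (h1.log hx2).const_mul (1 / 2 : ℝ)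
    have h3 : (fun y : Plane => 1 / 2 * log (‖y‖ ^ 2)) = fun y => log ‖y‖ := by
      ext y; rw [log_pow]; push_cast; ring
    rw [h3] at h2
    have h4 : HasDerivAt (fun s => ∫ t in s..b, η t) (-η (log ‖x‖)) (log ‖x‖) :=
      intervalIntegral.integral_hasDerivAt_left (hη.intervalIntegrable _ _)
        hη.stronglyMeasurable.stronglyMeasurableAtFilter hη.continuousAt
    have h5 := h4.comp_hasFDerivAt x h2
    refine h5.congr_fderiv ?_
    ext v
    simp [radialWeight]
    field_simp

theorem fderiv_radialTest (ha : 0 < a) (hη : Continuous η) (hη0 : ∀ t, t ∉ Ioo a b → η t = 0)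
    (x : Plane) (i : Fin 2) :
    fderiv ℝ (radialTest η b) x (planeBasis i) = -(radialWeight η x * x i) := by
  rw [(hasFDerivAt_radialTest ha hη hη0 x).fderiv]
  simp [planeBasis, EuclideanSpace.inner_single_right]

theorem contDiff_radialTest (ha : 0 < a) (hη : Continuous η) (hη0 : ∀ t, t ∉ Ioo a b → η t = 0) :
    ContDiff ℝ 1 (radialTest η b) := by
  rw [contDiff_one_iff_fderiv]
  refine ⟨fun x => (hasFDerivAt_radialTest ha hη hη0 x).differentiableAt, ?_⟩
  have : fderiv ℝ (radialTest η b) = fun x => -(radialWeight η x) • innerSL ℝ x :=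
    funext fun x => (hasFDerivAt_radialTest ha hη hη0 x).fderiv
  rw [this]
  exact (continuous_radialWeight ha hη hη0).neg.smul (innerSL ℝ).continuous

theorem hasCompactSupport_radialTest (hη0 : ∀ t, t ∉ Ioo a b → η t = 0) :
    HasCompactSupport (radialTest η b) :=
  HasCompactSupport.intro (isCompact_closedBall (0 : Plane) (exp b)) fun x hx =>
    radialTest_of_le_norm hη0 (by
      rw [mem_closedBall_zero_iff, not_le] at hx; exact hx.le)

/-- The gradient of the test function is at most 1/|x|, and 1 + ln|x| ≤ |x| on its support absorbs
the logarithmic weight of the norm. -/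
theorem abs_radialWeight_mul_le (ha : 0 < a) (hη1 : ∀ t, |η t| ≤ 1)
    (hη0 : ∀ t, t ∉ Ioo a b → η t = 0) (x : Plane) :
    |radialWeight η x| * ‖x‖ * (1 + posLog ‖x‖) ≤ 1 := by
  by_cases hx : x ∈ Metric.ball (0 : Plane) (exp b) \ Metric.ball 0 (exp a)
  · have hxa : exp a ≤ ‖x‖ := by simpa using hx.2
    have hx1 : 1 < ‖x‖ := (one_lt_exp_iff.2 ha).trans_le hxa
    have hx0 : 0 < ‖x‖ := by linarith
    rw [posLog_eq_log (by rw [abs_of_pos hx0]; exact hx1.le), radialWeight, abs_div,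
      abs_of_pos (pow_pos hx0 2)]
    have h1 := log_le_sub_one_of_pos hx0
    have h2 : 0 ≤ log ‖x‖ := log_nonneg hx1.le
    have h3 := hη1 (log ‖x‖)
    rw [div_mul_eq_mul_div, div_mul_eq_mul_div, div_le_one (pow_pos hx0 2)]
    calc |η (log ‖x‖)| * ‖x‖ * (1 + log ‖x‖) ≤ 1 * ‖x‖ * ‖x‖ := by
          gcongr; linarith
      _ = ‖x‖ ^ 2 := by ring
  · rw [radialWeight_eq_zero ha hη0 hx]; simp

theorem xlnNorm_radialTest_le (ha : 0 < a) (hη : Continuous η) (hη1 : ∀ t, |η t| ≤ 1)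
    (hη0 : ∀ t, t ∉ Ioo a b → η t = 0) : XlnNorm (radialTest η b) ≤ 1 := by
  refine essSup_le_of_ae_le _ (ae_of_all _ fun x => ?_)
  show ENNReal.ofReal _ ≤ 1
  rw [← ENNReal.ofReal_one]
  refine ENNReal.ofReal_le_ofReal ?_
  rw [(hasFDerivAt_radialTest ha hη hη0 x).fderiv, norm_smul, innerSL_apply_norm, norm_neg,
    Real.norm_eq_abs, mul_comm]
  exact abs_radialWeight_mul_le ha hη1 hη0 x

/-- The gradient of a radial function is parallel to x, so the Jacobian pairing sees only the
angular current; the factor 2 removes the ½ in J. -/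
theorem vorticityDefect_radialTest (ha : 0 < a) (hη : Continuous η)
    (hη0 : ∀ t, t ∉ Ioo a b → η t = 0) {n : ℕ} (u : Plane → ℂ) (d : Fin n → ℤ)
    {α : Fin n → Plane} (hα : ∀ i, ‖α i‖ < exp a) :
    2 * vorticityDefect u d α (radialTest η b) =
      (∫ x, radialWeight η x * swirl x (u x) (weakPartial 0 u x) (weakPartial 1 u x))
        - 2 * π * (∑ i, d i : ℤ) * ∫ t in a..b, η t := by
  have h1 : ∀ i, radialTest η b (α i) = ∫ t in a..b, η t := fun i =>
    radialTest_of_norm_lt ha hη hη0 (hα i)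
  have h2 : ∫ x, (fderiv ℝ (radialTest η b) x (planeBasis 1) * current u 0 x
      - fderiv ℝ (radialTest η b) x (planeBasis 0) * current u 1 x) =
      ∫ x, radialWeight η x * swirl x (u x) (weakPartial 0 u x) (weakPartial 1 u x) := by
    congr 1; ext x
    rw [fderiv_radialTest ha hη hη0, fderiv_radialTest ha hη hη0]
    unfold swirl current
    ring
  rw [vorticityDefect, jacobianPairing, h2]
  simp_rw [h1]
  rw [← Finset.sum_mul]
  push_cast
  ring

theorem pairing_le_of_xlnDualNorm_le (ha : 0 < a) (hη : Continuous η) (hη1 : ∀ t, |η t| ≤ 1)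
    (hη0 : ∀ t, t ∉ Ioo a b → η t = 0) {n : ℕ} {u : Plane → ℂ} {d : Fin n → ℤ}
    {α : Fin n → Plane} (hα : ∀ i, ‖α i‖ < exp a) {s : ℝ}
    (hs : XlnDualNorm (vorticityDefect u d α) ≤ (s : EReal)) :
    (∫ x, radialWeight η x * swirl x (u x) (weakPartial 0 u x) (weakPartial 1 u x))
        - 2 * π * (∑ i, d i : ℤ) * (∫ t in a..b, η t) ≤ 2 * s := by
  rw [← vorticityDefect_radialTest ha hη hη0 u d hα]
  have hmem : radialTest η b ∈
      {φ : Plane → ℝ | ContDiff ℝ 1 φ ∧ HasCompactSupport φ ∧ XlnNorm φ ≤ 1} :=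
    ⟨contDiff_radialTest ha hη hη0, hasCompactSupport_radialTest hη0,
      xlnNorm_radialTest_le ha hη hη1 hη0⟩
  have h1 : ((vorticityDefect u d α (radialTest η b) : ℝ) : EReal) ≤ (s : EReal) :=
    (le_iSup₂ (f := fun φ (_ : φ ∈ {φ : Plane → ℝ | ContDiff ℝ 1 φ ∧ HasCompactSupport φ ∧
      XlnNorm φ ≤ 1}) => ((vorticityDefect u d α φ : ℝ) : EReal)) _ hmem).trans hs
  have := EReal.coe_le_coe_iff.1 h1
  linarith

end RadialTest

/-! ### The annulus bound for maps in [U] + H¹. -/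

section AnnulusBound

open Real

/-- Lower bound for the energy of a map in `[U] + H¹` on an annulus around its vortices. -/
theorem annulus_lower_bound {U u : Plane → ℂ} (hU : ContDiff ℝ ∞ U) (hu : MemTranslatesAddH1 U u)
    {n : ℕ} {d : Fin n → ℤ} {α : Fin n → Plane} {s ε a b : ℝ}
    (hs : XlnDualNorm (vorticityDefect u d α) ≤ (s : EReal)) {D : ℤ} (hdD : ∑ i, d i = D)
    (hD : 1 ≤ D) (hε : 0 < ε) (hsD : s * (D : ℝ) ^ 2 ≤ 1 / 1000)
    (hεD : ε * (D : ℝ) ^ 2 ≤ 1 / 1000) (ha : 1 < a) (hab : a + log 2 ≤ b)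
    (hα : ∀ i, ‖α i‖ < exp (a - 1)) :
    π * (D : ℝ) ^ 2 * (b - a) - π * (D : ℝ) ^ 4 * ε ^ 2 * exp (-2 * a) ≤
      ∫ x in Metric.ball (0 : Plane) (exp b) \ Metric.ball 0 (exp a), energyDensity ε u x := by
  obtain ⟨w, hw, hlim⟩ := exists_smooth_approximation_energy hU hu
  have hD' : (1 : ℝ) ≤ D := by exact_mod_cast hD
  have hD2 : 0 < (D : ℝ) ^ 2 := by positivity
  set B := Metric.ball (0 : Plane) (exp (b + 1)) with hB
  obtain ⟨-, hcur⟩ := hlim B (exp (b + 1)) Metric.isOpen_ball.measurableSet Subset.rfl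
  obtain ⟨hen, -⟩ := hlim (Metric.ball (0 : Plane) (exp b) \ Metric.ball 0 (exp a)) (exp b)
    (Metric.isOpen_ball.measurableSet.diff Metric.isOpen_ball.measurableSet) sdiff_subset
  have hsum := (hcur 0).2.2.add (hcur 1).2.2
  rw [add_zero] at hsum
  -- From here on k is large enough that both current components are close in L¹ on B; multiplying
  -- by coefficients bounded by 1 preserves this.
  have hev := hsum.eventually (ge_mem_nhds (show (0 : ℝ) < 1 / (1000 * (D : ℝ) ^ 2) by positivity))
  refine ge_of_tendsto (hen ε).2 ?_
  filter_upwards [hev] with k hk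
  refine smooth_annulus_lower_bound (hw k) hε hD ha hab hεD fun η hη hη1 hη0 => ?_
  have ha' : 0 < a - 1 := by linarith
  have hpair := pairing_le_of_xlnDualNorm_le ha' hη hη1 hη0 hα hs
  rw [hdD] at hpair
  have hzero : ∀ x, x ∉ B → radialWeight η x = 0 := fun x hx =>
    radialWeight_eq_zero ha' hη0 fun h => hx h.1
  have hcw := continuous_radialWeight ha' hη hη0
  have hxi : ∀ (x : Plane) (i : Fin 2), |radialWeight η x * x i| ≤ 1 := by
    intro x i
    have h1 := abs_radialWeight_mul_le ha' hη1 hη0 x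
    have h2 : |x i| ≤ ‖x‖ := by simpa using PiLp.norm_apply_le x i
    have h3 : 0 ≤ posLog ‖x‖ := posLog_nonneg
    rw [abs_mul]
    calc |radialWeight η x| * |x i| ≤ |radialWeight η x| * ‖x‖ := by gcongr
      _ ≤ |radialWeight η x| * ‖x‖ * (1 + posLog ‖x‖) :=
        le_mul_of_one_le_right (by positivity) (by linarith)
      _ ≤ 1 := h1
  have hcoord : ∀ i : Fin 2, Continuous fun x : Plane => radialWeight η x * x i := fun i =>
    hcw.fun_mul (by fun_prop)
  have hint : ∀ {j : Fin 2 → Plane → ℝ}, (∀ i, IntegrableOn (j i) B) →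
      ∀ i l, IntegrableOn (fun x => radialWeight η x * x i * j l x) B := fun hj i l =>
    (hj l).bdd_mul (hcoord i).aestronglyMeasurable (ae_of_all _ fun x => hxi x i)
  have hform : ∀ {j : Fin 2 → Plane → ℝ}, (∀ i, IntegrableOn (j i) B) →
      ∫ x, radialWeight η x * (x 0 * j 1 x - x 1 * j 0 x) =
      (∫ x in B, radialWeight η x * x 0 * j 1 x) - ∫ x in B, radialWeight η x * x 1 * j 0 x := by
    intro j hj
    rw [← integral_sub (hint hj 0 1) (hint hj 1 0),
      ← setIntegral_eq_integral_of_forall_compl_eq_zero (s := B)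
        (fun x hx => by rw [hzero x hx, zero_mul])]
    congr 1; ext x; ring
  have hdiff : ∀ i l, |(∫ x in B, radialWeight η x * x i * classicalCurrent (w k) l x) -
      ∫ x in B, radialWeight η x * x i * current u l x| ≤
      ∫ x in B, |classicalCurrent (w k) l x - current u l x| := by
    intro i l
    rw [← integral_sub (hint (fun l => (hcur l).2.1 k) i l) (hint (fun l => (hcur l).1) i l),
      ← Real.norm_eq_abs]
    refine norm_integral_le_of_norm_le (((hcur l).2.1 k).sub (hcur l).1).abs
      (ae_of_all _ fun x => ?_)
    rw [← mul_sub, norm_mul, Real.norm_eq_abs, Real.norm_eq_abs]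
    exact mul_le_of_le_one_left (abs_nonneg _) (hxi x i)
  have e1 := hform (fun i => (hcur i).1)
  have e2 := hform (fun i => (hcur i).2.1 k)
  have f1 := (abs_le.1 (hdiff 0 1)).2
  have f2 := (abs_le.1 (hdiff 1 0)).1
  have g1 : ∫ x, radialWeight η x * swirl x (u x) (weakPartial 0 u x) (weakPartial 1 u x) =
    (∫ x in B, radialWeight η x * x 0 * current u 1 x) -
      ∫ x in B, radialWeight η x * x 1 * current u 0 x := e1
  have g2 : ∫ x, radialWeight η x * swirl x (w k x) (fderiv ℝ (w k) x (planeBasis 0))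
      (fderiv ℝ (w k) x (planeBasis 1)) =
    (∫ x in B, radialWeight η x * x 0 * classicalCurrent (w k) 1 x) -
      ∫ x in B, radialWeight η x * x 1 * classicalCurrent (w k) 0 x := e2
  rw [g1] at hpair
  rw [g2]
  have hs2 : s ≤ 1 / (1000 * (D : ℝ) ^ 2) := by
    rw [← div_div, le_div_iff₀ hD2]; exact hsD
  -- The budget: 2s from the hypothesis and 1/(1000D²) from the approximation fit into the allowed
  -- 1/(100D²).
  have hfin : 2 * (1 / (1000 * (D : ℝ) ^ 2)) + 1 / (1000 * (D : ℝ) ^ 2) ≤ 1 / (100 * (D : ℝ) ^ 2) := by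
    rw [← div_div, ← div_div, ← mul_div_assoc, ← add_div]
    gcongr; norm_num
  linarith

end AnnulusBound

/-! ### The reference map at infinity. -/

section Homogeneity

theorem norm_angularPhase (D : ℤ) {x : Plane} (hx : x ≠ 0) : ‖angularPhase D x‖ = 1 := by
  have h1 : ‖planeToComplex x‖ = ‖x‖ := by
    rw [← sq_eq_sq₀ (norm_nonneg _) (norm_nonneg _), plane_norm_sq, ← Complex.normSq_eq_norm_sq,
      Complex.normSq_apply, planeToComplex]
    ring
  have h2 : ‖x‖ ≠ 0 := norm_ne_zero_iff.2 hx
  rw [angularPhase, norm_zpow, norm_div, h1, Complex.norm_real, norm_norm, div_self h2, one_zpow]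

theorem angularPhase_smul (D : ℤ) {c : ℝ} (hc : 0 < c) (x : Plane) :
    angularPhase D (c • x) = angularPhase D x := by
  have h1 : planeToComplex (c • x) = c * planeToComplex x := by
    apply Complex.ext <;> simp [planeToComplex]
  rw [angularPhase, angularPhase, h1, norm_smul, Real.norm_of_nonneg hc.le, Complex.ofReal_mul,
    mul_div_mul_left _ _ (Complex.ofReal_ne_zero.2 hc.ne')]

theorem contDiffAt_angularPhase {D : ℤ} (hD : 0 < D) {x : Plane} (hx : x ≠ 0) :
    ContDiffAt ℝ ∞ (angularPhase D) x := by
  lift D to ℕ using hD.le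
  have h1 : (angularPhase (D : ℤ)) = fun x => (planeToComplex x / (‖x‖ : ℂ)) ^ D := by
    ext x; rw [angularPhase, zpow_natCast]
  have h2 : planeToComplex = fun x : Plane => (x 0 : ℂ) + (x 1 : ℂ) * Complex.I := by
    ext x; apply Complex.ext <;> simp [planeToComplex]
  have hcoord : ∀ i : Fin 2, ContDiffAt ℝ ∞ (fun x : Plane => ((x i : ℝ) : ℂ)) x := fun i =>
    (Complex.ofRealCLM.comp (EuclideanSpace.proj i)).contDiff.contDiffAt
  rw [h1]
  refine ContDiffAt.pow ?_ D
  have h3 : ContDiffAt ℝ ∞ planeToComplex x := by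
    rw [h2]
    exact (hcoord 0).add ((hcoord 1).mul contDiffAt_const)
  have h4 : ContDiffAt ℝ ∞ (fun x : Plane => (‖x‖ : ℂ)) x :=
    Complex.ofRealCLM.contDiff.contDiffAt.comp x (contDiffAt_norm ℝ hx)
  simp_rw [div_eq_mul_inv]
  exact h3.mul (h4.inv (Complex.ofReal_ne_zero.2 (norm_ne_zero_iff.2 hx)))

/-- A continuous function that is homogeneous of degree `-m` is bounded by `C / |x| ^ m`. -/
theorem exists_norm_le_div_of_homogeneous {F : Type*} [NormedAddCommGroup F] [NormedSpace ℝ F]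
    {G : Plane → F} {m : ℕ} (hG : ∀ x ≠ 0, ContinuousAt G x)
    (hhom : ∀ c : ℝ, 0 < c → ∀ x, c ^ m • G (c • x) = G x) :
    ∃ C, ∀ x ≠ 0, ‖G x‖ ≤ C / ‖x‖ ^ m := by
  obtain ⟨C, hC⟩ := (isCompact_sphere (0 : Plane) 1).exists_bound_of_continuousOn (f := G)
    fun x hx => (hG x (by rintro rfl; simp at hx)).continuousWithinAt
  refine ⟨C, fun x hx => ?_⟩
  have hx0 : 0 < ‖x‖ := norm_pos_iff.2 hx
  have h1 := hhom (‖x‖)⁻¹ (inv_pos.2 hx0) x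
  have h2 := hC (‖x‖⁻¹ • x) (by
    rw [mem_sphere_zero_iff_norm, norm_smul, norm_inv, norm_norm, inv_mul_cancel₀ hx0.ne'])
  rw [← h1, norm_smul, norm_pow, norm_inv, norm_norm, inv_pow, div_eq_inv_mul]
  gcongr

/-- Each derivative lowers the degree of homogeneity by one. From e^{iDθ}, of degree 0, this yields
decay |x|⁻¹ of the gradient and |x|⁻² of the Hessian. -/
theorem fderiv_homogeneous {F : Type*} [NormedAddCommGroup F] [NormedSpace ℝ F]
    {G : Plane → F} {m : ℕ} (hhom : ∀ c : ℝ, 0 < c → ∀ x, c ^ m • G (c • x) = G x) :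
    ∀ c : ℝ, 0 < c → ∀ x, c ^ (m + 1) • fderiv ℝ G (c • x) = fderiv ℝ G x := by
  intro c hc x
  have h1 : G = fun x => c ^ m • G (c • x) := funext fun x => (hhom c hc x).symm
  conv_rhs => rw [h1]
  have h2 : fderiv ℝ (fun x => c ^ m • G (c • x)) x
      = c ^ m • fderiv ℝ (fun x => G (c • x)) x := by
    -- An invertible scalar leaves `fderiv` without any differentiability assumption, so points such
    -- as the origin need no separate treatment.
    let _ := invertibleOfNonzero (pow_ne_zero m hc.ne')
    exact fderiv_const_smul_of_invertible (c ^ m)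
  rw [h2, fderiv_comp_smul, smul_smul, pow_succ]

theorem fderiv_angularPhase_self {D : ℤ} (hD : 0 < D) {x : Plane} (hx : x ≠ 0) :
    fderiv ℝ (angularPhase D) x x = 0 := by
  have h1 : HasFDerivAt (angularPhase D) (fderiv ℝ (angularPhase D) x) ((1 : ℝ) • x) := by
    rw [one_smul]
    exact ((contDiffAt_angularPhase hD hx).differentiableAt (by simp)).hasFDerivAt
  have h2 : HasDerivAt (fun t : ℝ => t • x) x 1 := by
    simpa using (hasDerivAt_id (1 : ℝ)).smul_const x
  have h3 := h1.comp_hasDerivAt (1 : ℝ) h2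
  have h4 : HasDerivAt (angularPhase D ∘ fun t : ℝ => t • x) 0 1 := by
    refine (hasDerivAt_const (1 : ℝ) (angularPhase D x)).congr_of_eventuallyEq ?_
    filter_upwards [lt_mem_nhds (zero_lt_one (α := ℝ))] with t ht
    exact angularPhase_smul D ht x
  exact h3.unique h4

end Homogeneity

/-- Behaviour at infinity of the reference map. -/
theorem IsReferenceMap.asymptotics {D : ℤ} {U : Plane → ℂ} (hU : IsReferenceMap D U) (hD : 0 < D) :
    ∃ r C : ℝ, 1 ≤ r ∧ 0 ≤ C ∧ ∀ x : Plane, r ≤ ‖x‖ → ‖U x‖ = 1 ∧ fderiv ℝ U x x = 0 ∧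
      ‖fderiv ℝ U x‖ ≤ C / ‖x‖ ∧ ‖fderiv ℝ (fderiv ℝ U) x‖ ≤ C / ‖x‖ ^ 2 := by
  obtain ⟨K, hK, hUK⟩ := hU.eq_phase
  obtain ⟨r₀, hr₀⟩ := hK.isBounded.subset_ball (0 : Plane)
  have h0 : ∀ c : ℝ, 0 < c → ∀ x, c ^ 0 • angularPhase D (c • x) = angularPhase D x :=
    fun c hc x => by rw [pow_zero, one_smul, angularPhase_smul D hc]
  have h1 := fderiv_homogeneous h0
  have h2 := fderiv_homogeneous (G := fderiv ℝ (angularPhase D)) (m := 0 + 1)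
    fun c hc x => h1 c hc x
  have hc1 : ∀ x : Plane, x ≠ 0 → ContDiffAt ℝ ∞ (fderiv ℝ (angularPhase D)) x := fun x hx =>
    (contDiffAt_angularPhase hD hx).fderiv_right (by simp)
  have hc2 : ∀ x : Plane, x ≠ 0 → ContDiffAt ℝ ∞ (fderiv ℝ (fderiv ℝ (angularPhase D))) x :=
    fun x hx => (hc1 x hx).fderiv_right (by simp)
  obtain ⟨C₁, hC₁⟩ := exists_norm_le_div_of_homogeneous (fun x hx => (hc1 x hx).continuousAt) h1
  obtain ⟨C₂, hC₂⟩ := exists_norm_le_div_of_homogeneous (fun x hx => (hc2 x hx).continuousAt) h2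
  refine ⟨max r₀ 1, max (max C₁ C₂) 0, le_max_right _ _, le_max_right _ _, fun x hx => ?_⟩
  have hx1 : 1 ≤ ‖x‖ := (le_max_right _ _).trans hx
  have hx0 : x ≠ 0 := norm_pos_iff.1 (by linarith)
  have hxK : x ∉ K := fun h => by
    have := mem_ball_zero_iff.1 (hr₀ h)
    exact absurd ((le_max_left _ _).trans hx) (not_le.2 this)
  have hev : U =ᶠ[𝓝 x] angularPhase D := by
    filter_upwards [hK.isClosed.isOpen_compl.mem_nhds hxK] with z hz using hUK z hz
  refine ⟨?_, ?_, ?_, ?_⟩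
  · rw [hUK x hxK, norm_angularPhase D hx0]
  · rw [hev.fderiv_eq]; exact fderiv_angularPhase_self hD hx0
  · rw [hev.fderiv_eq]
    refine (hC₁ x hx0).trans ?_
    rw [zero_add, pow_one]
    gcongr
    exact (le_max_left _ _).trans (le_max_left _ _)
  · rw [hev.fderiv.fderiv_eq]
    refine (hC₂ x hx0).trans ?_
    gcongr
    exact (le_max_right _ _).trans (le_max_left _ _)

section Decay

theorem exists_norm_le_rpow_of_decay {F : Type*} [NormedAddCommGroup F] {h : Plane → F}
    (hc : Continuous h) {m : ℕ} {C r : ℝ} (hr : 1 ≤ r)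
    (hd : ∀ x, r ≤ ‖x‖ → ‖h x‖ ≤ C / ‖x‖ ^ m) :
    ∃ C', 0 ≤ C' ∧ ∀ x, ‖h x‖ ≤ C' * (1 + ‖x‖) ^ (-(m : ℝ)) := by
  obtain ⟨C₀, hC₀⟩ := (isCompact_closedBall (0 : Plane) r).exists_bound_of_continuousOn
    hc.continuousOn
  refine ⟨max |C₀| |C| * (1 + r) ^ m * 2 ^ m, by positivity, fun x => ?_⟩
  have hx0 := norm_nonneg x
  rw [Real.rpow_neg (by positivity), Real.rpow_natCast, ← div_eq_mul_inv,
    le_div_iff₀ (by positivity)]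
  rcases le_total r ‖x‖ with hx | hx
  · have hxp : 0 < ‖x‖ := by linarith
    have h1 : ‖h x‖ ≤ |C| / ‖x‖ ^ m := (hd x hx).trans (by gcongr; exact le_abs_self C)
    have h2 : (1 + ‖x‖) ^ m ≤ (2 * ‖x‖) ^ m := by gcongr; linarith
    have h3 : (1 : ℝ) ≤ (1 + r) ^ m := one_le_pow₀ (by linarith)
    calc ‖h x‖ * (1 + ‖x‖) ^ m ≤ |C| / ‖x‖ ^ m * (2 * ‖x‖) ^ m := by gcongr
      _ = |C| * 1 * 2 ^ m := by rw [mul_pow]; field_simp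
      _ ≤ max |C₀| |C| * (1 + r) ^ m * 2 ^ m := by gcongr; exact le_max_right _ _
  · have h1 : ‖h x‖ ≤ |C₀| := (hC₀ x (mem_closedBall_zero_iff.2 hx)).trans (le_abs_self _)
    have h3 : (1 : ℝ) ≤ 2 ^ m := one_le_pow₀ (by norm_num)
    calc ‖h x‖ * (1 + ‖x‖) ^ m ≤ |C₀| * (1 + r) ^ m * 1 := by
          rw [mul_one]; gcongr
      _ ≤ max |C₀| |C| * (1 + r) ^ m * 2 ^ m := by gcongr; exact le_max_left _ _

/-- In the plane (1 + |x|)^{-m} is integrable as soon as m exceeds the dimension 2. -/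
theorem integrable_of_decay {F : Type*} [NormedAddCommGroup F] {h : Plane → F}
    (hc : Continuous h) {m : ℕ} (hm : 3 ≤ m) {C r : ℝ} (hr : 1 ≤ r)
    (hd : ∀ x, r ≤ ‖x‖ → ‖h x‖ ≤ C / ‖x‖ ^ m) : Integrable h := by
  obtain ⟨C', -, hC'⟩ := exists_norm_le_rpow_of_decay hc hr hd
  refine ((integrable_one_add_norm (E := Plane) (r := m) ?_).const_mul C').mono'
    hc.aestronglyMeasurable (ae_of_all _ hC')
  rw [finrank_euclideanSpace_fin]
  exact_mod_cast hm

theorem memLp_two_of_decay {F : Type*} [NormedAddCommGroup F] {h : Plane → F} (hc : Continuous h) {C r : ℝ} (hr : 1 ≤ r)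
    (hd : ∀ x, r ≤ ‖x‖ → ‖h x‖ ≤ C / ‖x‖ ^ 2) : MemLp h 2 := by
  rw [memLp_two_iff_integrable_sq_norm hc.aestronglyMeasurable]
  refine integrable_of_decay (hc.norm.pow 2) (m := 4) (by norm_num) (C := C ^ 2) hr fun x hx => ?_
  have h1 := hd x hx
  rw [norm_pow, norm_norm, show ‖x‖ ^ 4 = (‖x‖ ^ 2) ^ 2 by ring, ← div_pow]
  gcongr

end Decay

/-! ### Integration by parts on balls without boundary terms. -/

theorem MeasureTheory.MemLp.integrable_inner_two {μ : Measure Plane} {f g : Plane → ℂ}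
    (hf : MemLp f 2 μ) (hg : MemLp g 2 μ) : Integrable (fun x => inner ℝ (f x) (g x)) μ :=
  (hf.norm.integrable_mul hg.norm).mono' (hf.1.inner hg.1)
    (ae_of_all _ fun _ => norm_inner_le_norm _ _)

/-- Integration by parts of a Sobolev function against a complex test function. -/
theorem IsWeakPartial.integral_inner {i : Fin 2} {v g : Plane → ℂ} (h : IsWeakPartial i v g)
    {q : Plane → ℂ} (hq : ContDiff ℝ ∞ q) (hqc : HasCompactSupport q) :
    ∫ x, inner ℝ (fderiv ℝ q x (planeBasis i)) (v x) = -∫ x, inner ℝ (q x) (g x) := by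
  have hd : ∀ x, DifferentiableAt ℝ q x := fun x => hq.differentiable (by simp) x
  have hre : ContDiff ℝ ∞ fun x => (q x).re := Complex.reCLM.contDiff.comp hq
  have him : ContDiff ℝ ∞ fun x => (q x).im := Complex.imCLM.contDiff.comp hq
  have hrec : HasCompactSupport fun x => (q x).re := hqc.comp_left (g := Complex.re) rfl
  have himc : HasCompactSupport fun x => (q x).im := hqc.comp_left (g := Complex.im) rfl
  have hdre : ∀ x, fderiv ℝ (fun x => (q x).re) x (planeBasis i)
      = (fderiv ℝ q x (planeBasis i)).re := fun x => by
    have := (Complex.reCLM.hasFDerivAt.comp x (hd x).hasFDerivAt).fderiv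
    exact congrArg (fun L => L (planeBasis i)) this
  have hdim : ∀ x, fderiv ℝ (fun x => (q x).im) x (planeBasis i)
      = (fderiv ℝ q x (planeBasis i)).im := fun x => by
    have := (Complex.imCLM.hasFDerivAt.comp x (hd x).hasFDerivAt).fderiv
    exact congrArg (fun L => L (planeBasis i)) this
  have key : ∀ (p : Plane → ℂ) (f : Plane → ℂ),
      Integrable (fun x => (p x).re • f x) → Integrable (fun x => (p x).im • f x) →
      ∫ x, inner ℝ (p x) (f x) = (∫ x, (p x).re • f x).re + (∫ x, (p x).im • f x).im := by
    intro p f h1 h2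
    have e1 : (∫ x, (p x).re • f x).re = ∫ x, ((p x).re • f x).re :=
      (Complex.reCLM.integral_comp_comm h1).symm
    have e2 : (∫ x, (p x).im • f x).im = ∫ x, ((p x).im • f x).im :=
      (Complex.imCLM.integral_comp_comm h2).symm
    have h1' : Integrable fun x => ((p x).re • f x).re := h1.re
    have h2' : Integrable fun x => ((p x).im • f x).im := h2.im
    rw [e1, e2, ← integral_add h1' h2']
    refine integral_congr_ae (ae_of_all _ fun x => ?_)
    simp [mul_comm]
  have hcd : Continuous fun x => fderiv ℝ q x (planeBasis i) :=
    (hq.continuous_fderiv (by simp)).clm_apply continuous_const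
  have hcs : HasCompactSupport fun x => fderiv ℝ q x (planeBasis i) :=
    (hqc.fderiv (𝕜 := ℝ)).comp_left (g := fun L : Plane →L[ℝ] ℂ => L (planeBasis i)) rfl
  rw [key _ _
      (h.1.integrable_smul_left_of_hasCompactSupport (Complex.continuous_re.comp hcd)
        (hcs.comp_left (g := Complex.re) rfl))
      (h.1.integrable_smul_left_of_hasCompactSupport (Complex.continuous_im.comp hcd)
        (hcs.comp_left (g := Complex.im) rfl)),
    key _ _ (h.2.1.integrable_smul_left_of_hasCompactSupport hre.continuous hrec)
      (h.2.1.integrable_smul_left_of_hasCompactSupport him.continuous himc)]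
  have h1 := h.2.2 _ hre hrec
  have h2 := h.2.2 _ him himc
  simp_rw [hdre] at h1
  simp_rw [hdim] at h2
  rw [h1, h2, Complex.neg_re, Complex.neg_im]
  ring

section RadialCutoff

/-- Smooth radial functions increasing to the indicator of a ball. -/
noncomputable def radialCutoff (R : ℝ) (k : ℕ) (x : Plane) : ℝ :=
  Real.smoothTransition (k * (R ^ 2 - ‖x‖ ^ 2))

theorem contDiff_radialCutoff (R : ℝ) (k : ℕ) : ContDiff ℝ ∞ (radialCutoff R k) :=
  Real.smoothTransition.contDiff.comp
    (contDiff_const.mul (contDiff_const.sub (contDiff_norm_sq ℝ)))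

theorem radialCutoff_eq_zero {R : ℝ} (hR : 0 ≤ R) (k : ℕ) {x : Plane} (hx : R ≤ ‖x‖) :
    radialCutoff R k x = 0 :=
  Real.smoothTransition.zero_of_nonpos
    (mul_nonpos_of_nonneg_of_nonpos (Nat.cast_nonneg k) (sub_nonpos.2 (by gcongr)))

theorem hasCompactSupport_radialCutoff {R : ℝ} (hR : 0 ≤ R) (k : ℕ) :
    HasCompactSupport (radialCutoff R k) :=
  HasCompactSupport.intro (isCompact_closedBall 0 R) fun x hx =>
    radialCutoff_eq_zero hR k (by
      rw [mem_closedBall_zero_iff, not_le] at hx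
      exact hx.le)

theorem eventually_one_lt_mul_sq_sub {r R : ℝ} (hr : 0 ≤ r) (hrR : r < R) :
    ∀ᶠ k : ℕ in atTop, 1 < (k : ℝ) * (R ^ 2 - r ^ 2) := by
  have h1 : 0 < R ^ 2 - r ^ 2 := by nlinarith
  exact (tendsto_natCast_atTop_atTop.atTop_mul_const h1).eventually_gt_atTop 1

/-- The gradient is a multiple of x; paired with ∇U it sees only the radial derivative of U. -/
theorem fderiv_radialCutoff (R : ℝ) (k : ℕ) (x z : Plane) :
    fderiv ℝ (radialCutoff R k) x z =
      deriv Real.smoothTransition (k * (R ^ 2 - ‖x‖ ^ 2)) * (k * -(2 * inner ℝ x z)) := by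
  have h1 : HasFDerivAt (fun x : Plane => (k : ℝ) * (R ^ 2 - ‖x‖ ^ 2))
      ((k : ℝ) • -((2 : ℕ) • (innerSL ℝ x : Plane →L[ℝ] ℝ))) x :=
    ((hasStrictFDerivAt_norm_sq x).hasFDerivAt.const_sub (R ^ 2)).const_mul (k : ℝ)
  have h2 := (((Real.smoothTransition.contDiff (n := 1)).differentiable (by simp)
    (k * (R ^ 2 - ‖x‖ ^ 2))).hasDerivAt.comp_hasFDerivAt x h1).fderiv
  have h3 : radialCutoff R k = Real.smoothTransition ∘ fun x => k * (R ^ 2 - ‖x‖ ^ 2) := rfl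
  rw [h3, h2]
  simp

theorem deriv_smoothTransition_of_one_lt {t : ℝ} (ht : 1 < t) :
    deriv Real.smoothTransition t = 0 := by
  have h1 : Real.smoothTransition =ᶠ[𝓝 t] fun _ => 1 := by
    filter_upwards [lt_mem_nhds ht] with s hs using Real.smoothTransition.one_of_one_le (le_of_lt hs)
  rw [h1.deriv_eq, deriv_const]

/-- Dominated convergence. The cutoffs vanish outside the open ball, so integrability of H there
suffices. -/
theorem tendsto_integral_radialCutoff_mul {R : ℝ} (hR : 0 ≤ R) {H : Plane → ℝ}
    (hH : IntegrableOn H (Metric.ball 0 R)) (hm : AEStronglyMeasurable H) :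
    Tendsto (fun k => ∫ x, radialCutoff R k x * H x) atTop (𝓝 (∫ x in Metric.ball 0 R, H x)) := by
  rw [← integral_indicator measurableSet_ball]
  refine tendsto_integral_of_dominated_convergence (fun x => ‖(Metric.ball 0 R).indicator H x‖)
    (fun k => (contDiff_radialCutoff R k).continuous.aestronglyMeasurable.mul hm)
    (hH.integrable_indicator measurableSet_ball).norm (fun k => ae_of_all _ fun x => ?_)
    (ae_of_all _ fun x => ?_)
  · by_cases hx : x ∈ Metric.ball (0 : Plane) R
    · rw [indicator_of_mem hx, norm_mul, radialCutoff, Real.norm_of_nonneg (Real.smoothTransition.nonneg _)]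
      exact mul_le_of_le_one_left (norm_nonneg _) (Real.smoothTransition.le_one _)
    · rw [indicator_of_notMem hx, radialCutoff_eq_zero hR k (by simpa using hx)]
      simp
  · by_cases hx : x ∈ Metric.ball (0 : Plane) R
    · rw [indicator_of_mem hx]
      refine tendsto_const_nhds.congr' ?_
      filter_upwards [eventually_one_lt_mul_sq_sub (norm_nonneg x) (mem_ball_zero_iff.1 hx)] with k hk
      rw [radialCutoff, Real.smoothTransition.one_of_one_le hk.le, one_mul]
    · rw [indicator_of_notMem hx]
      refine tendsto_const_nhds.congr fun k => ?_
      rw [radialCutoff_eq_zero hR k (by simpa using hx), zero_mul]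

end RadialCutoff

/-- The Laplacian of a function on the plane, as a sum of iterated partial derivatives. -/
noncomputable def planeLaplacian (U : Plane → ℂ) (x : Plane) : ℂ :=
  ∑ i : Fin 2, fderiv ℝ (fun z => fderiv ℝ U z (planeBasis i)) x (planeBasis i)

theorem contDiff_fderiv_planeBasis {U : Plane → ℂ} (hU : ContDiff ℝ ∞ U) (i : Fin 2) :
    ContDiff ℝ ∞ fun z => fderiv ℝ U z (planeBasis i) :=
  (hU.fderiv_right (m := ∞) (by simp)).clm_apply contDiff_const

theorem continuous_planeLaplacian {U : Plane → ℂ} (hU : ContDiff ℝ ∞ U) :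
    Continuous (planeLaplacian U) :=
  continuous_finsetSum _ fun i _ =>
    ((contDiff_fderiv_planeBasis hU i).continuous_fderiv (by simp)).clm_apply continuous_const

theorem norm_planeLaplacian_le {U : Plane → ℂ} (hU : ContDiff ℝ ∞ U) (x : Plane) :
    ‖planeLaplacian U x‖ ≤ 2 * ‖fderiv ℝ (fderiv ℝ U) x‖ := by
  have h1 : ∀ i, ‖fderiv ℝ (fun z => fderiv ℝ U z (planeBasis i)) x (planeBasis i)‖
      ≤ ‖fderiv ℝ (fderiv ℝ U) x‖ := fun i => by
    have hd : HasFDerivAt (fderiv ℝ U) (fderiv ℝ (fderiv ℝ U) x) x :=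
      ((hU.fderiv_right (m := ∞) (by simp)).differentiable (by simp) x).hasFDerivAt
    have h2 := (hd.clm_apply (hasFDerivAt_const (planeBasis i) x)).fderiv
    rw [h2]
    have h3 := (fderiv ℝ (fderiv ℝ U) x).le_opNorm₂ (planeBasis i) (planeBasis i)
    simpa [norm_planeBasis] using h3
  refine (norm_sum_le _ _).trans ?_
  rw [Fin.sum_univ_two]
  linarith [h1 0, h1 1]

/-- If the radial derivative of `U` vanishes outside a ball, the gradient of `U` is orthogonal
to Sobolev gradients up to the Laplacian of `U`, without boundary terms on large balls. -/
theorem integral_ball_inner_fderiv {U v : Plane → ℂ} {g : Fin 2 → Plane → ℂ} {r R : ℝ}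
    (hU : ContDiff ℝ ∞ U) (hr : 0 ≤ r) (hrR : r < R)
    (hrad : ∀ x, r ≤ ‖x‖ → fderiv ℝ U x x = 0) (hv : MemLp v 2)
    (hg : ∀ i, IsWeakPartial i v (g i)) (hg2 : ∀ i, MemLp (g i) 2) :
    ∫ x in Metric.ball 0 R, ∑ i, inner ℝ (fderiv ℝ U x (planeBasis i)) (g i x) =
      -∫ x in Metric.ball 0 R, inner ℝ (planeLaplacian U x) (v x) := by
  have hR : 0 ≤ R := hr.trans hrR.le
  have hQ := contDiff_fderiv_planeBasis hU
  have hL2 : ∀ {f : Plane → ℂ}, Continuous f → MemLp f 2 (volume.restrict (Metric.ball 0 R)) :=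
    fun hf => memLp_of_continuous_of_subset_ball hf measurableSet_ball subset_rfl 2
  have t1 := tendsto_integral_radialCutoff_mul hR
    (H := fun x => ∑ i, inner ℝ (fderiv ℝ U x (planeBasis i)) (g i x))
    (integrable_finsetSum _ fun i _ =>
      (hL2 (hQ i).continuous).integrable_inner_two ((hg2 i).restrict _))
    (Finset.aestronglyMeasurable_fun_sum _ fun i _ =>
      (hQ i).continuous.aestronglyMeasurable.inner (hg2 i).1)
  have t2 := (tendsto_integral_radialCutoff_mul hR
    (H := fun x => inner ℝ (planeLaplacian U x) (v x))
    ((hL2 (continuous_planeLaplacian hU)).integrable_inner_two (hv.restrict _))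
    ((continuous_planeLaplacian hU).aestronglyMeasurable.inner hv.1)).neg
  refine tendsto_nhds_unique t1 (t2.congr' ?_)
  filter_upwards [eventually_one_lt_mul_sq_sub hr hrR] with k hk
  set ψ := radialCutoff R k with hψ
  have hψs : ContDiff ℝ ∞ ψ := contDiff_radialCutoff R k
  have hψc : HasCompactSupport ψ := hasCompactSupport_radialCutoff hR k
  have hq : ∀ i, ContDiff ℝ ∞ fun x => ψ x • fderiv ℝ U x (planeBasis i) :=
    fun i => hψs.smul (hQ i)
  have hqc : ∀ i, HasCompactSupport fun x => ψ x • fderiv ℝ U x (planeBasis i) :=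
    fun i => hψc.smul_right
  have hmem : ∀ {f : Plane → ℂ}, Continuous f → HasCompactSupport f → MemLp f 2 :=
    fun hf hc => hf.memLp_of_hasCompactSupport hc
  have hderiv : ∀ x i, fderiv ℝ (fun x => ψ x • fderiv ℝ U x (planeBasis i)) x (planeBasis i)
      = ψ x • fderiv ℝ (fun z => fderiv ℝ U z (planeBasis i)) x (planeBasis i)
        + fderiv ℝ ψ x (planeBasis i) • fderiv ℝ U x (planeBasis i) := fun x i => by
    rw [fderiv_fun_smul (hψs.differentiable (by simp) x) ((hQ i).differentiable (by simp) x)]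
    simp
  -- The would-be boundary term: for |x| ≥ r the radial derivative of U vanishes, and for |x| ≤ r
  -- the cutoff is locally constant once k(R² − r²) > 1.
  have hzero : ∀ x, ∑ i, fderiv ℝ ψ x (planeBasis i) • fderiv ℝ U x (planeBasis i) = 0 := by
    intro x
    rcases le_total r ‖x‖ with hx | hx
    · have h1 := hrad x hx
      conv at h1 => lhs; arg 2; rw [plane_eq_sum x]
      rw [map_add, map_smul, map_smul] at h1
      simp only [hψ, fderiv_radialCutoff, Fin.sum_univ_two]
      have h2 : ∀ i, inner ℝ x (planeBasis i) = x i := fun i => by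
        rw [planeBasis, EuclideanSpace.inner_single_right]; simp
      rw [h2, h2]
      set c := deriv Real.smoothTransition (k * (R ^ 2 - ‖x‖ ^ 2)) * (k * -2)
      rw [show deriv Real.smoothTransition (k * (R ^ 2 - ‖x‖ ^ 2)) * (k * -(2 * x 0)) = c * x 0 by
        ring, show deriv Real.smoothTransition (k * (R ^ 2 - ‖x‖ ^ 2)) * (k * -(2 * x 1)) = c * x 1 by
        ring, mul_smul c, mul_smul c, ← smul_add, h1, smul_zero]
    · have h1 : 1 < (k : ℝ) * (R ^ 2 - ‖x‖ ^ 2) := hk.trans_le (by gcongr)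
      refine Finset.sum_eq_zero fun i _ => ?_
      rw [hψ, fderiv_radialCutoff, deriv_smoothTransition_of_one_lt h1, zero_mul, zero_smul]
  have hparts := fun i => (hg i).integral_inner (hq i) (hqc i)
  have e1 : ∫ x, ψ x * ∑ i, inner ℝ (fderiv ℝ U x (planeBasis i)) (g i x)
      = ∑ i, ∫ x, inner ℝ (ψ x • fderiv ℝ U x (planeBasis i)) (g i x) := by
    rw [← integral_finsetSum _ fun i _ =>
      (hmem (hq i).continuous (hqc i)).integrable_inner_two (hg2 i)]
    simp_rw [Finset.mul_sum, real_inner_smul_left]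
  have e2 : ∫ x, ψ x * inner ℝ (planeLaplacian U x) (v x)
      = ∑ i, ∫ x, inner ℝ (fderiv ℝ (fun x => ψ x • fderiv ℝ U x (planeBasis i)) x
        (planeBasis i)) (v x) := by
    rw [← integral_finsetSum _ fun i _ => (hmem
      (((hq i).continuous_fderiv (by simp)).clm_apply continuous_const)
      (((hqc i).fderiv (𝕜 := ℝ)).comp_left (g := fun L : Plane →L[ℝ] ℂ => L (planeBasis i))
        rfl)).integrable_inner_two hv]
    refine integral_congr_ae (ae_of_all _ fun x => ?_)
    simp only [hderiv]
    rw [← sum_inner, Finset.sum_add_distrib, hzero, add_zero, ← Finset.smul_sum,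
      real_inner_smul_left, planeLaplacian]
  rw [e1, e2, ← Finset.sum_neg_distrib]
  exact Finset.sum_congr rfl fun i _ => by rw [hparts i, neg_neg]

/-! ### Finiteness of the renormalized energy. -/

/-- If |x| ≥ 2(r + |y|), the ball of radius |y| about x stays where |z| ≥ |x|/2 ≥ r. The mean value
inequality there turns Hessian decay into one extra power of decay for the difference of gradients.
-/
theorem exists_fderiv_translate_decay {U : Plane → ℂ} (hU : ContDiff ℝ ∞ U) {r C : ℝ} (hr : 1 ≤ r)
    (hC : 0 ≤ C) (h1 : ∀ x, r ≤ ‖x‖ → ‖fderiv ℝ U x‖ ≤ C / ‖x‖)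
    (h2 : ∀ x, r ≤ ‖x‖ → ‖fderiv ℝ (fderiv ℝ U) x‖ ≤ C / ‖x‖ ^ 2) (y : Plane) :
    ∃ r' C' : ℝ, r ≤ r' ∧ 0 ≤ C' ∧ ∀ x, r' ≤ ‖x‖ → r ≤ ‖x - y‖ ∧
      ‖fderiv ℝ U x‖ ≤ C' / ‖x‖ ∧ ‖fderiv ℝ U (x - y)‖ ≤ C' / ‖x‖ ∧
      ‖fderiv ℝ U (x - y) - fderiv ℝ U x‖ ≤ C' / ‖x‖ ^ 2 := by
  have hy := norm_nonneg y
  refine ⟨2 * (r + ‖y‖), max (2 * C) (4 * C * ‖y‖), by linarith, le_max_of_le_left (by positivity),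
    fun x hx => ?_⟩
  have hx0 : 0 < ‖x‖ := by linarith
  have hball : ∀ z ∈ Metric.closedBall x ‖y‖, ‖x‖ / 2 ≤ ‖z‖ := fun z hz => by
    have h3 : ‖x‖ - ‖z‖ ≤ ‖x - z‖ := norm_sub_norm_le _ _
    rw [mem_closedBall_iff_norm'] at hz
    linarith
  have hxr : r ≤ ‖x‖ / 2 := by linarith
  have hmem : x - y ∈ Metric.closedBall x ‖y‖ := by simp
  have hmem' : x ∈ Metric.closedBall x ‖y‖ := by simp
  refine ⟨hxr.trans (hball _ hmem), ?_, ?_, ?_⟩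
  · refine (h1 x (by linarith)).trans ?_
    gcongr
    exact le_max_of_le_left (by linarith)
  · refine (h1 _ (hxr.trans (hball _ hmem))).trans ?_
    calc C / ‖x - y‖ ≤ C / (‖x‖ / 2) := by gcongr; exact hball _ hmem
      _ = 2 * C / ‖x‖ := by field_simp
      _ ≤ _ := by gcongr; exact le_max_left _ _
  · have h3 := (convex_closedBall x ‖y‖).norm_image_sub_le_of_norm_fderiv_le (𝕜 := ℝ)
      (f := fderiv ℝ U) (C := 4 * C / ‖x‖ ^ 2)
      (fun z _ => (hU.fderiv_right (m := ∞) (by simp)).differentiable (by simp) z)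
      (fun z hz => (h2 z (hxr.trans (hball z hz))).trans (by
        calc C / ‖z‖ ^ 2 ≤ C / (‖x‖ / 2) ^ 2 := by gcongr; exact hball z hz
          _ = 4 * C / ‖x‖ ^ 2 := by field_simp; norm_num)) hmem' hmem
    refine h3.trans ?_
    rw [show x - y - x = -y by abel, norm_neg, div_mul_eq_mul_div]
    gcongr
    exact le_max_right _ _

/-- Neither square is assumed integrable, but the difference factors as O(|x|⁻¹)·O(|x|⁻²). -/
theorem integrable_norm_sq_sub_sq {P Q : Plane → ℂ} (hP : Continuous P) (hQ : Continuous Q)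
    {C r : ℝ} (hr : 1 ≤ r) (hP1 : ∀ x, r ≤ ‖x‖ → ‖P x‖ ≤ C / ‖x‖)
    (hQ1 : ∀ x, r ≤ ‖x‖ → ‖Q x‖ ≤ C / ‖x‖)
    (hPQ : ∀ x, r ≤ ‖x‖ → ‖P x - Q x‖ ≤ C / ‖x‖ ^ 2) :
    Integrable fun x => ‖P x‖ ^ 2 - ‖Q x‖ ^ 2 := by
  refine integrable_of_decay ((hP.norm.pow 2).sub (hQ.norm.pow 2)) (m := 3) le_rfl
    (C := C * (2 * C)) hr fun x hx => ?_
  have h0 : 0 < ‖x‖ := by linarith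
  rw [sq_sub_sq, norm_mul, Real.norm_eq_abs, Real.norm_eq_abs, abs_of_nonneg (by positivity)]
  have h1 := (abs_norm_sub_norm_le (P x) (Q x)).trans (hPQ x hx)
  calc (‖P x‖ + ‖Q x‖) * |‖P x‖ - ‖Q x‖| ≤ (C / ‖x‖ + C / ‖x‖) * (C / ‖x‖ ^ 2) := by
        gcongr
        · have := (norm_nonneg _).trans (hP1 x hx)
          positivity
        · exact hP1 x hx
        · exact hQ1 x hx
    _ = C * (2 * C) / ‖x‖ ^ 3 := by field_simp; ring

/-- The potential of a perturbation in `L² ∩ L⁴` of a smooth map of unit modulus at infinity. -/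
theorem integrable_potential {V v : Plane → ℂ} (hV : Continuous V) {r : ℝ}
    (hV1 : ∀ x, r ≤ ‖x‖ → ‖V x‖ = 1) (hv : MemLp v 2) (hv4 : MemLp v 4) :
    Integrable fun x => (‖V x + v x‖ ^ 2 - 1) ^ 2 := by
  obtain ⟨B, hB⟩ := (isCompact_closedBall (0 : Plane) r).exists_bound_of_continuousOn
    hV.continuousOn
  have hVb : ∀ x, ‖V x‖ ≤ max B 1 := fun x => by
    rcases le_total r ‖x‖ with hx | hx
    · exact (hV1 x hx).le.trans (le_max_right _ _)
    · exact (hB x (mem_closedBall_zero_iff.2 hx)).trans (le_max_left _ _)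
  -- Expanding |V + v|² − 1 gives three terms in L²: |V|² − 1 has compact support, V is bounded
  -- against v in L², and |v|² is the square of an L⁴ function.
  have h1 : MemLp (fun x => ‖V x‖ ^ 2 - 1) 2 :=
    ((hV.norm.fun_pow 2).fun_sub continuous_const).memLp_of_hasCompactSupport
      (HasCompactSupport.intro (isCompact_closedBall 0 r) fun x hx => by
        rw [mem_closedBall_zero_iff, not_le] at hx
        rw [hV1 x hx.le]; norm_num)
  have h2 : MemLp (fun x => 2 * inner ℝ (V x) (v x)) 2 :=
    (hv.of_le_mul (c := max B 1) (hV.aestronglyMeasurable.inner hv.1) (ae_of_all _ fun x =>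
      (norm_inner_le_norm _ _).trans (by gcongr; exact hVb x))).const_mul 2
  have h3 : MemLp (fun x => ‖v x‖ ^ 2) 2 := by
    rw [memLp_two_iff_integrable_sq (f := fun x => ‖v x‖ ^ 2) (hv.1.norm.pow 2)]
    have h4 := hv4.integrable_norm_pow (p := 4) (by norm_num)
    refine h4.congr (ae_of_all _ fun x => ?_)
    simp only
    ring
  refine ((h1.add h2).add h3).integrable_sq.congr (ae_of_all _ fun x => ?_)
  simp only [Pi.add_apply]
  rw [norm_add_sq_real]
  ring

/-- The renormalized energy is finite. -/
theorem tendsto_excessEnergy {D : ℤ} {U u : Plane → ℂ} (hU : IsReferenceMap D U) (hD : 0 < D)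
    (hu : MemTranslatesAddH1 U u) (ε : ℝ) :
    Tendsto (excessEnergy ε U u) atTop (𝓝 (renormalizedEnergy ε U u)) := by
  refine tendsto_nhds_limUnder ?_
  obtain ⟨y, v, hv, huv⟩ := hu
  have hUs := hU.smooth
  obtain ⟨r, C, hr, hC, has⟩ := hU.asymptotics hD
  obtain ⟨r', C', hrr', -, hdec⟩ := exists_fderiv_translate_decay hUs hr hC
    (fun x hx => (has x hx).2.2.1) (fun x hx => (has x hx).2.2.2) y
  have hr' := hr.trans hrr'
  have hv4 := hv.memLp_four
  obtain ⟨hv2, hvg⟩ := hv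
  choose g hg hg2 using hvg
  have hVs : ContDiff ℝ ∞ fun x => U (x - y) := hUs.comp (contDiff_id.sub contDiff_const)
  have hQs := contDiff_fderiv_planeBasis hUs
  set Q : Fin 2 → Plane → ℂ := fun i x => fderiv ℝ U x (planeBasis i) with hQdef
  set P : Fin 2 → Plane → ℂ := fun i x => fderiv ℝ U (x - y) (planeBasis i) with hPdef
  have hPc : ∀ i, Continuous (P i) := fun i =>
    (hQs i).continuous.comp (continuous_id.sub continuous_const)
  have hQc : ∀ i, Continuous (Q i) := fun i => (hQs i).continuous
  have hweak : ∀ i, weakPartial i u =ᵐ[volume] fun x => P i x + g i x := fun i => by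
    have h1 := ((isWeakPartial_of_contDiff i (hVs.of_le (by simp))).add (hg i)).weakPartial_ae_eq
    rw [show u = (fun x => U (x - y)) + v from funext huv]
    refine h1.trans (ae_of_all _ fun x => ?_)
    simp only [hPdef, Pi.add_apply, fderiv_comp_sub]
  have hle : ∀ (L : Plane →L[ℝ] ℂ) (i : Fin 2), ‖L (planeBasis i)‖ ≤ ‖L‖ := fun L i => by
    simpa [norm_planeBasis] using L.le_opNorm (planeBasis i)
  have hP1 : ∀ i x, r' ≤ ‖x‖ → ‖P i x‖ ≤ C' / ‖x‖ :=
    fun i x hx => (hle _ i).trans (hdec x hx).2.2.1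
  have hQ1 : ∀ i x, r' ≤ ‖x‖ → ‖Q i x‖ ≤ C' / ‖x‖ :=
    fun i x hx => (hle _ i).trans (hdec x hx).2.1
  have hPQ : ∀ i x, r' ≤ ‖x‖ → ‖P i x - Q i x‖ ≤ C' / ‖x‖ ^ 2 :=
    fun i x hx => (hle (fderiv ℝ U (x - y) - fderiv ℝ U x) i).trans (hdec x hx).2.2.2
  have hPQ2 : ∀ i, MemLp (fun x => P i x - Q i x) 2 := fun i =>
    memLp_two_of_decay ((hPc i).sub (hQc i)) hr' (hPQ i)
  have hL2 : MemLp (planeLaplacian U) 2 :=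
    memLp_two_of_decay (continuous_planeLaplacian hUs) hr (C := 2 * C) fun x hx =>
      (norm_planeLaplacian_le hUs x).trans (by
        rw [mul_div_assoc]; gcongr; exact (has x hx).2.2.2)
  have hpot : Integrable fun x => (‖u x‖ ^ 2 - 1) ^ 2 := by
    rw [show u = fun x => U (x - y) + v x from funext huv]
    exact integrable_potential hVs.continuous (fun x hx => (has _ (hdec x hx).1).1) hv2 hv4
  -- The excess density with the single term ∇U·∇v removed; replacing U(· − y) by U in the cross
  -- term costs only a product of L² functions.
  set F : Plane → ℝ := fun x => (1 / 2) * (∑ i, ((‖P i x‖ ^ 2 - ‖Q i x‖ ^ 2)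
    + 2 * inner ℝ (P i x - Q i x) (g i x) + ‖g i x‖ ^ 2))
    + 1 / (4 * ε ^ 2) * (‖u x‖ ^ 2 - 1) ^ 2 with hF
  have hFi : Integrable F :=
    ((integrable_finsetSum _ fun i _ =>
      ((integrable_norm_sq_sub_sq (hPc i) (hQc i) hr' (hP1 i) (hQ1 i) (hPQ i)).add
        (((hPQ2 i).integrable_inner_two (hg2 i)).const_mul 2)).add
        ((memLp_two_iff_integrable_sq_norm (hg2 i).1).1 (hg2 i))).const_mul (1 / 2)).add
      (hpot.const_mul _)
  have hLi := hL2.integrable_inner_two hv2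
  have hlim := (aecover_ball (μ := (volume : Measure Plane)) (x := 0)
    tendsto_id).integral_tendsto_of_countably_generated (hFi.sub hLi)
  refine ⟨_, hlim.congr' ?_⟩
  filter_upwards [eventually_gt_atTop r] with R hR
  -- On each large ball the removed term becomes −∫ΔU·v, now the integral of a function integrable
  -- on the whole plane.
  have hcross := integral_ball_inner_fderiv hUs (zero_le_one.trans hr) hR
    (fun x hx => (has x hx).2.1) hv2 hg hg2
  have hQg : IntegrableOn (fun x => ∑ i, inner ℝ (Q i x) (g i x)) (Metric.ball 0 R) :=
    integrable_finsetSum _ fun i _ =>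
      (memLp_of_continuous_of_subset_ball (hQc i) measurableSet_ball subset_rfl
        2).integrable_inner_two ((hg2 i).restrict _)
  have hsplit : excessEnergy ε U u R
      = ∫ x in Metric.ball 0 R, (F x + ∑ i, inner ℝ (Q i x) (g i x)) := by
    refine integral_congr_ae (ae_restrict_of_ae ?_)
    filter_upwards [hweak 0, hweak 1] with x h0 h1
    simp only [energyDensity, gradSq, hF, Fin.sum_univ_two, h0, h1]
    rw [norm_add_sq_real, norm_add_sq_real, inner_sub_left, inner_sub_left]
    ring
  rw [hsplit, integral_add hFi.integrableOn hQg, hcross, ← sub_eq_add_neg]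
  exact integral_sub hFi.integrableOn hLi.integrableOn

/-! ### Return to radii and conclusion. -/

theorem four_le_vortexRadius {n : ℕ} (α : Fin n → Plane) : 4 ≤ vortexRadius α := le_max_left _ _

theorem four_mul_norm_le_vortexRadius {n : ℕ} (α : Fin n → Plane) (i : Fin n) :
    4 * ‖α i‖ ≤ vortexRadius α :=
  le_max_of_le_right (by
    gcongr
    exact le_ciSup (f := fun j => ‖α j‖) (Set.finite_range _).bddAbove i)

theorem integrableOn_energyDensity_ball {U u : Plane → ℂ} (hU : ContDiff ℝ ∞ U)
    (hu : MemTranslatesAddH1 U u) (ε R : ℝ) :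
    IntegrableOn (energyDensity ε u) (Metric.ball 0 R) := by
  obtain ⟨w, -, h⟩ := exists_smooth_approximation_energy hU hu
  exact ((h (Metric.ball 0 R) R measurableSet_ball subset_rfl).1 ε).1

theorem locallyIntegrable_energyDensity {U u : Plane → ℂ} (hU : ContDiff ℝ ∞ U)
    (hu : MemTranslatesAddH1 U u) (ε : ℝ) : LocallyIntegrable (energyDensity ε u) := fun x =>
  ⟨Metric.ball 0 (‖x‖ + 1), Metric.isOpen_ball.mem_nhds (by simp),
    integrableOn_energyDensity_ball hU hu ε _⟩

/-- The energy lower bound on annuli, in terms of the radii. -/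
theorem annulus_lower_bound_radii {D : ℤ} {U u : Plane → ℂ} {n : ℕ} {α : Fin n → Plane}
    {d : Fin n → ℤ} {ε s R₁ R₂ : ℝ} (hU : ContDiff ℝ ∞ U) (hu : MemTranslatesAddH1 U u)
    (hs : XlnDualNorm (vorticityDefect u d α) ≤ ((s : ℝ) : EReal)) (hdD : ∑ i, d i = D)
    (hD : 0 < D) (hε : 0 < ε) (hsD : s * (D : ℝ) ^ 2 ≤ 1 / 1000)
    (hεD : ε * (D : ℝ) ^ 2 ≤ 1 / 1000) (hR₁ : vortexRadius α ≤ R₁) (hR₂ : 2 * R₁ ≤ R₂) :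
    - (Real.pi * (D : ℝ) ^ 4 * (ε / R₁)) ≤
      (∫ x in Metric.ball (0 : Plane) R₂ \ Metric.ball (0 : Plane) R₁, energyDensity ε u x)
        - Real.pi * (D : ℝ) ^ 2 * Real.log (R₂ / R₁) := by
  have h4 : 4 ≤ R₁ := (four_le_vortexRadius α).trans hR₁
  have hR₁0 : 0 < R₁ := by linarith
  have hR₂0 : 0 < R₂ := by linarith
  have he : Real.exp 1 < 3 := Real.exp_one_lt_d9.trans (by norm_num)
  have hD1 : (1 : ℝ) ≤ (D : ℝ) := by exact_mod_cast hD
  have hab : Real.log R₁ + Real.log 2 ≤ Real.log R₂ := by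
    rw [← Real.log_mul hR₁0.ne' (by norm_num)]
    exact Real.log_le_log (by positivity) (by linarith)
  -- The profiles start one logarithmic unit inside R₁; since e < 4, the vortices still lie in |x| <
  -- R₁/e.
  have hα : ∀ i, ‖α i‖ < Real.exp (Real.log R₁ - 1) := fun i => by
    have h5 := (four_mul_norm_le_vortexRadius α i).trans hR₁
    rw [Real.exp_sub, Real.exp_log hR₁0, lt_div_iff₀ (Real.exp_pos 1)]
    have := norm_nonneg (α i)
    nlinarith
  have ha : 1 < Real.log R₁ := by
    rw [Real.lt_log_iff_exp_lt hR₁0]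
    linarith
  have key := annulus_lower_bound hU hu hs hdD (by exact_mod_cast hD) hε hsD hεD ha hab hα
  rw [Real.exp_log hR₁0, Real.exp_log hR₂0, ← Real.log_div hR₂0.ne' hR₁0.ne'] at key
  have hexp : Real.exp (-2 * Real.log R₁) = 1 / R₁ ^ 2 := by
    rw [show -2 * Real.log R₁ = -(Real.log R₁ + Real.log R₁) by ring, Real.exp_neg, Real.exp_add,
      Real.exp_log hR₁0, sq, one_div]
  rw [hexp] at key
  have hε1 : ε ≤ 1 := by nlinarith
  -- The quadratic error is weakened to the linear one, using ε ≤ 1 ≤ R₁.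
  have h6 : ε ^ 2 * (1 / R₁ ^ 2) ≤ ε / R₁ := by
    rw [mul_one_div, ← div_pow, sq]
    refine mul_le_of_le_one_left (by positivity) ?_
    rw [div_le_one hR₁0]
    linarith
  have h7 : Real.pi * (D : ℝ) ^ 4 * (ε ^ 2 * (1 / R₁ ^ 2)) ≤ Real.pi * (D : ℝ) ^ 4 * (ε / R₁) := by
    gcongr
  linarith

theorem integrableOn_gradSq_ball {U : Plane → ℂ} (hU : ContDiff ℝ ∞ U) (R : ℝ) :
    IntegrableOn (gradSq U) (Metric.ball 0 R) := by
  have h1 : Continuous (gradSq U) := continuous_finsetSum _ fun i _ =>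
    ((contDiff_fderiv_planeBasis hU i).continuous.norm.pow 2)
  exact (h1.locallyIntegrable.integrableOn_isCompact (isCompact_closedBall 0 R)).mono_set
    Metric.ball_subset_closedBall

theorem mainTheorem6 :
    ∃ c₁ : ℝ, 0 < c₁ ∧ ∃ C : ℝ, 0 < C ∧
      ∀ (D : ℤ) (U : Plane → ℂ) (u : Plane → ℂ) (n : ℕ) (α : Fin n → Plane) (d : Fin n → ℤ)
        (ε s : ℝ),
        IsReferenceMap D U →
        MemTranslatesAddH1 U u →
        XlnDualNorm (vorticityDefect u d α) ≤ ((s : ℝ) : EReal) →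
        ∑ i, d i = D →
        0 < D →
        0 < ε →
        s * (D : ℝ) ^ 2 ≤ c₁ →
        ε * (D : ℝ) ^ 2 < c₁ →
        LocallyIntegrable (energyDensity ε u) ∧
        (∀ R₁ R₂ : ℝ, vortexRadius α ≤ R₁ → 2 * R₁ ≤ R₂ →
          - (C * (D : ℝ) ^ 4 * (ε / R₁)) ≤
            (∫ x in Metric.ball (0 : Plane) R₂ \ Metric.ball (0 : Plane) R₁, energyDensity ε u x)
              - Real.pi * (D : ℝ) ^ 2 * Real.log (R₂ / R₁)) ∧
        Tendsto (excessEnergy ε U u) atTop (𝓝 (renormalizedEnergy ε U u)) ∧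
        (∀ R : ℝ, vortexRadius α ≤ R →
          ∫ x in Metric.ball (0 : Plane) R, energyDensity ε u x ≤
            renormalizedEnergy ε U u + Real.pi * (D : ℝ) ^ 2 * Real.log R
              + C * (D : ℝ) ^ 4 * (ε / R)) := by
  refine ⟨1 / 1000, by norm_num, Real.pi, Real.pi_pos, fun D U u n α d ε s hU hu hs hdD hD hε hsD
    hεD => ?_⟩
  have hann := fun R₁ R₂ h1 h2 => annulus_lower_bound_radii (R₁ := R₁) (R₂ := R₂) hU.smooth hu hs
    hdD hD hε hsD hεD.le h1 h2
  have hlim := tendsto_excessEnergy hU hD hu ε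
  refine ⟨locallyIntegrable_energyDensity hU.smooth hu ε, hann, hlim, fun R hR => ?_⟩
  have h4 : 4 ≤ R := (four_le_vortexRadius α).trans hR
  have hint := integrableOn_energyDensity_ball hU.smooth hu ε
  -- For finite R' ≥ 2R the inequality holds with the excess energy of B_{R'} in place of its limit:
  -- the terms πD² ln R' from the annulus and from the normalization of U cancel.
  refine ge_of_tendsto ((hlim.add_const _).add_const _) ?_
  filter_upwards [eventually_ge_atTop (2 * R)] with R' hR'
  have h5 := hann R R' hR hR'
  have hsub : Metric.ball (0 : Plane) R ⊆ Metric.ball 0 R' := Metric.ball_subset_ball (by linarith)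
  rw [setIntegral_sdiff measurableSet_ball (hint R') hsub,
    Real.log_div (by linarith) (by linarith)] at h5
  have h6 : excessEnergy ε U u R' = (∫ x in Metric.ball 0 R', energyDensity ε u x)
      - Real.pi * (D : ℝ) ^ 2 * Real.log R' := by
    rw [excessEnergy, integral_sub (hint R') ((integrableOn_gradSq_ball hU.smooth R').const_mul _),
      integral_const_mul, hU.normalized R' (by linarith)]
  rw [h6]
  linarith
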